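/- Let $k$ be a commutative ring and $H$ a commutative Hopf algebra over $k$ with antipode $S$ (so $S^2=\mathrm{id}$). Unadorned $\otimes$ is over $k$, Sweedler notation is used, and $H$-modules are regarded as symmetric $H$-bimodules. **Galois co-objects.** A right $H$-module coalgebra $C$ ($\Delta(ch)=c_{1}h_{1}\otimes c_{2}h_{2}$, $\varepsilon(ch)=\varepsilon(c)\varepsilon(h)$) is a *Galois co-object* if the adjoint pair $(-\otimes_H k,\ -\otimes C)$ between $(H,C)$-Hopf modules and $k$-modules is an inverse equivalence (its unit and counit are isomorphisms). If $C,D$ are $H$-module coalgebras, $C\otimes_H D$ is one by $\Delta(c\otimes_H d)=(c_1\otimes_H d_1)\otimes(c_2\otimes_H d_2)$, $\varepsilon(c\otimes_H d)=\varepsilon(c)\varepsilon(d)$, $(c\otimes_Hd)h=c\otimes_Hdh$. **Herds.** A herd (over $k\to H$ on both sides) is an $H$-module $T$ with an $H$-module $\widehat T$ (the pen), $H$-bimodule maps $\mathrm{ev}:\widehat T\otimes T\to H$, $\widehat{\mathrm{ev}}:T\otimes\widehat T\to H$ with $\widehat{\mathrm{ev}}(x\otimes\hat y)z=x\,\mathrm{ev}(\hat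 y\otimes z)$ and $\mathrm{ev}(\hat x\otimes y)\hat z=\hat x\,\widehat{\mathrm{ev}}(y\otimes\hat z)$, and a $k$-linear map (the shepherd) $\gamma:T\to T\otimes\widehat T\otimes T$ with $(\widehat{\mathrm{ev}}\otimes T)\gamma(x)=1_H\otimes x$, $(T\otimes\mathrm{ev})\gamma(x)=x\otimes 1_H$ and $(\gamma\otimes\widehat T\otimes T)\gamma=(T\otimes\widehat T\otimes\gamma)\gamma$. Then $\widehat T\otimes T$ and $T\otimes\widehat T$ are $H$-corings with coproducts $\widehat T\otimes\gamma$ and $\gamma\otimes\widehat T$ (projected to $\otimes_H$ in the middle) and counits $\mathrm{ev}$, $\widehat{\mathrm{ev}}$. **The herd of a Galois co-object.** If $\delta_C:C\otimes H\to C\otimes C$, $c\otimes h\mapsto c_1\otimes c_2h$, is bijective, the herd data associated to $C$ are: the pen $\widehat C$, which is the $k$-module $C$ with action $h\rightharpoonup\hat c=\hat c\,S(h)$; $\mathrm{ev}_C=(\varepsilon_C\otimes H)\circ\delta_C^{-1}$, $\widehat{\mathrm{ev}}_C=S\circ\mathrm{ev}_C$; and the shepherd $\Delta_C^2=(\Delta_C\otimes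 C)\circ\Delta_C:C\to C\otimes\widehat C\otimes C$. **Composition.** Let $(T,\gamma_T)$, $(P,\gamma_P)$ be herds with corings $\mathcal C=\widehat T\otimes T$ and $\mathcal D=P\otimes\widehat P$, and let $\sigma:\mathcal C\otimes_H\mathcal D\to\mathcal D\otimes_H\mathcal C$ be an $H$-bimodule map. It defines a smash coproduct if $(\sigma\otimes_H\mathcal C)(\mathcal C\otimes_H\sigma)(\Delta_{\mathcal C}\otimes_H\mathcal D)=(\mathcal D\otimes_H\Delta_{\mathcal C})\sigma$, $(\mathcal D\otimes_H\sigma)(\sigma\otimes_H\mathcal D)(\mathcal C\otimes_H\Delta_{\mathcal D})=(\Delta_{\mathcal D}\otimes_H\mathcal C)\sigma$, $(\varepsilon_{\mathcal D}\otimes_H\mathcal C)\sigma=\mathcal C\otimes_H\varepsilon_{\mathcal D}$ and $(\mathcal D\otimes_H\varepsilon_{\mathcal C})\sigma=\varepsilon_{\mathcal C}\otimes_H\mathcal D$. The composite of $T$ and $P$ along $\sigma$ is $T\otimes_HP$ with pen $\widehat P\otimes_H\widehat T$, evaluation $\mathrm{ev}_P\circ(\widehat P\otimes_H\mathrm{ev}_T\otimes_HP)$,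 coevaluation $\widehat{\mathrm{ev}}_T\circ(T\otimes_H\widehat{\mathrm{ev}}_P\otimes_H\widehat T)$, and shepherd $(T\otimes_H\sigma\otimes_HP)\circ(\gamma_{T,H}\otimes_H\gamma_{P,H})$, where $\gamma_{T,H}$ and $\gamma_{P,H}$ are the projections of $\gamma_T$ and $\gamma_P$ to $T\otimes_H\widehat T\otimes T$ and $P\otimes\widehat P\otimes_HP$. **Theorem.** Let $C$ and $D$ be Galois co-objects for $H$. Then $C\otimes_HD$ is a Galois co-object, the maps $\delta_C,\delta_D,\delta_{C\otimes_HD}$ are bijective, and the data associated to $C$, $D$ and $C\otimes_HD$ are herds. There is a unique $H$-bimodule map $\sigma:(\widehat C\otimes C)\otimes_H(D\otimes\widehat D)\to(D\otimes\widehat D)\otimes_H(\widehat C\otimes C)$ with $$\sigma(c_1\otimes c_2\otimes_Hd_1\otimes d_2h)=d_1\otimes d_2\otimes_Hc_1\otimes c_2S(h)\qquad(c\in C,\ d\in D,\ h\in H),$$ it defines a smash coproduct, and the composite of the herds of $C$ and $D$ along $\sigma$ is a herd. The twist $\tau:\widehat{C\otimes_HD}\to\widehat D\otimes_H\widehat C$,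 $\widehat{c\otimes_Hd}\mapsto\hat d\otimes_H\hat c$, is a well-defined isomorphism of $H$-modules which identifies the herd of $C\otimes_HD$ with this composite: it carries $\mathrm{ev}_{C\otimes_HD}$ and $\widehat{\mathrm{ev}}_{C\otimes_HD}$ to the evaluation and coevaluation of the composite, and the shepherd of the composite is $$(C\otimes_HD\otimes\tau\otimes C\otimes_HD)\circ\Delta^2_{C\otimes_HD}=(C\otimes_H\sigma\otimes_HD)\circ(\Delta^2_{C,H}\otimes_H\Delta^2_{D,H}).$$ -/

import Mathlib

open scoped TensorProduct

universe u

namespace HerdTheory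

noncomputable section

open TensorProduct

/-! ### Balanced maps -/

section Balanced

variable {k H M N L : Type*} [CommRing k] [CommRing H] [Algebra k H]
  [AddCommGroup M] [Module k M] [Module H M] [IsScalarTower k H M]
  [AddCommGroup N] [Module k N] [Module H N]
  [AddCommGroup L] [Module k L]

/-- The `k`-linear map `M ⊗_H N → L` induced by an `H`-balanced `k`-bilinear map. -/
def liftBal (f : M →ₗ[k] N →ₗ[k] L) (hf : ∀ (h : H) (m : M) (n : N), f (h • m) n = f m (h • n)) :
    M ⊗[H] N →ₗ[k] L :=
  { TensorProduct.liftAddHom (R := H)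
      (LinearMap.toAddMonoidHom'.comp f.toAddMonoidHom) hf with
    map_smul' := by
      intro a z
      induction z with
      | zero => simp
      | tmul m n =>
        change f (a • m) n = a • f m n
        simp
      | add x y hx hy =>
        simp only [smul_add] at *
        simp_all }

@[simp]
theorem liftBal_tmul (f : M →ₗ[k] N →ₗ[k] L)
    (hf : ∀ (h : H) (m : M) (n : N), f (h • m) n = f m (h • n)) (m : M) (n : N) :
    liftBal f hf (m ⊗ₜ[H] n) = f m n := rfl

/-- The canonical surjection `M ⊗_k N → M ⊗_H N`; it is `H`-linear. -/
abbrev proj (k H M N : Type*) [CommRing k] [CommRing H] [Algebra k H]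
    [AddCommGroup M] [Module k M] [Module H M] [IsScalarTower k H M]
    [AddCommGroup N] [Module k N] [Module H N] [IsScalarTower k H N] :
    M ⊗[k] N →ₗ[H] M ⊗[H] N :=
  TensorProduct.mapOfCompatibleSMul H k H M N

end Balanced

/-- The action of `H` on `M` as a `k`-bilinear map. -/
def act (k H : Type*) [CommRing k] [CommRing H] [Algebra k H] (M : Type*) [AddCommGroup M]
    [Module k M] [Module H M] [IsScalarTower k H M] : H →ₗ[k] M →ₗ[k] M :=
  (Algebra.lsmul k k M).toLinearMap

@[simp]
theorem act_apply (k H : Type*) [CommRing k] [CommRing H] [Algebra k H] (M : Type*)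
    [AddCommGroup M] [Module k M] [Module H M] [IsScalarTower k H M] (h : H) (m : M) :
    act k H M h m = h • m := rfl

theorem act_one (k H : Type*) [CommRing k] [CommRing H] [Algebra k H] (M : Type*)
    [AddCommGroup M] [Module k M] [Module H M] [IsScalarTower k H M] :
    act k H M 1 = LinearMap.id := by
  ext; simp

/-! ### Module coalgebras, Hopf modules and Galois co-objects -/

section ModuleCoalgebra

variable (k H : Type u) [CommRing k] [CommRing H] [HopfAlgebra k H]

/-- `C` is an `H`-module coalgebra: `Δ(ch) = c₁h₁ ⊗ c₂h₂` and `ε(ch) = ε(c)ε(h)`. As `H` is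
commutative, right `H`-modules are written as left `H`-modules. -/
class ModuleCoalgebra (C : Type*) [AddCommGroup C] [Module k C] [Module H C]
    [IsScalarTower k H C] [Coalgebra k C] : Prop where
  comul_smul : ∀ (h : H) (c : C), Coalgebra.comul (R := k) (h • c) =
    TensorProduct.map₂ (act k H C) (act k H C) (Coalgebra.comul (R := k) h)
      (Coalgebra.comul (R := k) c)
  counit_smul : ∀ (h : H) (c : C), Coalgebra.counit (R := k) (h • c) =
    Coalgebra.counit (R := k) h * Coalgebra.counit (R := k) c

variable {k} in
/-- `ρ : M → M ⊗ C` makes the `H`-module `M` an `(H, C)`-Hopf module: it is a coassociative and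
counital coaction with `ρ(mh) = m₀h₁ ⊗ m₁h₂`. -/
structure IsHopfModule {C M : Type*} [AddCommGroup C] [Module k C] [Module H C]
    [IsScalarTower k H C] [Coalgebra k C] [AddCommGroup M] [Module k M] [Module H M]
    [IsScalarTower k H M] (ρ : M →ₗ[k] M ⊗[k] C) : Prop where
  coassoc : TensorProduct.assoc k M C C ∘ₗ ρ.rTensor C ∘ₗ ρ =
    (Coalgebra.comul (R := k) (A := C)).lTensor M ∘ₗ ρ
  counital : ∀ m : M, (Coalgebra.counit (R := k) (A := C)).lTensor M (ρ m) = m ⊗ₜ[k] (1 : k)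
  map_smul : ∀ (h : H) (m : M), ρ (h • m) =
    TensorProduct.map₂ (act k H M) (act k H C) (Coalgebra.comul (R := k) h) (ρ m)

/-- `k` as an `H`-module through the counit of `H`. -/
def CounitModule (_H : Type u) : Type u := k

instance : AddCommGroup (CounitModule k H) := inferInstanceAs (AddCommGroup k)

instance : Module k (CounitModule k H) := inferInstanceAs (Module k k)

instance : Module H (CounitModule k H) :=
  Module.compHom k (Bialgebra.counitAlgHom k H : H →+* k)

theorem CounitModule.smul_def (h : H) (a : CounitModule k H) :
    h • a = (Coalgebra.counit (R := k) h • a : CounitModule k H) := rfl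

instance : IsScalarTower k H (CounitModule k H) where
  smul_assoc a h b := by
    rw [CounitModule.smul_def, CounitModule.smul_def, map_smul, smul_assoc]

/-- The unit of `k`, as an element of `CounitModule k H`. -/
def CounitModule.one : CounitModule k H := (1 : k)

/-- `CounitModule k H` is `k` as a `k`-module. -/
def CounitModule.equiv : CounitModule k H ≃ₗ[k] k := LinearEquiv.refl k k

variable {k} in
/-- For a Hopf module `M`, the unit `M → (M ⊗_H k) ⊗ C`, `m ↦ (m₀ ⊗ 1) ⊗ m₁`, of the adjunction
between `- ⊗_H k` (from `(H, C)`-Hopf modules to `k`-modules) and `- ⊗ C` in the other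
direction. -/
def adjUnit {C M : Type u} [AddCommGroup C] [Module k C] [AddCommGroup M] [Module k M] [Module H M]
    [IsScalarTower k H M] (ρ : M →ₗ[k] M ⊗[k] C) :
    M →ₗ[k] (M ⊗[H] CounitModule k H) ⊗[k] C :=
  ((((TensorProduct.mk H M (CounitModule k H)).flip
    (CounitModule.one k H)).restrictScalars k).rTensor C) ∘ₗ ρ

/-- The counit `(N ⊗ C) ⊗_H k → N`, `(n ⊗ c) ⊗ a ↦ a ε(c) n`, of the same adjunction. The tensor
product `N ⊗ C` is written `C ⊗ N`; `H` acts on `C`. -/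
def adjCounit (C N : Type u) [AddCommGroup C] [Module k C] [Module H C] [IsScalarTower k H C]
    [Coalgebra k C] [ModuleCoalgebra k H C] [AddCommGroup N] [Module k N] :
    (C ⊗[k] N) ⊗[H] CounitModule k H →ₗ[k] N :=
  liftBal
    (((LinearMap.lsmul k N).flip.compl₂ (CounitModule.equiv k H).toLinearMap) ∘ₗ
      ((TensorProduct.lid k N).toLinearMap ∘ₗ
        (Coalgebra.counit (R := k) (A := C)).rTensor N))
    (by
      intro h z a
      induction z with
      | zero => simp
      | tmul c n =>
        rw [CounitModule.smul_def, TensorProduct.smul_tmul']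
        simp [ModuleCoalgebra.counit_smul, smul_smul, mul_assoc]
      | add x y hx hy =>
        simp only [smul_add, map_add, LinearMap.add_apply, hx, hy])

/-- An `H`-module coalgebra `C` is a Galois co-object if the adjoint pair `(- ⊗_H k, - ⊗ C)`
between `(H, C)`-Hopf modules and `k`-modules is an inverse equivalence, that is, its unit and its
counit are isomorphisms. -/
structure IsGaloisCoobject (C : Type u) [AddCommGroup C] [Module k C] [Module H C]
    [IsScalarTower k H C] [Coalgebra k C] [ModuleCoalgebra k H C] : Prop where
  counit_bijective : ∀ (N : Type u) [AddCommGroup N] [Module k N],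
    Function.Bijective (adjCounit k H C N)
  unit_bijective : ∀ (M : Type u) [AddCommGroup M] [Module k M] [Module H M]
    [IsScalarTower k H M] (ρ : M →ₗ[k] M ⊗[k] C), IsHopfModule H ρ →
      Function.Bijective (adjUnit H ρ)

/-- The map `δ : C ⊗ H → C ⊗ C`, `c ⊗ h ↦ c₁ ⊗ c₂h`. -/
def delta (C : Type*) [AddCommGroup C] [Module k C] [Module H C] [IsScalarTower k H C]
    [Coalgebra k C] : C ⊗[k] H →ₗ[k] C ⊗[k] C :=
  (TensorProduct.lift (act k H C).flip).lTensor C ∘ₗ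
    (TensorProduct.assoc k C C H).toLinearMap ∘ₗ
      (Coalgebra.comul (R := k) (A := C)).rTensor H

end ModuleCoalgebra

/-! ### The composed module coalgebra -/

section Composition

variable {k H C D : Type u} [CommRing k] [CommRing H] [HopfAlgebra k H]
  [AddCommGroup C] [Module k C] [Module H C] [IsScalarTower k H C] [Coalgebra k C]
  [ModuleCoalgebra k H C]
  [AddCommGroup D] [Module k D] [Module H D] [IsScalarTower k H D] [Coalgebra k D]
  [ModuleCoalgebra k H D]

variable (k H C D) in
/-- `c ⊗_H d ↦ (c₁ ⊗_H d₁) ⊗ (c₂ ⊗_H d₂)`. -/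
def comulComp : C ⊗[H] D →ₗ[k] (C ⊗[H] D) ⊗[k] (C ⊗[H] D) :=
  liftBal
    (TensorProduct.curry
      (TensorProduct.map ((proj k H C D).restrictScalars k) ((proj k H C D).restrictScalars k) ∘ₗ
        (TensorProduct.tensorTensorTensorComm k C C D D).toLinearMap ∘ₗ
          TensorProduct.map (Coalgebra.comul (R := k)) (Coalgebra.comul (R := k))))
    (by
      intro h c d
      simp only [curry_apply, LinearMap.comp_apply, TensorProduct.map_tmul,
        ModuleCoalgebra.comul_smul]
      generalize Coalgebra.comul (R := k) h = x
      generalize Coalgebra.comul (R := k) c = y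
      generalize Coalgebra.comul (R := k) d = z
      induction x with
      | zero => simp
      | add x x' hx hx' => simp only [map_add, LinearMap.add_apply, add_tmul, tmul_add, hx, hx']
      | tmul a a' =>
      induction y with
      | zero => simp
      | add x x' hx hx' => simp only [map_add, add_tmul, hx, hx']
      | tmul c c' =>
      induction z with
      | zero => simp
      | add x x' hx hx' => simp only [map_add, tmul_add, hx, hx']
      | tmul d d' => simp [TensorProduct.smul_tmul])

variable (k H C D) in
/-- `c ⊗_H d ↦ ε(c)ε(d)`. -/
def counitComp : C ⊗[H] D →ₗ[k] k :=
  liftBal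
    (((LinearMap.mul k k).compl₂ (Coalgebra.counit (R := k) (A := D))) ∘ₗ
      Coalgebra.counit (R := k) (A := C))
    (by
      intro h c d
      simp [ModuleCoalgebra.counit_smul, mul_assoc, mul_left_comm])

theorem comulComp_proj (z : C ⊗[k] D) : comulComp k H C D (proj k H C D z) =
    TensorProduct.map ((proj k H C D).restrictScalars k) ((proj k H C D).restrictScalars k)
      (Coalgebra.comul (R := k) z) := by
  induction z with
  | zero => simp
  | add x y hx hy => simp only [map_add, hx, hy]
  | tmul c d => rfl

theorem counitComp_proj (z : C ⊗[k] D) :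
    counitComp k H C D (proj k H C D z) = Coalgebra.counit (R := k) z := by
  induction z with
  | zero => simp
  | add x y hx hy => simp only [map_add, hx, hy]
  | tmul c d => simp [counitComp, mul_comm]

theorem rTensor_comulComp (x : (C ⊗[k] D) ⊗[k] (C ⊗[k] D)) :
    (comulComp k H C D).rTensor _ (TensorProduct.map ((proj k H C D).restrictScalars k)
      ((proj k H C D).restrictScalars k) x) =
    TensorProduct.map (TensorProduct.map ((proj k H C D).restrictScalars k)
      ((proj k H C D).restrictScalars k)) ((proj k H C D).restrictScalars k)
      ((Coalgebra.comul (R := k)).rTensor (C ⊗[k] D) x) := by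
  induction x with
  | zero => simp
  | add x y hx hy => simp only [map_add, hx, hy]
  | tmul x y =>
    simp only [TensorProduct.map_tmul, LinearMap.rTensor_tmul, LinearMap.restrictScalars_apply,
      comulComp_proj]

theorem lTensor_comulComp (x : (C ⊗[k] D) ⊗[k] (C ⊗[k] D)) :
    (comulComp k H C D).lTensor _ (TensorProduct.map ((proj k H C D).restrictScalars k)
      ((proj k H C D).restrictScalars k) x) =
    TensorProduct.map ((proj k H C D).restrictScalars k)
      (TensorProduct.map ((proj k H C D).restrictScalars k) ((proj k H C D).restrictScalars k))
      ((Coalgebra.comul (R := k)).lTensor (C ⊗[k] D) x) := by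
  induction x with
  | zero => simp
  | add x y hx hy => simp only [map_add, hx, hy]
  | tmul x y =>
    simp only [TensorProduct.map_tmul, LinearMap.lTensor_tmul, LinearMap.restrictScalars_apply,
      comulComp_proj]

theorem assoc_map {M N : Type*} [AddCommGroup M] [Module k M] [AddCommGroup N] [Module k N]
    (p : M →ₗ[k] N) (x : (M ⊗[k] M) ⊗[k] M) :
    TensorProduct.assoc k N N N (TensorProduct.map (TensorProduct.map p p) p x) =
      TensorProduct.map p (TensorProduct.map p p) (TensorProduct.assoc k M M M x) := by
  induction x with
  | zero => simp
  | add x y hx hy => simp only [map_add, hx, hy]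
  | tmul x z =>
    induction x with
    | zero => simp
    | add x y hx hy => simp only [map_add, add_tmul, hx, hy]
    | tmul x y => simp

/-- The coalgebra `C ⊗_H D`, for `H`-module coalgebras `C` and `D`. -/
instance compCoalgebra : Coalgebra k (C ⊗[H] D) where
  comul := comulComp k H C D
  counit := counitComp k H C D
  coassoc := by
    ext z
    obtain ⟨w, rfl⟩ := TensorProduct.mapOfCompatibleSMul_surjective H k H C D z
    simp only [LinearMap.comp_apply, LinearEquiv.coe_coe, comulComp_proj,
      rTensor_comulComp, lTensor_comulComp, assoc_map]
    rw [Coalgebra.coassoc_apply]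
  rTensor_counit_comp_comul := by
    ext z
    obtain ⟨w, rfl⟩ := TensorProduct.mapOfCompatibleSMul_surjective H k H C D z
    rw [LinearMap.comp_apply, comulComp_proj]
    have key : ∀ x : (C ⊗[k] D) ⊗[k] (C ⊗[k] D),
        (counitComp k H C D).rTensor _ (TensorProduct.map ((proj k H C D).restrictScalars k)
          ((proj k H C D).restrictScalars k) x) =
        ((proj k H C D).restrictScalars k).lTensor k
          ((Coalgebra.counit (R := k)).rTensor (C ⊗[k] D) x) := by
      intro x
      induction x with
      | zero => simp
      | add x y hx hy => simp only [map_add, hx, hy]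
      | tmul x y =>
        simp only [TensorProduct.map_tmul, LinearMap.rTensor_tmul, LinearMap.lTensor_tmul,
          LinearMap.restrictScalars_apply, counitComp_proj]
    rw [key, Coalgebra.rTensor_counit_comul]
    rfl
  lTensor_counit_comp_comul := by
    ext z
    obtain ⟨w, rfl⟩ := TensorProduct.mapOfCompatibleSMul_surjective H k H C D z
    rw [LinearMap.comp_apply, comulComp_proj]
    have key : ∀ x : (C ⊗[k] D) ⊗[k] (C ⊗[k] D),
        (counitComp k H C D).lTensor _ (TensorProduct.map ((proj k H C D).restrictScalars k)
          ((proj k H C D).restrictScalars k) x) =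
        ((proj k H C D).restrictScalars k).rTensor k
          ((Coalgebra.counit (R := k)).lTensor (C ⊗[k] D) x) := by
      intro x
      induction x with
      | zero => simp
      | add x y hx hy => simp only [map_add, hx, hy]
      | tmul x y =>
        simp only [TensorProduct.map_tmul, LinearMap.rTensor_tmul, LinearMap.lTensor_tmul,
          LinearMap.restrictScalars_apply, counitComp_proj]
    rw [key, Coalgebra.lTensor_counit_comul]
    rfl

theorem comul_tmul_comp (c : C) (d : D) :
    Coalgebra.comul (R := k) (c ⊗ₜ[H] d) =
      TensorProduct.map ((proj k H C D).restrictScalars k) ((proj k H C D).restrictScalars k)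
        (TensorProduct.tensorTensorTensorComm k C C D D
          (Coalgebra.comul (R := k) c ⊗ₜ[k] Coalgebra.comul (R := k) d)) := rfl

theorem counit_tmul_comp (c : C) (d : D) :
    Coalgebra.counit (R := k) (c ⊗ₜ[H] d) =
      Coalgebra.counit (R := k) c * Coalgebra.counit (R := k) d := rfl

instance compModuleCoalgebra : ModuleCoalgebra k H (C ⊗[H] D) where
  comul_smul h z := by
    induction z with
    | zero => simp
    | add x y hx hy => simp only [smul_add, map_add, hx, hy]
    | tmul c d =>
      rw [TensorProduct.smul_tmul', comul_tmul_comp, comul_tmul_comp,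
        ModuleCoalgebra.comul_smul]
      generalize Coalgebra.comul (R := k) h = x
      generalize Coalgebra.comul (R := k) c = y
      generalize Coalgebra.comul (R := k) d = z
      induction x with
      | zero => simp
      | add x x' hx hx' => simp only [map_add, LinearMap.add_apply, add_tmul, hx, hx']
      | tmul a a' =>
      induction y with
      | zero => simp
      | add x x' hx hx' => simp only [map_add, add_tmul, hx, hx']
      | tmul c c' =>
      induction z with
      | zero => simp
      | add x x' hx hx' => simp only [map_add, tmul_add, hx, hx']
      | tmul d d' => simp [TensorProduct.smul_tmul']
  counit_smul h z := by
    induction z with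
    | zero => simp
    | add x y hx hy => simp only [smul_add, map_add, hx, hy, mul_add]
    | tmul c d =>
      rw [TensorProduct.smul_tmul', counit_tmul_comp, counit_tmul_comp,
        ModuleCoalgebra.counit_smul, mul_assoc]

end Composition

/-! ### Herds

All bimodules that carry a herd below are symmetric `H`-bimodules over a commutative
`k`-algebra `H`, i.e. `H`-modules, with `A = B = H` and `R = S = k`. The bimodules `X ⊗_k T` are
not symmetric: `H` acts from the left on `X` and from the right on `T`. A tensor product over `H` of
such bimodules, like `(X ⊗_k T) ⊗_H (P ⊗_k Q)`, is written `X ⊗_k (T ⊗_H (P ⊗_k Q))` or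
`(X ⊗_k (T ⊗_H P)) ⊗_k Q`; its left `H`-action is the Mathlib one on the first factor. -/

section Herd

variable {k H : Type u} [CommRing k] [CommRing H] [Algebra k H]

/-- The data of a herd on the `H`-module `T` with pen `X`: the maps `ev : X ⊗_k T → H` and
`êv : T ⊗_k X → H`, and the shepherd `γ : T → T ⊗_k X ⊗_k T`. As `T` and `X` are symmetric
bimodules, `H`-bimodule maps `X ⊗_k T → H` are the same as `H`-bilinear maps `X × T → H`. -/
structure HerdData (k H T X : Type*) [CommRing k] [CommRing H] [Algebra k H]
    [AddCommGroup T] [Module k T] [Module H T] [AddCommGroup X] [Module k X] [Module H X] where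
  ev : X →ₗ[H] T →ₗ[H] H
  coev : T →ₗ[H] X →ₗ[H] H
  shepherd : T →ₗ[k] (T ⊗[k] X) ⊗[k] T

section Pairing

variable {M N : Type*} [AddCommGroup M] [Module k M] [Module H M] [IsScalarTower k H M]
  [AddCommGroup N] [Module k N] [Module H N] [IsScalarTower k H N]

variable (k) in
/-- The map `M ⊗_k N → H` of an `H`-bilinear map `M × N → H`. -/
def pairing (b : M →ₗ[H] N →ₗ[H] H) : M ⊗[k] N →ₗ[H] H :=
  TensorProduct.lift b ∘ₗ proj k H M N

@[simp]
theorem pairing_tmul (b : M →ₗ[H] N →ₗ[H] H) (m : M) (n : N) :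
    pairing k b (m ⊗ₜ[k] n) = b m n := rfl

variable (k) in
/-- `(M ⊗_k N) ⊗_H Y → Y`, `m ⊗ n ⊗ y ↦ b(m, n)y`. -/
def pairingLeft (b : M →ₗ[H] N →ₗ[H] H) (Y : Type*) [AddCommGroup Y] [Module k Y] [Module H Y]
    [IsScalarTower k H Y] : M ⊗[k] (N ⊗[H] Y) →ₗ[H] Y :=
  (TensorProduct.lid H Y).toLinearMap ∘ₗ (TensorProduct.lift b).rTensor Y ∘ₗ
    (TensorProduct.assoc H M N Y).symm.toLinearMap ∘ₗ proj k H M (N ⊗[H] Y)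

@[simp]
theorem pairingLeft_tmul (b : M →ₗ[H] N →ₗ[H] H) (Y : Type*) [AddCommGroup Y] [Module k Y]
    [Module H Y] [IsScalarTower k H Y] (m : M) (n : N) (y : Y) :
    pairingLeft k b Y (m ⊗ₜ[k] (n ⊗ₜ[H] y)) = b m n • y := rfl

variable (k) in
/-- `Y ⊗_H (M ⊗_k N) → Y`, `y ⊗ m ⊗ n ↦ y b(m, n)`. -/
def pairingRight (b : M →ₗ[H] N →ₗ[H] H) (Y : Type*) [AddCommGroup Y] [Module k Y] [Module H Y]
    [IsScalarTower k H Y] : Y ⊗[H] (M ⊗[k] N) →ₗ[H] Y :=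
  (TensorProduct.rid H Y).toLinearMap ∘ₗ (pairing k b).lTensor Y

@[simp]
theorem pairingRight_tmul (b : M →ₗ[H] N →ₗ[H] H) (Y : Type*) [AddCommGroup Y] [Module k Y]
    [Module H Y] [IsScalarTower k H Y] (m : M) (n : N) (y : Y) :
    pairingRight k b Y (y ⊗ₜ[H] (m ⊗ₜ[k] n)) = b m n • y := rfl

end Pairing

namespace HerdData

variable {T X : Type u} [AddCommGroup T] [Module k T] [Module H T] [IsScalarTower k H T]
  [AddCommGroup X] [Module k X] [Module H X] [IsScalarTower k H X]

/-- `T` is a herd: `X` is a formal dual of `T` through `ev` and `êv` (first two conditions), and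
`γ` is a shepherd (last three conditions). -/
structure IsHerd (𝒯 : HerdData k H T X) : Prop where
  coev_smul : ∀ (x : T) (y : X) (z : T), 𝒯.coev x y • z = 𝒯.ev y z • x
  ev_smul : ∀ (x : X) (y : T) (z : X), 𝒯.ev x y • z = 𝒯.coev y z • x
  coev_shepherd : ∀ x : T,
    ((pairing k 𝒯.coev).restrictScalars k).rTensor T (𝒯.shepherd x) = (1 : H) ⊗ₜ[k] x
  ev_shepherd : ∀ x : T, ((pairing k 𝒯.ev).restrictScalars k).lTensor T
    (TensorProduct.assoc k T X T (𝒯.shepherd x)) = x ⊗ₜ[k] (1 : H)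
  shepherd_assoc : (𝒯.shepherd.rTensor X).rTensor T ∘ₗ 𝒯.shepherd =
    ((TensorProduct.assoc k (T ⊗[k] X) T X).symm.toLinearMap.rTensor T) ∘ₗ
      (TensorProduct.assoc k (T ⊗[k] X) (T ⊗[k] X) T).symm.toLinearMap ∘ₗ
        𝒯.shepherd.lTensor (T ⊗[k] X) ∘ₗ 𝒯.shepherd

/-- Two herds on `T` with pens `X` and `X'` are identified by the isomorphism `τ : X ≅ X'`. -/
structure IsIdentifiedBy {X' : Type u} [AddCommGroup X'] [Module k X'] [Module H X']
    [IsScalarTower k H X'] (𝒯 : HerdData k H T X) (𝒯' : HerdData k H T X')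
    (τ : X ≃ₗ[H] X') : Prop where
  ev_eq : ∀ (x : X) (t : T), 𝒯'.ev (τ x) t = 𝒯.ev x t
  coev_eq : ∀ (t : T) (x : X), 𝒯'.coev t (τ x) = 𝒯.coev t x
  shepherd_eq : ∀ t : T, 𝒯'.shepherd t =
    ((τ.toLinearMap.restrictScalars k).lTensor T).rTensor T (𝒯.shepherd t)

variable (𝒯 : HerdData k H T X)

/-- The composite of `γ` and `T ⊗_k X ⊗_k T → T ⊗_H X ⊗_k T`. -/
def gammaRight : T →ₗ[k] T ⊗[H] (X ⊗[k] T) :=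
  ((TensorProduct.AlgebraTensorModule.assoc k H H T X T).toLinearMap.restrictScalars k) ∘ₗ
    ((proj k H T X).restrictScalars k).rTensor T ∘ₗ 𝒯.shepherd

/-- The composite of `γ` and `T ⊗_k X ⊗_k T → T ⊗_k X ⊗_H T`. -/
def gammaLeft : T →ₗ[k] T ⊗[k] (X ⊗[H] T) :=
  ((proj k H X T).restrictScalars k).lTensor T ∘ₗ
    (TensorProduct.assoc k T X T).toLinearMap ∘ₗ 𝒯.shepherd

variable {𝒯}

/-- `γ_A` is right linear. -/
theorem IsHerd.gammaRight_smul (h𝒯 : 𝒯.IsHerd) (h : H) (t : T) :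
    𝒯.gammaRight (h • t) =
      (TensorProduct.AlgebraTensorModule.lTensor H X (act k H T h)).lTensor T (𝒯.gammaRight t) := by
  have main : ∀ (x : T) (y : X) (w : (T ⊗[k] X) ⊗[k] T),
      𝒯.coev x y • TensorProduct.AlgebraTensorModule.assoc k H H T X T
        (((proj k H T X).restrictScalars k).rTensor T w) =
      TensorProduct.mk H T (X ⊗[k] T) x
        (TensorProduct.map ((act k H X).flip y) LinearMap.id
        (((pairing k 𝒯.coev).restrictScalars k).rTensor T w)) := by
    intro x y w
    induction w with
    | zero => simp
    | add a b ha hb => simp only [map_add, smul_add, ha, hb]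
    | tmul w z =>
      induction w with
      | zero => simp
      | add a b ha hb => simp only [map_add, add_tmul, smul_add, ha, hb]
      | tmul w v =>
        simp only [LinearMap.rTensor_tmul, LinearMap.restrictScalars_apply,
          TensorProduct.mapOfCompatibleSMul_tmul, TensorProduct.AlgebraTensorModule.assoc_tmul,
          pairing_tmul, TensorProduct.map_tmul, LinearMap.flip_apply, act_apply,
          LinearMap.id_apply, TensorProduct.mk_apply, ← h𝒯.ev_smul]
        rw [TensorProduct.smul_tmul', h𝒯.coev_smul, TensorProduct.smul_tmul,
          TensorProduct.smul_tmul']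
  have key : ∀ w : (T ⊗[k] X) ⊗[k] T,
      TensorProduct.lift ((act k H (T ⊗[H] (X ⊗[k] T))).compl₂
          (𝒯.gammaRight ∘ₗ act k H T h))
        (((pairing k 𝒯.coev).restrictScalars k).rTensor T w) =
      (TensorProduct.AlgebraTensorModule.lTensor H X (act k H T h)).lTensor T
        (TensorProduct.AlgebraTensorModule.assoc k H H T X T
          (((proj k H T X).restrictScalars k).rTensor T w)) := by
    intro w
    induction w with
    | zero => simp
    | add a b ha hb => simp only [map_add, ha, hb]
    | tmul w z =>
      induction w with
      | zero => simp
      | add a b ha hb => simp only [map_add, add_tmul, ha, hb]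
      | tmul x y =>
        have := main x y (𝒯.shepherd (h • z))
        rw [h𝒯.coev_shepherd] at this
        simpa [gammaRight] using this
  have := key (𝒯.shepherd t)
  rw [h𝒯.coev_shepherd] at this
  simpa [gammaRight] using this

/-- `γ_B` is left linear. -/
theorem IsHerd.gammaLeft_smul (h𝒯 : 𝒯.IsHerd) (h : H) (t : T) :
    𝒯.gammaLeft (h • t) = h • 𝒯.gammaLeft t := by
  have main : ∀ (x : X) (y : T) (w : (T ⊗[k] X) ⊗[k] T),
      (act k H (X ⊗[H] T) (𝒯.ev x y)).lTensor T
        (((proj k H X T).restrictScalars k).lTensor T (TensorProduct.assoc k T X T w)) =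
      TensorProduct.map LinearMap.id ((act k H (X ⊗[H] T)).flip (x ⊗ₜ[H] y))
        (((pairing k 𝒯.ev).restrictScalars k).lTensor T (TensorProduct.assoc k T X T w)) := by
    intro x y w
    induction w with
    | zero => simp
    | add a b ha hb => simp only [map_add, ha, hb]
    | tmul w z =>
      induction w with
      | zero => simp
      | add a b ha hb => simp only [map_add, add_tmul, ha, hb]
      | tmul w v =>
        simp only [LinearMap.lTensor_tmul, LinearMap.restrictScalars_apply,
          TensorProduct.mapOfCompatibleSMul_tmul, TensorProduct.assoc_tmul,
          pairing_tmul, TensorProduct.map_tmul, LinearMap.flip_apply, act_apply,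
          LinearMap.id_apply]
        rw [TensorProduct.smul_tmul', TensorProduct.smul_tmul', h𝒯.ev_smul,
          TensorProduct.smul_tmul, TensorProduct.smul_tmul, h𝒯.coev_smul]
  have key : ∀ w : (T ⊗[k] X) ⊗[k] T,
      TensorProduct.lift ((LinearMap.llcomp k T (T ⊗[k] (X ⊗[H] T)) (T ⊗[k] (X ⊗[H] T))).flip
          (𝒯.gammaLeft ∘ₗ Algebra.lsmul k k T h) ∘ₗ (LinearMap.lTensorHom T ∘ₗ
            act k H (X ⊗[H] T))).flip
        (((pairing k 𝒯.ev).restrictScalars k).lTensor T (TensorProduct.assoc k T X T w)) =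
      h • (((proj k H X T).restrictScalars k).lTensor T (TensorProduct.assoc k T X T w)) := by
    intro w
    induction w with
    | zero => simp
    | add a b ha hb => simp only [map_add, smul_add, ha, hb]
    | tmul w z =>
      induction w with
      | zero => simp
      | add a b ha hb => simp only [map_add, add_tmul, smul_add, ha, hb]
      | tmul x y =>
        have := main y z (𝒯.shepherd (h • x))
        rw [h𝒯.ev_shepherd] at this
        simpa [gammaLeft, TensorProduct.smul_tmul'] using this
  have := key (𝒯.shepherd t)
  rw [h𝒯.ev_shepherd] at this
  simpa [gammaLeft, act_one] using this

/-- `γ_B` as a map of left `H`-modules. -/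
def IsHerd.gammaLeftLinear (h𝒯 : 𝒯.IsHerd) : T →ₗ[H] T ⊗[k] (X ⊗[H] T) :=
  { 𝒯.gammaLeft with map_smul' := h𝒯.gammaLeft_smul }

/-- `γ_A ⊗_H Y : T ⊗_H Y → T ⊗_H (X ⊗_k T) ⊗_H Y`. -/
def IsHerd.gammaRightTensor (h𝒯 : 𝒯.IsHerd) (Y : Type u) [AddCommGroup Y] [Module k Y] [Module H Y]
    [IsScalarTower k H Y] : T ⊗[H] Y →ₗ[k] T ⊗[H] (X ⊗[k] (T ⊗[H] Y)) :=
  liftBal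
    (LinearMap.mk₂ k
      (fun (t : T) (y : Y) => (TensorProduct.AlgebraTensorModule.lTensor H X
        (((TensorProduct.mk H T Y).flip y).restrictScalars k)).lTensor T (𝒯.gammaRight t))
      (by intro t t' y; simp only [map_add])
      (by intro a t y; rw [map_smul, LinearMap.map_smul_of_tower])
      (by
        intro t y y'
        have : ((TensorProduct.mk H T Y).flip (y + y')).restrictScalars k =
            ((TensorProduct.mk H T Y).flip y).restrictScalars k +
              ((TensorProduct.mk H T Y).flip y').restrictScalars k := by
          ext; simp
        rw [this, map_add, LinearMap.lTensor_add, LinearMap.add_apply])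
      (by
        intro a t y
        have : ((TensorProduct.mk H T Y).flip (a • y)).restrictScalars k =
            a • ((TensorProduct.mk H T Y).flip y).restrictScalars k := by
          ext; simp
        rw [this, map_smul]
        generalize 𝒯.gammaRight t = z
        induction z with
        | zero => simp
        | add x y hx hy => simp only [map_add, smul_add, hx, hy]
        | tmul m n => simp))
    (by
      intro h t y
      rw [LinearMap.mk₂_apply, LinearMap.mk₂_apply, h𝒯.gammaRight_smul]
      generalize 𝒯.gammaRight t = z
      induction z with
      | zero => simp
      | add x y hx hy => simp only [map_add, hx, hy]
      | tmul m n =>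
        induction n with
        | zero => simp
        | add x y hx hy => simp only [map_add, tmul_add, hx, hy]
        | tmul x t => simp)

/-- The coproduct `X ⊗_k γ_A` of the coring `𝒞 = X ⊗_k T`. -/
def IsHerd.comulPen (_h𝒯 : 𝒯.IsHerd) : X ⊗[k] T →ₗ[H] X ⊗[k] (T ⊗[H] (X ⊗[k] T)) :=
  TensorProduct.AlgebraTensorModule.lTensor H X 𝒯.gammaRight

/-- The map `Δ_𝒞 ⊗_H Y : 𝒞 ⊗_H Y → 𝒞 ⊗_H 𝒞 ⊗_H Y` for the coring `𝒞 = X ⊗_k T`. -/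
def IsHerd.comulPenTensor (h𝒯 : 𝒯.IsHerd) (Y : Type u) [AddCommGroup Y] [Module k Y] [Module H Y]
    [IsScalarTower k H Y] :
    X ⊗[k] (T ⊗[H] Y) →ₗ[H] X ⊗[k] (T ⊗[H] (X ⊗[k] (T ⊗[H] Y))) :=
  TensorProduct.AlgebraTensorModule.lTensor H X (h𝒯.gammaRightTensor Y)

/-- The map `γ_B ⊗_k N : T ⊗_k N → T ⊗_k X ⊗_H T ⊗_k N`. For `N = X` it is the coproduct of the
coring `𝒟 = T ⊗_k X`, and for `N = X ⊗_H Y` it is the map `Δ_𝒟 ⊗_H Y`. -/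
def IsHerd.comulTensor (h𝒯 : 𝒯.IsHerd) (N : Type u) [AddCommGroup N] [Module k N] :
    T ⊗[k] N →ₗ[H] T ⊗[k] (X ⊗[H] (T ⊗[k] N)) :=
  TensorProduct.AlgebraTensorModule.lTensor H T
    ((TensorProduct.AlgebraTensorModule.assoc k H H X T N).toLinearMap.restrictScalars k) ∘ₗ
  (TensorProduct.AlgebraTensorModule.assoc k k H T (X ⊗[H] T) N).toLinearMap ∘ₗ
  TensorProduct.AlgebraTensorModule.rTensor k N h𝒯.gammaLeftLinear

end HerdData

/-! ### Smash coproducts and composition of herds -/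

variable {T X P Q : Type u}
  [AddCommGroup T] [Module k T] [Module H T] [IsScalarTower k H T]
  [AddCommGroup X] [Module k X] [Module H X] [IsScalarTower k H X]
  [AddCommGroup P] [Module k P] [Module H P] [IsScalarTower k H P]
  [AddCommGroup Q] [Module k Q] [Module H Q] [IsScalarTower k H Q]

variable (k H T X P Q) in
/-- An `H`-bimodule map `σ : 𝒞 ⊗_H 𝒟 → 𝒟 ⊗_H 𝒞`, where `𝒞 = X ⊗_k T` and `𝒟 = P ⊗_k Q`. -/
structure SwapMap where
  toLinearMap : (X ⊗[k] (T ⊗[H] P)) ⊗[k] Q →ₗ[H] (P ⊗[k] (Q ⊗[H] X)) ⊗[k] T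
  map_right : ∀ (h : H) (w : (X ⊗[k] (T ⊗[H] P)) ⊗[k] Q),
    toLinearMap ((act k H Q h).lTensor (X ⊗[k] (T ⊗[H] P)) w) =
      (act k H T h).lTensor (P ⊗[k] (Q ⊗[H] X)) (toLinearMap w)

variable (k H) in
/-- `A ⊗_k (B ⊗_H (C ⊗_k N)) ≅ (A ⊗_k (B ⊗_H C)) ⊗_k N`. -/
def chainAssoc (A B C N : Type u) [AddCommGroup A] [Module k A] [Module H A] [IsScalarTower k H A]
    [AddCommGroup B] [Module k B] [Module H B] [IsScalarTower k H B]
    [AddCommGroup C] [Module k C] [Module H C] [IsScalarTower k H C]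
    [AddCommGroup N] [Module k N] :
    A ⊗[k] (B ⊗[H] (C ⊗[k] N)) ≃ₗ[H] (A ⊗[k] (B ⊗[H] C)) ⊗[k] N :=
  TensorProduct.AlgebraTensorModule.congr (LinearEquiv.refl H A)
    ((TensorProduct.AlgebraTensorModule.assoc k H H B C N).symm.restrictScalars k) ≪≫ₗ
  (TensorProduct.AlgebraTensorModule.assoc k k H A (B ⊗[H] C) N).symm

variable (k H) in
/-- `(M ⊗_k N) ⊗_H f` for an `H`-linear map `f`. -/
def whisker (M N : Type u) {Y Z : Type u}
    [AddCommGroup M] [Module k M] [Module H M] [IsScalarTower k H M]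
    [AddCommGroup N] [Module k N] [Module H N] [IsScalarTower k H N]
    [AddCommGroup Y] [Module k Y] [Module H Y] [IsScalarTower k H Y]
    [AddCommGroup Z] [Module k Z] [Module H Z] [IsScalarTower k H Z] (f : Y →ₗ[H] Z) :
    M ⊗[k] (N ⊗[H] Y) →ₗ[H] M ⊗[k] (N ⊗[H] Z) :=
  TensorProduct.AlgebraTensorModule.lTensor H M ((f.lTensor N).restrictScalars k)

namespace SwapMap

variable (σ : SwapMap k H T X P Q)

/-- `σ ⊗_H Y`. -/
def tensor (Y : Type u) [AddCommGroup Y] [Module k Y] [Module H Y] [IsScalarTower k H Y] :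
    (X ⊗[k] (T ⊗[H] P)) ⊗[k] (Q ⊗[H] Y) →ₗ[H] (P ⊗[k] (Q ⊗[H] X)) ⊗[k] (T ⊗[H] Y) :=
  TensorProduct.AlgebraTensorModule.lift
    { toFun := fun m => liftBal
        (LinearMap.mk₂ k
          (fun (q : Q) (y : Y) => (((TensorProduct.mk H T Y).flip y).restrictScalars k).lTensor
            (P ⊗[k] (Q ⊗[H] X)) (σ.toLinearMap (m ⊗ₜ[k] q)))
          (by intro q q' y; simp only [map_add, tmul_add])
          (by intro a q y; rw [tmul_smul, LinearMap.map_smul_of_tower, map_smul])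
          (by
            intro q y y'
            have : ((TensorProduct.mk H T Y).flip (y + y')).restrictScalars k =
                ((TensorProduct.mk H T Y).flip y).restrictScalars k +
                  ((TensorProduct.mk H T Y).flip y').restrictScalars k := by
              ext; simp
            rw [this, LinearMap.lTensor_add, LinearMap.add_apply])
          (by
            intro a q y
            have : ((TensorProduct.mk H T Y).flip (a • y)).restrictScalars k =
                a • ((TensorProduct.mk H T Y).flip y).restrictScalars k := by
              ext; simp
            rw [this, LinearMap.lTensor_smul, LinearMap.smul_apply]))
        (by
          intro h q y
          have := σ.map_right h (m ⊗ₜ[k] q)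
          rw [LinearMap.lTensor_tmul, act_apply] at this
          rw [LinearMap.mk₂_apply, LinearMap.mk₂_apply, this]
          generalize σ.toLinearMap (m ⊗ₜ[k] q) = z
          induction z with
          | zero => simp
          | add x y hx hy => simp only [map_add, hx, hy]
          | tmul m n => simp)
      map_add' := by
        intro m m'
        ext z
        induction z with
        | zero => simp
        | add x y hx hy => simp only [map_add, hx, hy]
        | tmul q y => simp [add_tmul]
      map_smul' := by
        intro h m
        ext z
        induction z with
        | zero => simp
        | add x y hx hy => simp only [map_add, hx, hy]
        | tmul q y =>
          simp only [liftBal_tmul, LinearMap.mk₂_apply, RingHom.id_apply, LinearMap.smul_apply]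
          rw [← TensorProduct.smul_tmul', map_smul]
          generalize σ.toLinearMap (m ⊗ₜ[k] q) = z
          induction z with
          | zero => simp
          | add x y hx hy => simp only [map_add, smul_add, hx, hy]
          | tmul m n => simp [TensorProduct.smul_tmul'] }

/-- `σ` on right-nested tensor products. -/
def nested : X ⊗[k] (T ⊗[H] (P ⊗[k] Q)) →ₗ[H] P ⊗[k] (Q ⊗[H] (X ⊗[k] T)) :=
  (chainAssoc k H P Q X T).symm.toLinearMap ∘ₗ σ.toLinearMap ∘ₗ
    (chainAssoc k H X T P Q).toLinearMap

/-- `σ ⊗_H Y` on right-nested tensor products. -/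
def nestedTensor (Y : Type u) [AddCommGroup Y] [Module k Y] [Module H Y] [IsScalarTower k H Y] :
    X ⊗[k] (T ⊗[H] (P ⊗[k] (Q ⊗[H] Y))) →ₗ[H] P ⊗[k] (Q ⊗[H] (X ⊗[k] (T ⊗[H] Y))) :=
  (chainAssoc k H P Q X (T ⊗[H] Y)).symm.toLinearMap ∘ₗ σ.tensor Y ∘ₗ
    (chainAssoc k H X T P (Q ⊗[H] Y)).toLinearMap

/-- `σ : 𝒞 ⊗_H 𝒟 → 𝒟 ⊗_H 𝒞` defines a smash coproduct of the corings `𝒟 = P ⊗_k Q` and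
`𝒞 = X ⊗_k T` of the herds `P` and `T`: it is compatible with the coproducts and counits. -/
structure IsSmash {𝒯 : HerdData k H T X} {𝒰 : HerdData k H P Q} (h𝒯 : 𝒯.IsHerd)
    (h𝒰 : 𝒰.IsHerd) : Prop where
  left_pentagon : σ.nestedTensor (X ⊗[k] T) ∘ₗ whisker k H X T σ.nested ∘ₗ
      h𝒯.comulPenTensor (P ⊗[k] Q) = whisker k H P Q h𝒯.comulPen ∘ₗ σ.nested
  right_pentagon : whisker k H P Q σ.nested ∘ₗ σ.nestedTensor (P ⊗[k] Q) ∘ₗ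
      whisker k H X T (h𝒰.comulTensor Q) = h𝒰.comulTensor (Q ⊗[H] (X ⊗[k] T)) ∘ₗ σ.nested
  left_counit : pairingLeft k 𝒰.coev (X ⊗[k] T) ∘ₗ σ.nested =
    TensorProduct.AlgebraTensorModule.lTensor H X
      ((pairingRight k 𝒰.coev T).restrictScalars k)
  right_counit : TensorProduct.AlgebraTensorModule.lTensor H P
      ((pairingRight k 𝒯.ev Q).restrictScalars k) ∘ₗ σ.nested =
    pairingLeft k 𝒯.ev (P ⊗[k] Q)

end SwapMap

/-- For bilinear `b : M × N → H` and `b' : M' × N' → H`, the bilinear map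
`(M ⊗_H M') × (N' ⊗_H N) → H`, `(m ⊗ m', n' ⊗ n) ↦ b(m, b'(m', n')n)`. -/
def compPairing {M N M' N' : Type u}
    [AddCommGroup M] [Module H M] [AddCommGroup N] [Module H N]
    [AddCommGroup M'] [Module H M'] [AddCommGroup N'] [Module H N']
    (b : M →ₗ[H] N →ₗ[H] H) (b' : M' →ₗ[H] N' →ₗ[H] H) :
    (M ⊗[H] M') →ₗ[H] (N' ⊗[H] N) →ₗ[H] H :=
  TensorProduct.lift (LinearMap.mk₂ H
    (fun m m' => TensorProduct.lift ((LinearMap.lsmul H N).compr₂ (b m) ∘ₗ b' m'))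
    (by intro m₁ m₂ m'; ext; simp [mul_add])
    (by intro a m m'; ext; simp [mul_left_comm])
    (by intro m m₁ m₂; ext; simp)
    (by intro a m m'; ext; simp [mul_assoc]))

theorem compPairing_tmul {M N M' N' : Type u}
    [AddCommGroup M] [Module H M] [AddCommGroup N] [Module H N]
    [AddCommGroup M'] [Module H M'] [AddCommGroup N'] [Module H N']
    (b : M →ₗ[H] N →ₗ[H] H) (b' : M' →ₗ[H] N' →ₗ[H] H) (m : M) (m' : M') (n : N) (n' : N') :
    compPairing b b' (m ⊗ₜ[H] m') (n' ⊗ₜ[H] n) = b m (b' m' n' • n) := rfl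

/-- The composite, along `σ`, of the herds `T` (with pen `X`) and `P` (with pen `Q`): the module
`T ⊗_H P` with pen `Q ⊗_H X`, evaluation `ev_P ∘ (Q ⊗ ev_T ⊗ P)`, coevaluation
`êv_T ∘ (T ⊗ êv_P ⊗ X)`, and shepherd `(T ⊗_H σ ⊗_H P) ∘ (γ_{T,H} ⊗_H γ_{P,H})`. -/
def HerdData.comp {𝒯 : HerdData k H T X} {𝒰 : HerdData k H P Q} (h𝒯 : 𝒯.IsHerd) (h𝒰 : 𝒰.IsHerd)
    (σ : SwapMap k H T X P Q) : HerdData k H (T ⊗[H] P) (Q ⊗[H] X) where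
  ev := compPairing 𝒰.ev 𝒯.ev
  coev := compPairing 𝒯.coev 𝒰.coev
  shepherd :=
    (((TensorProduct.AlgebraTensorModule.assoc k H H T P
      (Q ⊗[H] X)).symm.toLinearMap.restrictScalars k).rTensor
      (T ⊗[H] P)) ∘ₗ
    (TensorProduct.AlgebraTensorModule.assoc k H H T (P ⊗[k] (Q ⊗[H] X))
      (T ⊗[H] P)).symm.toLinearMap.restrictScalars k ∘ₗ
    ((σ.tensor P ∘ₗ (chainAssoc k H X T P (Q ⊗[H] P)).toLinearMap).lTensor T).restrictScalars k ∘ₗ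
    h𝒯.gammaRightTensor (P ⊗[k] (Q ⊗[H] P)) ∘ₗ
    (h𝒰.gammaLeftLinear.lTensor T).restrictScalars k

end Herd

/-! ### The herd of a Galois co-object -/

section GaloisHerd

variable (k H : Type u) [CommRing k] [CommRing H] [HopfAlgebra k H]

/-- The pen `Ĉ`: the `k`-module `C` with the action `h ⇀ ĉ = ĉ S(h)` of `H`. (The antipode `S` of the
commutative Hopf algebra `H` satisfies `S⁻¹ = S`.) -/
def Pen (_k _H C : Type u) : Type u := C

section Pen

variable (C : Type u) [AddCommGroup C] [Module k C] [Module H C]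

instance : AddCommGroup (Pen k H C) := inferInstanceAs (AddCommGroup C)

instance : Module k (Pen k H C) := inferInstanceAs (Module k C)

/-- The identity map `C → Ĉ`. -/
def Pen.of : C ≃ₗ[k] Pen k H C := LinearEquiv.refl k C

instance : Module H (Pen k H C) :=
  Module.compHom C (HopfAlgebra.antipodeAlgHom k H : H →+* H)

theorem Pen.smul_of (h : H) (c : C) :
    h • Pen.of k H C c = Pen.of k H C (HopfAlgebra.antipode k h • c) := rfl

instance [IsScalarTower k H C] : IsScalarTower k H (Pen k H C) where
  smul_assoc a h x := by
    obtain ⟨c, rfl⟩ := (Pen.of k H C).surjective x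
    rw [Pen.smul_of, Pen.smul_of, map_smul (HopfAlgebra.antipode k), smul_assoc,
      map_smul (Pen.of k H C)]

end Pen

theorem antipode_antipode (h : H) :
    HopfAlgebra.antipode k (HopfAlgebra.antipode k h) = h := by
  have h1 := inv_inv (WithConv.toConv (AlgHom.id k H))
  have h2 := congrArg (fun f => f.ofConv h) h1
  exact h2

variable {k H}
variable {C : Type u} [AddCommGroup C] [Module k C] [Module H C] [IsScalarTower k H C]
  [Coalgebra k C]

/-- `ev = (ε ⊗ H) ∘ δ⁻¹ : C ⊗ C → H`, as a `k`-linear map. -/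
def evLin (hδ : Function.Bijective (delta k H C)) : C ⊗[k] C →ₗ[k] H :=
  (TensorProduct.lid k H).toLinearMap ∘ₗ (Coalgebra.counit (R := k) (A := C)).rTensor H ∘ₗ
    (LinearEquiv.ofBijective (delta k H C) hδ).symm.toLinearMap

theorem evLin_delta (hδ : Function.Bijective (delta k H C)) (z : C ⊗[k] H) :
    evLin hδ (delta k H C z) =
      TensorProduct.lid k H ((Coalgebra.counit (R := k) (A := C)).rTensor H z) := by
  have : (LinearEquiv.ofBijective (delta k H C) hδ).symm (delta k H C z) = z :=
    (LinearEquiv.ofBijective (delta k H C) hδ).symm_apply_apply z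
  simp [evLin, this]

theorem evLin_smul_right (hδ : Function.Bijective (delta k H C)) (h : H) (c d : C) :
    evLin hδ (c ⊗ₜ[k] (h • d)) = h * evLin hδ (c ⊗ₜ[k] d) := by
  have key : ∀ z : C ⊗[k] H, delta k H C ((LinearMap.mulLeft k h).lTensor C z) =
      (act k H C h).lTensor C (delta k H C z) := by
    intro z
    induction z with
    | zero => simp
    | add x y hx hy => simp only [map_add, hx, hy]
    | tmul c g =>
      simp only [delta, LinearMap.comp_apply, LinearMap.lTensor_tmul, LinearMap.rTensor_tmul,
        LinearMap.mulLeft_apply]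
      generalize Coalgebra.comul (R := k) c = w
      induction w with
      | zero => simp
      | add x y hx hy => simp only [map_add, add_tmul, hx, hy]
      | tmul x y => simp [mul_smul]
  have key' : ∀ z : C ⊗[k] H, TensorProduct.lid k H ((Coalgebra.counit (R := k) (A := C)).rTensor H
      ((LinearMap.mulLeft k h).lTensor C z)) =
      h * TensorProduct.lid k H ((Coalgebra.counit (R := k) (A := C)).rTensor H z) := by
    intro z
    induction z with
    | zero => simp
    | add x y hx hy => simp only [map_add, mul_add, hx, hy]
    | tmul x y => simp
  obtain ⟨z, hz⟩ := hδ.2 (c ⊗ₜ[k] d)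
  have h1 : c ⊗ₜ[k] (h • d) = (act k H C h).lTensor C (c ⊗ₜ[k] d) := by simp
  rw [h1, ← hz, ← key, evLin_delta, evLin_delta, key']

/-- `c₁h ⊗ c₂g = δ(ch₁ ⊗ S(h₂)g)`. -/
theorem delta_smul_left [ModuleCoalgebra k H C] (h g : H) (c : C) :
    delta k H C (TensorProduct.map ((act k H C).flip c)
      (LinearMap.mulRight k g ∘ₗ HopfAlgebra.antipode k) (Coalgebra.comul (R := k) h)) =
    TensorProduct.map (act k H C h) (act k H C g) (Coalgebra.comul (R := k) c) := by
  have h1 : ∀ w : H ⊗[k] H, delta k H C (TensorProduct.map ((act k H C).flip c)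
      (LinearMap.mulRight k g ∘ₗ HopfAlgebra.antipode k) w) =
      TensorProduct.map₂ (act k H C) (act k H C)
        ((LinearMap.mulRight k g ∘ₗ LinearMap.mul' k H ∘ₗ
          (HopfAlgebra.antipode k).lTensor H).lTensor H (TensorProduct.assoc k H H H
            ((Coalgebra.comul (R := k)).rTensor H w))) (Coalgebra.comul (R := k) c) := by
    intro w
    induction w with
    | zero => simp
    | add x y hx hy => simp only [map_add, LinearMap.add_apply, hx, hy]
    | tmul a b =>
      simp only [delta, LinearMap.comp_apply, LinearMap.rTensor_tmul, TensorProduct.map_tmul,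
        LinearMap.flip_apply, act_apply, ModuleCoalgebra.comul_smul]
      generalize Coalgebra.comul (R := k) a = v
      generalize Coalgebra.comul (R := k) c = w
      induction v with
      | zero => simp
      | add x y hx hy => simp only [map_add, add_tmul, LinearMap.add_apply, hx, hy]
      | tmul a a' =>
      induction w with
      | zero => simp
      | add x y hx hy => simp only [map_add, add_tmul, hx, hy]
      | tmul x y => simp [smul_smul, mul_comm, mul_left_comm]
  rw [h1, Coalgebra.coassoc_apply, ← LinearMap.comp_apply (LinearMap.lTensor _ _),
    ← LinearMap.lTensor_comp, LinearMap.comp_assoc, LinearMap.comp_assoc,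
    HopfAlgebra.mul_antipode_lTensor_comul, LinearMap.lTensor_comp, LinearMap.lTensor_comp,
    LinearMap.comp_apply, LinearMap.comp_apply, Coalgebra.lTensor_counit_comul]
  generalize Coalgebra.comul (R := k) c = w
  induction w with
  | zero => simp
  | add x y hx hy => simp only [map_add, hx, hy]
  | tmul x y => simp

theorem evLin_smul_left [ModuleCoalgebra k H C] (hδ : Function.Bijective (delta k H C)) (h : H)
    (c d : C) :
    evLin hδ ((h • c) ⊗ₜ[k] d) = HopfAlgebra.antipode k h * evLin hδ (c ⊗ₜ[k] d) := by
  have key : ∀ z : C ⊗[k] H, evLin hδ ((act k H C h).rTensor C (delta k H C z)) =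
      HopfAlgebra.antipode k h * evLin hδ (delta k H C z) := by
    intro z
    induction z with
    | zero => simp
    | add x y hx hy => simp only [map_add, mul_add, hx, hy]
    | tmul c g =>
      have h1 : (act k H C h).rTensor C (delta k H C (c ⊗ₜ[k] g)) =
          TensorProduct.map (act k H C h) (act k H C g) (Coalgebra.comul (R := k) c) := by
        simp only [delta, LinearMap.comp_apply, LinearMap.rTensor_tmul]
        generalize Coalgebra.comul (R := k) c = w
        induction w with
        | zero => simp
        | add x y hx hy => simp only [map_add, add_tmul, hx, hy]
        | tmul x y => simp
      have h2 : ∀ w : H ⊗[k] H, TensorProduct.lid k H ((Coalgebra.counit (R := k) (A := C)).rTensor H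
          (TensorProduct.map ((act k H C).flip c)
            (LinearMap.mulRight k g ∘ₗ HopfAlgebra.antipode k) w)) =
          Coalgebra.counit (R := k) c • (HopfAlgebra.antipode k (TensorProduct.lid k H
            ((Coalgebra.counit (R := k)).rTensor H w)) * g) := by
        intro w
        induction w with
        | zero => simp
        | add x y hx hy => simp only [map_add, add_mul, smul_add, hx, hy]
        | tmul a b => simp [ModuleCoalgebra.counit_smul, smul_smul, mul_comm]
      rw [h1, ← delta_smul_left, evLin_delta, evLin_delta, h2, Coalgebra.rTensor_counit_comul]
      simp
  obtain ⟨z, hz⟩ := hδ.2 (c ⊗ₜ[k] d)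
  have h1 : (h • c) ⊗ₜ[k] d = (act k H C h).rTensor C (c ⊗ₜ[k] d) := by simp
  rw [h1, ← hz, key]

/-- The herd of the Galois co-object `C`: the pen is `Ĉ`, `ev = (ε ⊗ H) ∘ δ⁻¹`,
`êv = S ∘ ev`, and the shepherd is `Δ² = (Δ ⊗ C) ∘ Δ : C → C ⊗ Ĉ ⊗ C`. -/
def galoisHerd [ModuleCoalgebra k H C] (hδ : Function.Bijective (delta k H C)) :
    HerdData k H C (Pen k H C) where
  ev := LinearMap.mk₂ H (fun x c => evLin hδ ((Pen.of k H C).symm x ⊗ₜ[k] c))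
    (by intro x x' c; simp [add_tmul])
    (by
      intro h x c
      obtain ⟨x, rfl⟩ := (Pen.of k H C).surjective x
      rw [Pen.smul_of, LinearEquiv.symm_apply_apply, evLin_smul_left, antipode_antipode,
        LinearEquiv.symm_apply_apply, smul_eq_mul])
    (by intro x c c'; simp [tmul_add])
    (by
      intro h x c
      rw [evLin_smul_right, smul_eq_mul])
  coev := LinearMap.mk₂ H
    (fun c x => HopfAlgebra.antipode k (evLin hδ (c ⊗ₜ[k] (Pen.of k H C).symm x)))
    (by intro c c' x; simp [add_tmul])
    (by
      intro h c x
      rw [evLin_smul_left, HopfAlgebra.antipode_mul_distrib, antipode_antipode, smul_eq_mul])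
    (by intro c x x'; simp [tmul_add])
    (by
      intro h c x
      obtain ⟨x, rfl⟩ := (Pen.of k H C).surjective x
      rw [Pen.smul_of, LinearEquiv.symm_apply_apply, evLin_smul_right,
        HopfAlgebra.antipode_mul_distrib, antipode_antipode, LinearEquiv.symm_apply_apply,
        smul_eq_mul])
  shepherd := ((Pen.of k H C).toLinearMap.lTensor C).rTensor C ∘ₗ
    (Coalgebra.comul (R := k) (A := C)).rTensor C ∘ₗ Coalgebra.comul (R := k) (A := C)

end GaloisHerd

section Sigma

variable (k H : Type u) [CommRing k] [CommRing H] [HopfAlgebra k H]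

variable (C D : Type u)
  [AddCommGroup C] [Module k C] [Module H C] [IsScalarTower k H C]
  [AddCommGroup D] [Module k D] [Module H D] [IsScalarTower k H D]

/-- `(x ⊗ x') ⊗ (y ⊗ y') ↦ x ⊗ x' ⊗_H y ⊗ y'`, with values in `(Ĉ ⊗ C) ⊗_H (D ⊗ D̂)`. -/
def toCD : (C ⊗[k] C) ⊗[k] (D ⊗[k] D) →ₗ[k] (Pen k H C ⊗[k] (C ⊗[H] D)) ⊗[k] Pen k H D :=
  TensorProduct.map
    (TensorProduct.map (Pen.of k H C).toLinearMap ((proj k H C D).restrictScalars k) ∘ₗ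
      (TensorProduct.assoc k C C D).toLinearMap)
    (Pen.of k H D).toLinearMap ∘ₗ
  (TensorProduct.assoc k (C ⊗[k] C) D D).symm.toLinearMap

/-- `(y ⊗ y') ⊗ (x ⊗ x') ↦ y ⊗ y' ⊗_H x ⊗ x'`, with values in `(D ⊗ D̂) ⊗_H (Ĉ ⊗ C)`. -/
def toDC : (D ⊗[k] D) ⊗[k] (C ⊗[k] C) →ₗ[k] (D ⊗[k] (Pen k H D ⊗[H] Pen k H C)) ⊗[k] C :=
  TensorProduct.map
    (((proj k H (Pen k H D) (Pen k H C)).restrictScalars k ∘ₗ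
      TensorProduct.map (Pen.of k H D).toLinearMap (Pen.of k H C).toLinearMap).lTensor D ∘ₗ
      (TensorProduct.assoc k D D C).toLinearMap)
    LinearMap.id ∘ₗ
  (TensorProduct.assoc k (D ⊗[k] D) C C).symm.toLinearMap

variable {k H C D} in
/-- `σ(c₁ ⊗ c₂ ⊗_H d₁ ⊗ d₂h) = d₁ ⊗ d₂ ⊗_H c₁ ⊗ c₂S(h)` for all `c ∈ C`, `d ∈ D`, `h ∈ H`. -/
def IsGaloisSwap [Coalgebra k C] [Coalgebra k D]
    (σ : SwapMap k H C (Pen k H C) D (Pen k H D)) : Prop :=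
  ∀ (c : C) (d : D) (h : H),
    σ.toLinearMap (toCD k H C D (Coalgebra.comul (R := k) c ⊗ₜ[k]
      (act k H D h).lTensor D (Coalgebra.comul (R := k) d))) =
    toDC k H C D (Coalgebra.comul (R := k) d ⊗ₜ[k]
      (act k H C (HopfAlgebra.antipode k h)).lTensor C (Coalgebra.comul (R := k) c))

end Sigma

end

end HerdTheory

namespace HerdTheory

noncomputable section

open TensorProduct

/-! Everything is expressed through the translation map `e = (ε ⊗ H) ∘ δ⁻¹ : C ⊗ C → H`. When `δ` is
bijective, `e` satisfies `e(c, dh) = e(c, d)h`, `e(c₁, c₂) = ε(c)` and `c₁e(c₂, d) = ε(c)d`.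
Conversely, any `e` with these identities makes `c ⊗ d ↦ c₁ ⊗ e(c₂, d)` a two-sided inverse of `δ`,
and is then the translation map (`IsTranslation.delta_bijective`, `IsTranslation.evLin_eq`). Being a
Galois co-object amounts to bijectivity of `δ` together with an element of counit `1`. In one
direction `δ` is the unit of the adjunction at the Hopf module `H ⊗ C`
(`IsGaloisCoobject.delta_bijective`). In the other, `m ⊗ c ↦ m₀e(m₁, c)` inverts the unit
(`isGaloisCoobject_of_delta_bijective`).

The herd axioms for `C` reduce to coassociativity, to `e(c₁, c₂) = ε(c)` and to the exchange rule
`S(e(x, y))z = e(y, z)x` (`IsTranslation.antipode_smul`). For `C ⊗_H D` the product `e_C(c,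
c')e_D(d, d')` satisfies the three identities (`isTranslation_compEv`). So `δ` is bijective there,
and the evaluation of its herd is that product, which is the composite evaluation read through the
twist.

Since `δ_C` and `δ_D` are onto and scalars slide across `⊗_H`, the elements `c₁ ⊗ c₂ ⊗_H d₁ ⊗ d₂h`
span the source of `σ` (`ext_toCD`), which gives uniqueness. Existence comes from the closed formula
`x ⊗ y ⊗_H d ⊗ q ↦ e(x, y₁)d₁ ⊗ d₂ ⊗_H y₂ ⊗ y₃S(e(d₃, q))` (`galoisSwap`). On the spanning elements
the coring coproducts only apply `Δ` to `c` or `d`, so the smash conditions become identities about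
moving `c`'s past `d`'s (`IsGaloisSwap.isSmash`).

In the composite shepherd `σ` only meets spanning elements with `h = 1`, where it is the plain
interchange. Both shepherds therefore interleave `c₁ ⊗ c₂ ⊗ c₃` with `d₁ ⊗ d₂ ⊗ d₃`
(`comp_shepherd`, `galoisHerd_shepherd_comp`). The composite inherits the herd axioms by transport
along the twist, without a separate verification. -/

/-- Additive functions on a tensor product that agree on pure tensors are equal. -/
theorem tmul_ext {R M N L : Type*} [CommSemiring R] [AddCommMonoid M] [Module R M]
    [AddCommMonoid N] [Module R N] [Add L] {f g : M ⊗[R] N → L}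
    (h : ∀ m n, f (m ⊗ₜ[R] n) = g (m ⊗ₜ[R] n))
    (h0 : f 0 = g 0 := by simp)
    (hf : ∀ x y, f (x + y) = f x + f y := by
      intros; simp only [map_add, LinearMap.add_apply, LinearMap.lTensor_add, add_tmul, tmul_add,
        smul_add, add_smul, mul_add, add_mul])
    (hg : ∀ x y, g (x + y) = g x + g y := by
      intros; simp only [map_add, LinearMap.add_apply, LinearMap.lTensor_add, add_tmul, tmul_add,
        smul_add, add_smul, mul_add, add_mul]) (z : M ⊗[R] N) : f z = g z := by
  induction z with
  | zero => exact h0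
  | add x y hx hy => rw [hf, hg, hx, hy]
  | tmul m n => exact h m n

/-! ### Translation maps and the Galois property -/

section Translation

variable {k H : Type u} [CommRing k] [CommRing H] [HopfAlgebra k H]
  {C : Type u} [AddCommGroup C] [Module k C] [Module H C] [IsScalarTower k H C]

/-- The map `a ⊗ b ↦ a e(b, c)`. -/
def evSmul (e : C ⊗[k] C →ₗ[k] H) (c : C) : C ⊗[k] C →ₗ[k] C :=
  TensorProduct.lift ((act k H C).flip.compl₂ (e ∘ₗ (TensorProduct.mk k C C).flip c))

@[simp]
theorem evSmul_tmul (e : C ⊗[k] C →ₗ[k] H) (c a b : C) :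
    evSmul e c (a ⊗ₜ[k] b) = e (b ⊗ₜ[k] c) • a := rfl

variable [Coalgebra k C]

theorem delta_tmul (c : C) (h : H) :
    delta k H C (c ⊗ₜ[k] h) = (act k H C h).lTensor C (Coalgebra.comul (R := k) c) := by
  simp only [delta, LinearMap.comp_apply, LinearMap.rTensor_tmul]
  generalize Coalgebra.comul (R := k) c = w
  revert w
  refine tmul_ext fun x y => ?_
  simp

/-- The identities `e(c, dh) = e(c, d)h`, `e(c₁, c₂) = ε(c)` and `c₁e(c₂, d) = ε(c)d`, which
characterize the map `(ε ⊗ H) ∘ δ⁻¹`. -/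
structure IsTranslation (e : C ⊗[k] C →ₗ[k] H) : Prop where
  smul_right : ∀ (h : H) (c d : C), e (c ⊗ₜ[k] (h • d)) = h * e (c ⊗ₜ[k] d)
  comul : ∀ c : C, e (Coalgebra.comul (R := k) c) = algebraMap k H (Coalgebra.counit (R := k) c)
  evSmul_comul : ∀ c d : C,
    evSmul e d (Coalgebra.comul (R := k) c) = Coalgebra.counit (R := k) c • d

/-- `c ⊗ d ↦ c₁ ⊗ e(c₂, d)`. -/
def deltaInv (e : C ⊗[k] C →ₗ[k] H) : C ⊗[k] C →ₗ[k] C ⊗[k] H :=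
  e.lTensor C ∘ₗ (TensorProduct.assoc k C C C).toLinearMap ∘ₗ
    (Coalgebra.comul (R := k) (A := C)).rTensor C

/-- The normalization is the definition of `evLin` read on `δ(c ⊗ 1) = Δ(c)`. The last identity is
linear in `c ⊗ d`, hence can be tested on the image of `δ`. -/
theorem isTranslation_evLin (hδ : Function.Bijective (delta k H C)) :
    IsTranslation (evLin hδ) where
  smul_right := evLin_smul_right hδ
  comul c := by
    have h1 := delta_tmul (k := k) (H := H) c 1
    rw [act_one, LinearMap.lTensor_id, LinearMap.id_apply] at h1
    rw [← h1, evLin_delta]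
    simp [Algebra.algebraMap_eq_smul_one]
  evSmul_comul c d := by
    -- For `z = c ⊗ h` the left side is `c₁e(c₂, c₃h) = c₁ε(c₂)h = ch`, and the right side is
    -- `ε(c₁)c₂h = ch`.
    have key : ∀ z : C ⊗[k] H, TensorProduct.lift (act k H C).flip
        ((evLin hδ).lTensor C (TensorProduct.assoc k C C C
          ((Coalgebra.comul (R := k)).rTensor C (delta k H C z)))) =
        TensorProduct.lid k C ((Coalgebra.counit (R := k) (A := C)).rTensor C
          (delta k H C z)) := by
      refine tmul_ext fun c h => ?_
      have h1 : ∀ w : C ⊗[k] C, (Coalgebra.comul (R := k) (A := C)).rTensor C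
          ((act k H C h).lTensor C w) = (act k H C h).lTensor (C ⊗[k] C)
            ((Coalgebra.comul (R := k) (A := C)).rTensor C w) := by
        intro w
        rw [← LinearMap.comp_apply, LinearMap.rTensor_comp_lTensor,
          ← LinearMap.comp_apply, LinearMap.lTensor_comp_rTensor]
      have h2 : ∀ w : (C ⊗[k] C) ⊗[k] C, TensorProduct.assoc k C C C
          ((act k H C h).lTensor (C ⊗[k] C) w) =
          ((act k H C h).lTensor C).lTensor C (TensorProduct.assoc k C C C w) := by
        intro w
        rw [LinearMap.lTensor_tensor]
        simp
      have h3 : ∀ w : C ⊗[k] C, (evLin hδ).lTensor C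
          (((act k H C h).lTensor C).lTensor C
            ((Coalgebra.comul (R := k) (A := C)).lTensor C w)) =
          TensorProduct.map LinearMap.id
            (LinearMap.toSpanSingleton k H h ∘ₗ Coalgebra.counit (R := k)) w := by
        refine tmul_ext fun x y => ?_
        simp only [LinearMap.lTensor_tmul, ← delta_tmul, evLin_delta]
        simp
      have h4 : ∀ w : C ⊗[k] C, TensorProduct.lift (act k H C).flip
          (TensorProduct.map LinearMap.id
            (LinearMap.toSpanSingleton k H h ∘ₗ Coalgebra.counit (R := k)) w) =
          h • TensorProduct.rid k C ((Coalgebra.counit (R := k)).lTensor C w) := by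
        refine tmul_ext fun x y => ?_
        simp [smul_comm h]
      have h5 : ∀ w : C ⊗[k] C, (Coalgebra.counit (R := k) (A := C)).rTensor C
          ((act k H C h).lTensor C w) = (act k H C h).lTensor k
            ((Coalgebra.counit (R := k) (A := C)).rTensor C w) := by
        intro w
        rw [← LinearMap.comp_apply, LinearMap.rTensor_comp_lTensor,
          ← LinearMap.comp_apply, LinearMap.lTensor_comp_rTensor]
      rw [delta_tmul, h1, h2, Coalgebra.coassoc_apply, h3, h4,
        Coalgebra.lTensor_counit_comul, h5, Coalgebra.rTensor_counit_comul]
      simp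
    obtain ⟨z, hz⟩ := hδ.2 (c ⊗ₜ[k] d)
    have h1 := key z
    rw [hz] at h1
    simp only [LinearMap.rTensor_tmul, TensorProduct.lid_tmul] at h1
    rw [← h1]
    generalize Coalgebra.comul (R := k) c = w
    revert w
    refine tmul_ext fun x y => ?_
    simp

namespace IsTranslation

variable {e : C ⊗[k] C →ₗ[k] H}

theorem lTensor_act_comul (he : IsTranslation e) (h : H) (c : C) :
    e ((act k H C h).lTensor C (Coalgebra.comul (R := k) c)) =
      Coalgebra.counit (R := k) c • h := by
  have h1 : ∀ w : C ⊗[k] C, e ((act k H C h).lTensor C w) = h * e w := by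
    refine tmul_ext fun x y => ?_
    simp [he.smul_right]
  rw [h1, he.comul, Algebra.smul_def, mul_comm]

/-- In Sweedler notation, `c₁ ⊗ e(c₂, c₃h) = c₁ ⊗ ε(c₂)h = c ⊗ h`. -/
theorem deltaInv_delta (he : IsTranslation e) (z : C ⊗[k] H) :
    deltaInv e (delta k H C z) = z := by
  revert z
  refine tmul_ext fun c h => ?_
  have h1 : ∀ w : C ⊗[k] C, TensorProduct.assoc k C C C
      ((Coalgebra.comul (R := k)).rTensor C ((act k H C h).lTensor C w)) =
      ((act k H C h).lTensor C).lTensor C (TensorProduct.assoc k C C C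
        ((Coalgebra.comul (R := k)).rTensor C w)) := by
    intro w
    rw [← LinearMap.comp_apply (LinearMap.rTensor _ _), LinearMap.rTensor_comp_lTensor,
      ← LinearMap.lTensor_comp_rTensor, LinearMap.lTensor_tensor]
    simp
  have h2 : ∀ w : C ⊗[k] C, e.lTensor C (((act k H C h).lTensor C).lTensor C
      ((Coalgebra.comul (R := k)).lTensor C w)) =
      TensorProduct.map LinearMap.id (LinearMap.toSpanSingleton k H h)
        ((Coalgebra.counit (R := k)).lTensor C w) := by
    refine tmul_ext fun x y => ?_
    simp [he.lTensor_act_comul]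
  rw [delta_tmul, deltaInv]
  simp only [LinearMap.comp_apply, LinearEquiv.coe_coe]
  rw [h1, Coalgebra.coassoc_apply, h2, Coalgebra.lTensor_counit_comul]
  simp

/-- In Sweedler notation, `c₁ ⊗ c₂e(c₃, d) = c₁ ⊗ ε(c₂)d = c ⊗ d`. -/
theorem delta_deltaInv (he : IsTranslation e) (z : C ⊗[k] C) :
    delta k H C (deltaInv e z) = z := by
  revert z
  refine tmul_ext fun c d => ?_
  have h1 : ∀ w : C ⊗[k] C, delta k H C (e.lTensor C (TensorProduct.assoc k C C C
      (w ⊗ₜ[k] d))) = (evSmul e d).lTensor C (TensorProduct.assoc k C C C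
        ((Coalgebra.comul (R := k)).rTensor C w)) := by
    refine tmul_ext fun x y => ?_
    simp only [TensorProduct.assoc_tmul, LinearMap.lTensor_tmul, delta_tmul,
      LinearMap.rTensor_tmul]
    generalize Coalgebra.comul (R := k) x = v
    revert v
    refine tmul_ext fun x y => ?_
    simp
  have h2 : ∀ w : C ⊗[k] C, (evSmul e d).lTensor C ((Coalgebra.comul (R := k)).lTensor C w) =
      TensorProduct.map LinearMap.id (LinearMap.toSpanSingleton k C d)
        ((Coalgebra.counit (R := k)).lTensor C w) := by
    refine tmul_ext fun x y => ?_
    simp [he.evSmul_comul]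
  rw [deltaInv]
  simp only [LinearMap.comp_apply, LinearEquiv.coe_coe, LinearMap.rTensor_tmul]
  rw [h1, Coalgebra.coassoc_apply, h2, Coalgebra.lTensor_counit_comul]
  simp

theorem delta_bijective (he : IsTranslation e) : Function.Bijective (delta k H C) :=
  ⟨Function.LeftInverse.injective he.deltaInv_delta,
    Function.RightInverse.surjective he.delta_deltaInv⟩

/-- Uniqueness of the translation map: its values on the image of `δ` are forced. This lets the
evaluation of `C ⊗_H D` be computed from any candidate satisfying the three identities. -/
theorem evLin_eq (he : IsTranslation e) (hδ : Function.Bijective (delta k H C)) :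
    evLin hδ = e := by
  refine LinearMap.ext fun z => ?_
  obtain ⟨w, rfl⟩ := hδ.2 z
  rw [evLin_delta]
  revert w
  refine tmul_ext fun c h => ?_
  rw [delta_tmul, he.lTensor_act_comul]
  simp

/-- Apply `ε` to `c₁e(c₂, d) = ε(c)d`; the left side collapses to `ε(e(c, d))` by counitality. -/
theorem counit_ev [ModuleCoalgebra k H C] (he : IsTranslation e) (c d : C) :
    Coalgebra.counit (R := k) (e (c ⊗ₜ[k] d)) =
      Coalgebra.counit (R := k) c * Coalgebra.counit (R := k) d := by
  have h1 : ∀ w : C ⊗[k] C, Coalgebra.counit (R := k) (evSmul e d w) =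
      Coalgebra.counit (R := k) (e (TensorProduct.lid k C
        ((Coalgebra.counit (R := k)).rTensor C w) ⊗ₜ[k] d)) := by
    refine tmul_ext fun x y => ?_
    simp [ModuleCoalgebra.counit_smul, ← TensorProduct.smul_tmul', mul_comm]
  have h2 := h1 (Coalgebra.comul (R := k) c)
  rw [he.evSmul_comul, Coalgebra.rTensor_counit_comul] at h2
  simpa using h2.symm

end IsTranslation

/-- Surjectivity of the adjunction counit at the module `k` suffices: its image consists of values
of `ε`. -/
theorem IsGaloisCoobject.exists_counit_eq_one [ModuleCoalgebra k H C]
    (hC : IsGaloisCoobject k H C) : ∃ c : C, Coalgebra.counit (R := k) c = 1 := by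
  have h1 : ∀ z : (C ⊗[k] k) ⊗[H] CounitModule k H,
      ∃ c : C, Coalgebra.counit (R := k) c = adjCounit k H C k z := by
    intro z
    induction z with
    | zero => exact ⟨0, by simp⟩
    | add x y hx hy =>
      obtain ⟨a, ha⟩ := hx
      obtain ⟨b, hb⟩ := hy
      exact ⟨a + b, by simp [ha, hb]⟩
    | tmul z a =>
      induction z with
      | zero => exact ⟨0, by simp⟩
      | add x y hx hy =>
        obtain ⟨a, ha⟩ := hx
        obtain ⟨b, hb⟩ := hy
        exact ⟨a + b, by simp [ha, hb, add_tmul]⟩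
      | tmul c n =>
        refine ⟨CounitModule.equiv k H a • n • c, ?_⟩
        simp [adjCounit, mul_comm n]
  obtain ⟨z, hz⟩ := (hC.counit_bijective k).2 1
  obtain ⟨c, hc⟩ := h1 z
  exact ⟨c, hc.trans hz⟩

end Translation

/-! ### The Galois property and bijectivity of `δ` -/

section Criterion

variable {k H : Type u} [CommRing k] [CommRing H] [HopfAlgebra k H]
  {C : Type u} [AddCommGroup C] [Module k C] [Module H C] [IsScalarTower k H C]
  {e : C ⊗[k] C →ₗ[k] H}

/-- A `k`-linear map that is multiplied by `ε(h)` when its argument is multiplied by `h` factors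
through `M ⊗_H k`. -/
def liftCounit {M L : Type u} [AddCommGroup M] [Module k M] [Module H M] [IsScalarTower k H M]
    [AddCommGroup L] [Module k L] (f : M →ₗ[k] L)
    (hf : ∀ (h : H) (m : M), f (h • m) = Coalgebra.counit (R := k) h • f m) :
    M ⊗[H] CounitModule k H →ₗ[k] L :=
  liftBal ((LinearMap.lsmul k L).flip.compl₂ (CounitModule.equiv k H).toLinearMap ∘ₗ f)
    (by
      intro h m a
      simp [CounitModule.smul_def, hf, smul_smul])

theorem liftCounit_tmul {M L : Type u} [AddCommGroup M] [Module k M] [Module H M]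
    [IsScalarTower k H M] [AddCommGroup L] [Module k L] (f : M →ₗ[k] L)
    (hf : ∀ (h : H) (m : M), f (h • m) = Coalgebra.counit (R := k) h • f m) (m : M) :
    liftCounit f hf (m ⊗ₜ[H] CounitModule.one k H) = f m :=
  one_smul k (f m)

theorem tmul_counitModule {M : Type u} [AddCommGroup M] [Module k M] [Module H M]
    [IsScalarTower k H M] (m : M) (a : CounitModule k H) :
    m ⊗ₜ[H] a = (CounitModule.equiv k H a • m) ⊗ₜ[H] CounitModule.one k H := by
  rw [TensorProduct.smul_tmul]
  congr 1
  exact (mul_one (CounitModule.equiv k H a)).symm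

theorem smul_tmul_one {M : Type u} [AddCommGroup M] [Module k M] [Module H M]
    [IsScalarTower k H M] (h : H) (m : M) :
    (h • m) ⊗ₜ[H] CounitModule.one k H =
      Coalgebra.counit (R := k) h • (m ⊗ₜ[H] CounitModule.one k H) := by
  rw [TensorProduct.smul_tmul, CounitModule.smul_def, TensorProduct.tmul_smul]

theorem exists_tmul_one {M : Type u} [AddCommGroup M] [Module k M] [Module H M]
    [IsScalarTower k H M] (z : M ⊗[H] CounitModule k H) :
    ∃ m : M, z = m ⊗ₜ[H] CounitModule.one k H := by
  induction z with
  | zero => exact ⟨0, by simp⟩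
  | add x y hx hy =>
    obtain ⟨a, rfl⟩ := hx
    obtain ⟨b, rfl⟩ := hy
    exact ⟨a + b, by rw [add_tmul]⟩
  | tmul m a => exact ⟨_, tmul_counitModule m a⟩

/-- The map `m ⊗ c ⊗ d ↦ m e(c, d)`. -/
def coactEv (e : C ⊗[k] C →ₗ[k] H) (M : Type u) [AddCommGroup M] [Module k M] [Module H M]
    [IsScalarTower k H M] : M ⊗[k] (C ⊗[k] C) →ₗ[k] M :=
  TensorProduct.lift (act k H M).flip ∘ₗ e.lTensor M

/-- `m ⊗ c ↦ m₀ e(m₁, c)`. -/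
def evCoact {M : Type u} [AddCommGroup M] [Module k M] [Module H M] [IsScalarTower k H M]
    (e : C ⊗[k] C →ₗ[k] H) (ρ : M →ₗ[k] M ⊗[k] C) : M ⊗[k] C →ₗ[k] M :=
  coactEv e M ∘ₗ (TensorProduct.assoc k M C C).toLinearMap ∘ₗ ρ.rTensor C

variable [Coalgebra k C]

/-- The factor produced by `h` is `h₁S(h₂) = ε(h)`, as `e` is antipode-linear in its first argument.
Hence `m ⊗ c ↦ m₀e(m₁, c)` descends to `(M ⊗_H k) ⊗ C`. -/
theorem evCoact_smul {M : Type u} [AddCommGroup M] [Module k M] [Module H M] [IsScalarTower k H M]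
    {ρ : M →ₗ[k] M ⊗[k] C} (hρ : IsHopfModule H ρ)
    (he : ∀ (h : H) (c d : C),
      e ((h • c) ⊗ₜ[k] d) = HopfAlgebra.antipode k h * e (c ⊗ₜ[k] d))
    (h : H) (m : M) (c : C) :
    evCoact e ρ ((h • m) ⊗ₜ[k] c) = Coalgebra.counit (R := k) h • evCoact e ρ (m ⊗ₜ[k] c) := by
  have h1 : ∀ (v : H ⊗[k] H) (w : M ⊗[k] C), coactEv e M (TensorProduct.assoc k M C C
      (TensorProduct.map₂ (act k H M) (act k H C) v w ⊗ₜ[k] c)) =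
      LinearMap.mul' k H ((HopfAlgebra.antipode k).lTensor H v) •
        coactEv e M (TensorProduct.assoc k M C C (w ⊗ₜ[k] c)) := by
    intro v w
    revert v
    refine tmul_ext fun a b => ?_
    revert w
    refine tmul_ext fun x y => ?_
    simp only [TensorProduct.map₂_apply_tmul, TensorProduct.map_tmul, act_apply,
      TensorProduct.assoc_tmul, coactEv, LinearMap.comp_apply, LinearMap.lTensor_tmul,
      TensorProduct.lift.tmul, LinearMap.flip_apply, he, smul_smul, LinearMap.mul'_apply]
    congr 1
    ring
  simp only [evCoact, LinearMap.comp_apply, LinearEquiv.coe_coe, LinearMap.rTensor_tmul,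
    hρ.map_smul]
  rw [h1, HopfAlgebra.mul_antipode_lTensor_comul_apply, algebraMap_smul]

/-- The inverse sends `(m ⊗ 1) ⊗ c` to `m₀e(m₁, c)`. One composite is `m₀e(m₁, m₂) = m₀ε(m₁) = m`.
The other is `(m₀ ⊗ 1) ⊗ m₁e(m₂, c) = (m ⊗ 1) ⊗ c`. -/
theorem IsTranslation.adjUnit_bijective (he : IsTranslation e)
    (he' : ∀ (h : H) (c d : C),
      e ((h • c) ⊗ₜ[k] d) = HopfAlgebra.antipode k h * e (c ⊗ₜ[k] d))
    (M : Type u) [AddCommGroup M] [Module k M] [Module H M] [IsScalarTower k H M]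
    {ρ : M →ₗ[k] M ⊗[k] C} (hρ : IsHopfModule H ρ) : Function.Bijective (adjUnit H ρ) := by
  let inv : (M ⊗[H] CounitModule k H) ⊗[k] C →ₗ[k] M :=
    TensorProduct.lift (liftCounit (TensorProduct.curry (evCoact e ρ)) (by
      intro h m
      ext c
      exact evCoact_smul hρ he' h m c))
  have hinv : ∀ (m : M) (c : C), inv ((m ⊗ₜ[H] CounitModule.one k H) ⊗ₜ[k] c) =
      evCoact e ρ (m ⊗ₜ[k] c) := by
    intro m c
    simp only [inv, TensorProduct.lift.tmul]
    rw [liftCounit_tmul]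
    rfl
  refine ⟨Function.LeftInverse.injective (g := inv) ?_,
    Function.RightInverse.surjective (g := inv) ?_⟩
  · intro m
    have h1 : ∀ w : M ⊗[k] C, inv ((((TensorProduct.mk H M (CounitModule k H)).flip
        (CounitModule.one k H)).restrictScalars k).rTensor C w) = evCoact e ρ w := by
      refine tmul_ext fun x y => ?_
      simpa using hinv x y
    have h2 : ∀ w : M ⊗[k] C, coactEv e M ((Coalgebra.comul (R := k) (A := C)).lTensor M w) =
        TensorProduct.rid k M ((Coalgebra.counit (R := k) (A := C)).lTensor M w) := by
      refine tmul_ext fun x y => ?_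
      simp [coactEv, he.comul]
    have h3 := LinearMap.congr_fun hρ.coassoc m
    simp only [LinearMap.comp_apply, LinearEquiv.coe_coe] at h3
    simp only [adjUnit, LinearMap.comp_apply]
    rw [h1, evCoact]
    simp only [LinearMap.comp_apply, LinearEquiv.coe_coe]
    rw [h3, h2, hρ.counital]
    simp
  · intro z
    induction z with
    | zero => simp
    | add x y hx hy => rw [map_add, map_add, hx, hy]
    | tmul z c =>
      obtain ⟨m, rfl⟩ := exists_tmul_one z
      rw [hinv]
      have h1 : ∀ w : M ⊗[k] C, adjUnit H ρ (coactEv e M (TensorProduct.assoc k M C C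
          (w ⊗ₜ[k] c))) = TensorProduct.map (((TensorProduct.mk H M (CounitModule k H)).flip
            (CounitModule.one k H)).restrictScalars k) (evSmul e c)
          (TensorProduct.assoc k M C C (ρ.rTensor C w)) := by
        refine tmul_ext fun x y => ?_
        -- In `ρ(mh) = m₀h₁ ⊗ m₁h₂` the factor `h₁` becomes `ε(h₁)` in `M ⊗_H k`, so the whole of
        -- `h` ends up acting on the `C`-leg.
        have h2 : ∀ (v : H ⊗[k] H) (w : M ⊗[k] C),
            (((TensorProduct.mk H M (CounitModule k H)).flip
              (CounitModule.one k H)).restrictScalars k).rTensor C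
            (TensorProduct.map₂ (act k H M) (act k H C) v w) =
            (((TensorProduct.mk H M (CounitModule k H)).flip
              (CounitModule.one k H)).restrictScalars k).rTensor C
            ((act k H C (TensorProduct.lid k H ((Coalgebra.counit (R := k)).rTensor H v))).lTensor
              M w) := by
          intro v w
          induction v with
          | zero => simp
          | add x y hx hy =>
            simp only [map_add, LinearMap.add_apply, LinearMap.lTensor_add, hx, hy]
          | tmul a b =>
            revert w
            refine tmul_ext fun x y => ?_
            simp only [TensorProduct.map₂_apply_tmul, TensorProduct.map_tmul, act_apply,
              LinearMap.rTensor_tmul,             LinearMap.restrictScalars_apply, LinearMap.flip_apply, TensorProduct.mk_apply,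
              TensorProduct.lid_tmul, LinearMap.lTensor_tmul, smul_assoc,
              TensorProduct.tmul_smul]
            rw [TensorProduct.smul_tmul', smul_tmul_one, ← TensorProduct.smul_tmul',
              LinearMap.rTensor_tmul, map_smul, ← TensorProduct.smul_tmul']
            rfl
        simp only [coactEv, LinearMap.comp_apply, TensorProduct.assoc_tmul,
          LinearMap.lTensor_tmul, TensorProduct.lift.tmul, LinearMap.flip_apply, act_apply,
          adjUnit, hρ.map_smul, h2, Coalgebra.rTensor_counit_comul, TensorProduct.lid_tmul,
          one_smul, LinearMap.rTensor_tmul]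
        generalize ρ x = w
        revert w
        refine tmul_ext fun x y => ?_
        simp
      have h3 := LinearMap.congr_fun hρ.coassoc m
      simp only [LinearMap.comp_apply, LinearEquiv.coe_coe] at h3
      have h4 : ∀ w : M ⊗[k] C, TensorProduct.map (((TensorProduct.mk H M (CounitModule k H)).flip
            (CounitModule.one k H)).restrictScalars k) (evSmul e c)
            ((Coalgebra.comul (R := k) (A := C)).lTensor M w) =
          TensorProduct.map (((TensorProduct.mk H M (CounitModule k H)).flip
            (CounitModule.one k H)).restrictScalars k) (LinearMap.toSpanSingleton k C c)
            ((Coalgebra.counit (R := k) (A := C)).lTensor M w) := by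
        refine tmul_ext fun x y => ?_
        simp [he.evSmul_comul]
      rw [evCoact]
      simp only [LinearMap.comp_apply, LinearEquiv.coe_coe, LinearMap.rTensor_tmul]
      rw [h1, h3, h4, hρ.counital]
      simp

variable [ModuleCoalgebra k H C]

theorem adjCounit_tmul_one {N : Type u} [AddCommGroup N] [Module k N] (c : C) (n : N) :
    adjCounit k H C N ((c ⊗ₜ[k] n) ⊗ₜ[H] CounitModule.one k H) =
      Coalgebra.counit (R := k) c • n :=
  one_smul k _

/-- Write `c = ε(c₀)c = (c₀)₁e((c₀)₂, c)`. In the tensor product with `k` over `H` the scalar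
`e((c₀)₂, c)` acts through its counit `ε((c₀)₂)ε(c)`, which leaves `c₀`. -/
theorem IsTranslation.tmul_one_eq (he : IsTranslation e) {c₀ : C}
    (hc₀ : Coalgebra.counit (R := k) c₀ = 1) {N : Type u} [AddCommGroup N] [Module k N]
    (c : C) (n : N) :
    ((c ⊗ₜ[k] n) ⊗ₜ[H] CounitModule.one k H : (C ⊗[k] N) ⊗[H] CounitModule k H) =
      (c₀ ⊗ₜ[k] (Coalgebra.counit (R := k) c • n)) ⊗ₜ[H] CounitModule.one k H := by
  have h1 : ∀ w : C ⊗[k] C,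
      ((evSmul e c w ⊗ₜ[k] n) ⊗ₜ[H] CounitModule.one k H : (C ⊗[k] N) ⊗[H] CounitModule k H) =
      (TensorProduct.rid k C ((Coalgebra.counit (R := k)).lTensor C w) ⊗ₜ[k]
        (Coalgebra.counit (R := k) c • n)) ⊗ₜ[H] CounitModule.one k H := by
    refine tmul_ext fun x y => ?_
    rw [evSmul_tmul, ← TensorProduct.smul_tmul', smul_tmul_one, he.counit_ev]
    simp only [LinearMap.lTensor_tmul, TensorProduct.rid_tmul, ← TensorProduct.smul_tmul',
      TensorProduct.tmul_smul, mul_smul]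
    rw [smul_comm]
  have h2 := h1 (Coalgebra.comul (R := k) c₀)
  rw [he.evSmul_comul, hc₀, one_smul, Coalgebra.lTensor_counit_comul] at h2
  simpa using h2

/-- The map `n ↦ (c₀ ⊗ n) ⊗ 1` is a two-sided inverse. -/
theorem IsTranslation.adjCounit_bijective (he : IsTranslation e) {c₀ : C}
    (hc₀ : Coalgebra.counit (R := k) c₀ = 1) (N : Type u) [AddCommGroup N] [Module k N] :
    Function.Bijective (adjCounit k H C N) := by
  have h1 : ∀ z : C ⊗[k] N, (z ⊗ₜ[H] CounitModule.one k H : (C ⊗[k] N) ⊗[H] CounitModule k H) =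
      (c₀ ⊗ₜ[k] adjCounit k H C N (z ⊗ₜ[H] CounitModule.one k H)) ⊗ₜ[H]
        CounitModule.one k H := by
    intro z
    induction z with
    | zero => simp
    | add x y hx hy =>
      simp only [add_tmul, map_add, tmul_add]
      rw [← hx, ← hy]
    | tmul c n => rw [adjCounit_tmul_one, he.tmul_one_eq hc₀]
  constructor
  · intro z z' hz
    obtain ⟨m, rfl⟩ := exists_tmul_one z
    obtain ⟨m', rfl⟩ := exists_tmul_one z'
    rw [h1, hz, ← h1]
  · intro n
    exact ⟨(c₀ ⊗ₜ[k] n) ⊗ₜ[H] CounitModule.one k H, by rw [adjCounit_tmul_one, hc₀, one_smul]⟩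

/-- A module coalgebra with bijective `δ` and an element of counit `1` is a Galois co-object. -/
theorem isGaloisCoobject_of_delta_bijective (hδ : Function.Bijective (delta k H C)) {c₀ : C}
    (hc₀ : Coalgebra.counit (R := k) c₀ = 1) : IsGaloisCoobject k H C where
  counit_bijective N _ _ := (isTranslation_evLin hδ).adjCounit_bijective hc₀ N
  unit_bijective M _ _ _ _ _ hρ :=
    (isTranslation_evLin hδ).adjUnit_bijective (evLin_smul_left hδ) M hρ

/-! ### The Hopf module `H ⊗ C`, and bijectivity of `δ` for a Galois co-object. -/

variable (k H C) in
/-- The coaction `h ⊗ c ↦ (h₁ ⊗ c₁) ⊗ c₂h₂` on `H ⊗ C`. -/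
def tensorCoaction : H ⊗[k] C →ₗ[k] (H ⊗[k] C) ⊗[k] C :=
  (TensorProduct.lift (act k H C)).lTensor (H ⊗[k] C) ∘ₗ
    Coalgebra.comul (R := k) (A := H ⊗[k] C)

/-- The coaction is the comultiplication of the tensor product coalgebra `H ⊗ C` followed by the
action `H ⊗ C → C` on the second leg. The module coalgebra axioms say that this action is a
coalgebra map, so coassociativity and counitality are inherited. Here `H` acts on `H ⊗ C` through
the factor `H` only. -/
theorem isHopfModule_tensorCoaction : IsHopfModule H (tensorCoaction k H C) where
  coassoc := by
    have h0 : ∀ z : H ⊗[k] C, Coalgebra.comul (R := k) (TensorProduct.lift (act k H C) z) =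
        TensorProduct.map (TensorProduct.lift (act k H C)) (TensorProduct.lift (act k H C))
          (Coalgebra.comul (R := k) z) := by
      refine tmul_ext fun h c => ?_
      rw [TensorProduct.lift.tmul, act_apply, ModuleCoalgebra.comul_smul,
        TensorProduct.comul_tmul]
      generalize Coalgebra.comul (R := k) h = x
      generalize Coalgebra.comul (R := k) c = y
      revert x
      refine tmul_ext fun a a' => ?_
      revert y
      refine tmul_ext fun b b' => ?_
      simp
    refine LinearMap.ext fun m => ?_
    simp only [tensorCoaction, LinearMap.comp_apply, LinearEquiv.coe_coe]
    have h1 : ∀ w : (H ⊗[k] C) ⊗[k] (H ⊗[k] C), TensorProduct.assoc k (H ⊗[k] C) C C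
        (((TensorProduct.lift (act k H C)).lTensor (H ⊗[k] C) ∘ₗ
          Coalgebra.comul (R := k) (A := H ⊗[k] C)).rTensor C
          ((TensorProduct.lift (act k H C)).lTensor (H ⊗[k] C) w)) =
        (TensorProduct.map (TensorProduct.lift (act k H C))
          (TensorProduct.lift (act k H C))).lTensor (H ⊗[k] C)
          (TensorProduct.assoc k _ _ _ ((Coalgebra.comul (R := k)).rTensor (H ⊗[k] C) w)) := by
      refine tmul_ext fun x y => ?_
      simp only [LinearMap.lTensor_tmul, LinearMap.rTensor_tmul, LinearMap.comp_apply]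
      generalize Coalgebra.comul (R := k) x = v
      revert v
      refine tmul_ext fun x x' => ?_
      simp
    have h2 : ∀ w : (H ⊗[k] C) ⊗[k] (H ⊗[k] C), (TensorProduct.map (TensorProduct.lift (act k H C))
          (TensorProduct.lift (act k H C))).lTensor (H ⊗[k] C)
          ((Coalgebra.comul (R := k)).lTensor (H ⊗[k] C) w) =
        (Coalgebra.comul (R := k)).lTensor (H ⊗[k] C)
          ((TensorProduct.lift (act k H C)).lTensor (H ⊗[k] C) w) := by
      refine tmul_ext fun x y => ?_
      simp only [LinearMap.lTensor_tmul, h0]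
    rw [h1, Coalgebra.coassoc_apply, h2]
  counital m := by
    have h1 : ∀ w : (H ⊗[k] C) ⊗[k] (H ⊗[k] C), (Coalgebra.counit (R := k) (A := C)).lTensor
        (H ⊗[k] C) ((TensorProduct.lift (act k H C)).lTensor (H ⊗[k] C) w) =
        (Coalgebra.counit (R := k) (A := H ⊗[k] C)).lTensor (H ⊗[k] C) w := by
      have h0 : Coalgebra.counit (R := k) (A := C) ∘ₗ TensorProduct.lift (act k H C) =
          Coalgebra.counit (R := k) (A := H ⊗[k] C) := by
        ext h c
        simp [ModuleCoalgebra.counit_smul, mul_comm]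
      intro w
      rw [← LinearMap.comp_apply, ← LinearMap.lTensor_comp, h0]
    rw [tensorCoaction, LinearMap.comp_apply, h1, Coalgebra.lTensor_counit_comul]
  map_smul h m := by
    revert m
    refine tmul_ext fun g c => ?_
    simp only [tensorCoaction, LinearMap.comp_apply, TensorProduct.smul_tmul', smul_eq_mul,
      TensorProduct.comul_tmul, Bialgebra.comul_mul]
    generalize Coalgebra.comul (R := k) h = x
    generalize Coalgebra.comul (R := k) g = y
    generalize Coalgebra.comul (R := k) c = z
    revert x
    refine tmul_ext fun a a' => ?_
    revert y
    refine tmul_ext fun b b' => ?_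
    revert z
    refine tmul_ext fun c c' => ?_
    simp [TensorProduct.smul_tmul', mul_smul]

/-- The map `(h ⊗ c) ⊗ 1 ↦ ε(h)c` identifies `(H ⊗ C) ⊗_H k` with `C`. Under it the adjunction unit
`h ⊗ c ↦ (h₁ ⊗ c₁) ⊗ c₂h₂` becomes `ε(h₁)c₁ ⊗ c₂h₂ = c₁ ⊗ c₂h`, that is, `δ` up to the flip. -/
theorem IsGaloisCoobject.delta_bijective (hC : IsGaloisCoobject k H C) :
    Function.Bijective (delta k H C) := by
  let f : (H ⊗[k] C) ⊗[H] CounitModule k H →ₗ[k] C :=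
    liftCounit (TensorProduct.lid k C ∘ₗ (Coalgebra.counit (R := k) (A := H)).rTensor C) (by
      intro h
      refine tmul_ext fun g c => ?_
      simp [TensorProduct.smul_tmul', mul_smul])
  have hf : ∀ (h : H) (c : C), f ((h ⊗ₜ[k] c) ⊗ₜ[H] CounitModule.one k H) =
      Coalgebra.counit (R := k) h • c := by
    intro h c
    simp only [f]
    rw [liftCounit_tmul]
    simp
  let g : C →ₗ[k] (H ⊗[k] C) ⊗[H] CounitModule k H :=
    ((TensorProduct.mk H (H ⊗[k] C) (CounitModule k H)).flip
      (CounitModule.one k H)).restrictScalars k ∘ₗ TensorProduct.mk k H C 1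
  have hfg : ∀ c, f (g c) = c := by
    intro c
    simpa [g] using hf 1 c
  have hgf : ∀ z, g (f z) = z := by
    intro z
    obtain ⟨m, rfl⟩ := exists_tmul_one z
    induction m with
    | zero => simp
    | add x y hx hy => rw [add_tmul, map_add, map_add, hx, hy]
    | tmul h c =>
      have h1 : h ⊗ₜ[k] c = h • ((1 : H) ⊗ₜ[k] c) := by simp [TensorProduct.smul_tmul']
      rw [hf, map_smul, h1, smul_tmul_one]
      rfl
  let E : (H ⊗[k] C) ⊗[H] CounitModule k H ≃ₗ[k] C :=
    LinearEquiv.ofLinearMap f g (LinearMap.ext hfg) (LinearMap.ext hgf)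
  have h1 : delta k H C = (E.rTensor C).toLinearMap ∘ₗ adjUnit H (tensorCoaction k H C) ∘ₗ
      (TensorProduct.comm k C H).toLinearMap := by
    refine TensorProduct.ext' fun c h => ?_
    have h2 : ∀ v : (H ⊗[k] C) ⊗[k] (H ⊗[k] C),
        E.rTensor C ((((TensorProduct.mk H (H ⊗[k] C) (CounitModule k H)).flip
          (CounitModule.one k H)).restrictScalars k).rTensor C
            ((TensorProduct.lift (act k H C)).lTensor (H ⊗[k] C) v)) =
        TensorProduct.map (TensorProduct.lid k C ∘ₗ (Coalgebra.counit (R := k) (A := H)).rTensor C)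
          (TensorProduct.lift (act k H C)) v := by
      refine tmul_ext fun x y => ?_
      simp [E, f, liftCounit_tmul]
    -- The scalar `ε(h₁)` is absorbed into `h₂`, so that counitality of `H` can be applied.
    have h3 : ∀ (x : H ⊗[k] H) (y : C ⊗[k] C),
        TensorProduct.map (TensorProduct.lid k C ∘ₗ (Coalgebra.counit (R := k) (A := H)).rTensor C)
          (TensorProduct.lift (act k H C))
          (TensorProduct.tensorTensorTensorComm k H H C C (x ⊗ₜ[k] y)) =
        (act k H C (TensorProduct.lid k H ((Coalgebra.counit (R := k)).rTensor H x))).lTensor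
          C y := by
      intro x y
      revert x
      refine tmul_ext fun a a' => ?_
      revert y
      refine tmul_ext fun b b' => ?_
      simp [TensorProduct.smul_tmul]
    simp only [LinearMap.comp_apply, LinearEquiv.coe_coe, TensorProduct.comm_tmul, adjUnit,
      tensorCoaction]
    rw [h2, delta_tmul, TensorProduct.comul_tmul]
    erw [h3]
    rw [Coalgebra.rTensor_counit_comul]
    simp
  rw [h1]
  simp only [LinearMap.coe_comp, LinearEquiv.coe_coe]
  exact (E.rTensor C).bijective.comp
    ((hC.unit_bijective _ _ isHopfModule_tensorCoaction).comp
      (TensorProduct.comm k C H).bijective)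

end Criterion

/-! ### The herd of a Galois co-object -/

section GaloisHerd

variable {k H : Type u} [CommRing k] [CommRing H] [HopfAlgebra k H]
  {C : Type u} [AddCommGroup C] [Module k C] [Coalgebra k C]

/-- The map `x ⊗ y ↦ e(x, y₁) ⊗ y₂`. -/
def evComul (e : C ⊗[k] C →ₗ[k] H) : C ⊗[k] C →ₗ[k] H ⊗[k] C :=
  e.rTensor C ∘ₗ (TensorProduct.assoc k C C C).symm.toLinearMap ∘ₗ
    (Coalgebra.comul (R := k) (A := C)).lTensor C

theorem evComul_tmul (e : C ⊗[k] C →ₗ[k] H) (x y : C) :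
    evComul e (x ⊗ₜ[k] y) = (e ∘ₗ TensorProduct.mk k C C x).rTensor C
      (Coalgebra.comul (R := k) y) := by
  simp only [evComul, LinearMap.comp_apply, LinearMap.lTensor_tmul]
  generalize Coalgebra.comul (R := k) y = w
  revert w
  refine tmul_ext fun x y => ?_
  simp

variable [Module H C] [IsScalarTower k H C]

/-- By coassociativity, `e(c₁, c₂) ⊗ c₃ = ε(c₁)1 ⊗ c₂`. -/
theorem IsTranslation.evComul_comul {e : C ⊗[k] C →ₗ[k] H} (he : IsTranslation e) (c : C) :
    evComul e (Coalgebra.comul (R := k) c) = (1 : H) ⊗ₜ[k] c := by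
  have h1 : e ∘ₗ Coalgebra.comul (R := k) =
      (Algebra.linearMap k H) ∘ₗ Coalgebra.counit (R := k) (A := C) :=
    LinearMap.ext he.comul
  simp only [evComul, LinearMap.comp_apply, LinearEquiv.coe_coe]
  rw [Coalgebra.coassoc_symm_apply, ← LinearMap.comp_apply (LinearMap.rTensor _ _),
    ← LinearMap.rTensor_comp, h1, LinearMap.rTensor_comp, LinearMap.comp_apply,
    Coalgebra.rTensor_counit_comul]
  simp

variable [ModuleCoalgebra k H C]

theorem evComul_smul_right {e : C ⊗[k] C →ₗ[k] H} (he : IsTranslation e) (h : H) (x y : C) :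
    evComul e (x ⊗ₜ[k] (h • y)) =
      TensorProduct.map₂ (LinearMap.mul k H) (act k H C) (Coalgebra.comul (R := k) h)
        (evComul e (x ⊗ₜ[k] y)) := by
  rw [evComul_tmul, evComul_tmul, ModuleCoalgebra.comul_smul]
  generalize Coalgebra.comul (R := k) h = v
  generalize Coalgebra.comul (R := k) y = w
  revert v
  refine tmul_ext fun a b => ?_
  revert w
  refine tmul_ext fun x y => ?_
  simp [he.smul_right]

/-- `S(e(x, y₁))y₂ = ε(y)x`. -/
theorem antipode_evComul {e : C ⊗[k] C →ₗ[k] H} (he : IsTranslation e) (z : C ⊗[k] C) :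
    TensorProduct.lift (act k H C) ((HopfAlgebra.antipode k).rTensor C (evComul e z)) =
      TensorProduct.rid k C ((Coalgebra.counit (R := k)).lTensor C z) := by
  -- It is enough to take `c₁ ⊗ c₂h`, where the left side is `S(e(c₁, c₂)h₁)c₃h₂ = S(h₁)h₂c =
  -- ε(h)c`.
  obtain ⟨w, rfl⟩ := he.delta_bijective.2 z
  revert w
  refine tmul_ext fun c h => ?_
  have h1 : ∀ w : C ⊗[k] C, evComul e ((act k H C h).lTensor C w) =
      TensorProduct.map₂ (LinearMap.mul k H) (act k H C) (Coalgebra.comul (R := k) h)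
        (evComul e w) := by
    refine tmul_ext fun x y => ?_
    simp [evComul_smul_right he]
  have h2 : ∀ v : H ⊗[k] H, TensorProduct.lift (act k H C)
      ((HopfAlgebra.antipode k).rTensor C
        (TensorProduct.map₂ (LinearMap.mul k H) (act k H C) v ((1 : H) ⊗ₜ[k] c))) =
      LinearMap.mul' k H ((HopfAlgebra.antipode k).rTensor H v) • c := by
    refine tmul_ext fun a b => ?_
    simp [smul_smul]
  have h3 : Coalgebra.counit (R := k) ∘ₗ act k H C h =
      Coalgebra.counit (R := k) h • Coalgebra.counit (R := k) (A := C) := by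
    ext x
    simp [ModuleCoalgebra.counit_smul]
  rw [delta_tmul, h1, he.evComul_comul, h2, HopfAlgebra.mul_antipode_rTensor_comul_apply,
    ← LinearMap.comp_apply (LinearMap.lTensor _ _), ← LinearMap.lTensor_comp, h3,
    LinearMap.lTensor_smul, LinearMap.smul_apply, Coalgebra.lTensor_counit_comul]
  simp

/-- `S(e(x, y))z = e(y, z)x`. -/
theorem IsTranslation.antipode_smul {e : C ⊗[k] C →ₗ[k] H} (he : IsTranslation e) (x y z : C) :
    HopfAlgebra.antipode k (e (x ⊗ₜ[k] y)) • z = e (y ⊗ₜ[k] z) • x := by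
  -- With `x` fixed, `y ⊗ z` is replaced by `c₁ ⊗ c₂h`. By `antipode_evComul`, `S(e(x, c₁))c₂h =
  -- ε(c)hx`, and this is `e(c₁, c₂h)x`.
  have h1 : ∀ w : C ⊗[k] H, TensorProduct.lift ((act k H C) ∘ₗ HopfAlgebra.antipode k ∘ₗ e ∘ₗ
      TensorProduct.mk k C C x) (delta k H C w) = (e (delta k H C w)) • x := by
    refine tmul_ext fun c h => ?_
    have h2 := antipode_evComul he (x ⊗ₜ[k] c)
    have h3 : ∀ w : C ⊗[k] C, TensorProduct.lift ((act k H C) ∘ₗ HopfAlgebra.antipode k ∘ₗ e ∘ₗ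
        TensorProduct.mk k C C x) ((act k H C h).lTensor C w) =
        h • TensorProduct.lift (act k H C) ((HopfAlgebra.antipode k).rTensor C
          ((e ∘ₗ TensorProduct.mk k C C x).rTensor C w)) := by
      refine tmul_ext fun a b => ?_
      simp [smul_smul, mul_comm]
    rw [delta_tmul, he.lTensor_act_comul, h3, ← evComul_tmul, h2]
    simp [smul_comm h]
  obtain ⟨w, hw⟩ := he.delta_bijective.2 (y ⊗ₜ[k] z)
  have h2 := h1 w
  rw [hw] at h2
  simpa using h2

variable (k C) in
/-- `c ↦ (c₁ ⊗ c₂) ⊗ c₃`. -/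
def comul3 : C →ₗ[k] (C ⊗[k] C) ⊗[k] C :=
  (Coalgebra.comul (R := k) (A := C)).rTensor C ∘ₗ Coalgebra.comul (R := k) (A := C)

theorem comul3_apply (c : C) : comul3 k C c =
    (Coalgebra.comul (R := k) (A := C)).rTensor C (Coalgebra.comul (R := k) c) := rfl

theorem assoc_comul3 (c : C) : TensorProduct.assoc k C C C (comul3 k C c) =
    (Coalgebra.comul (R := k) (A := C)).lTensor C (Coalgebra.comul (R := k) c) :=
  Coalgebra.coassoc_apply c

theorem galoisHerd_shepherd (hδ : Function.Bijective (delta k H C)) (c : C) :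
    (galoisHerd hδ).shepherd c =
      ((Pen.of k H C).toLinearMap.lTensor C).rTensor C (comul3 k C c) := rfl

theorem galoisHerd_ev (hδ : Function.Bijective (delta k H C)) (x c : C) :
    (galoisHerd hδ).ev (Pen.of k H C x) c = evLin hδ (x ⊗ₜ[k] c) := rfl

theorem galoisHerd_coev (hδ : Function.Bijective (delta k H C)) (x c : C) :
    (galoisHerd hδ).coev c (Pen.of k H C x) =
      HopfAlgebra.antipode k (evLin hδ (c ⊗ₜ[k] x)) := rfl

/-- `Δ² ⊗ Δ ∘ Δ`, computed in two ways. -/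
theorem comul3_coassoc (c : C) :
    (((comul3 k C).rTensor C).rTensor C) (comul3 k C c) =
      (TensorProduct.assoc k (C ⊗[k] C) C C).symm.toLinearMap.rTensor C
        ((TensorProduct.assoc k (C ⊗[k] C) (C ⊗[k] C) C).symm
          ((comul3 k C).lTensor (C ⊗[k] C) (comul3 k C c))) := by
  have h1 : ∀ z : C ⊗[k] C, (TensorProduct.assoc k (C ⊗[k] C) C C).symm
      ((Coalgebra.comul (R := k) (A := C)).lTensor (C ⊗[k] C)
        ((Coalgebra.comul (R := k) (A := C)).rTensor C z)) =
      ((Coalgebra.comul (R := k) (A := C)).rTensor C).rTensor C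
        ((TensorProduct.assoc k C C C).symm ((Coalgebra.comul (R := k) (A := C)).lTensor C z)) := by
    refine tmul_ext fun x y => ?_
    simp only [LinearMap.rTensor_tmul, LinearMap.lTensor_tmul]
    generalize Coalgebra.comul (R := k) y = v
    revert v
    refine tmul_ext fun v v' => ?_
    simp
  -- On `c₁ ⊗ c₂ ⊗ c₃`, splitting the last leg gives the same four-fold coproduct as applying `Δ²`
  -- to the first leg of `Δ(c)`.
  have h2 : ∀ c : C, (TensorProduct.assoc k (C ⊗[k] C) C C).symm
      ((Coalgebra.comul (R := k) (A := C)).lTensor (C ⊗[k] C) (comul3 k C c)) =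
      (comul3 k C).rTensor C (Coalgebra.comul (R := k) c) := by
    intro c
    rw [comul3_apply, h1, Coalgebra.coassoc_symm_apply, comul3, LinearMap.rTensor_comp]
    rfl
  have h3 : ∀ z : (C ⊗[k] C) ⊗[k] C,
      (TensorProduct.assoc k (C ⊗[k] C) C C).symm.toLinearMap.rTensor C
        ((TensorProduct.assoc k (C ⊗[k] C) (C ⊗[k] C) C).symm
          (((Coalgebra.comul (R := k) (A := C)).rTensor C).lTensor (C ⊗[k] C)
            ((Coalgebra.comul (R := k) (A := C)).lTensor (C ⊗[k] C) z))) =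
      ((TensorProduct.assoc k (C ⊗[k] C) C C).symm.toLinearMap ∘ₗ
        (Coalgebra.comul (R := k) (A := C)).lTensor (C ⊗[k] C)).rTensor C
        ((TensorProduct.assoc k (C ⊗[k] C) C C).symm
          ((Coalgebra.comul (R := k) (A := C)).lTensor (C ⊗[k] C) z)) := by
    refine tmul_ext fun x y => ?_
    simp only [LinearMap.lTensor_tmul]
    generalize Coalgebra.comul (R := k) y = v
    revert v
    refine tmul_ext fun v v' => ?_
    simp
  have h4 : (TensorProduct.assoc k (C ⊗[k] C) C C).symm.toLinearMap ∘ₗ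
      (Coalgebra.comul (R := k) (A := C)).lTensor (C ⊗[k] C) ∘ₗ comul3 k C =
      (comul3 k C).rTensor C ∘ₗ Coalgebra.comul (R := k) := LinearMap.ext h2
  have h5 : (comul3 k C).lTensor (C ⊗[k] C) (comul3 k C c) =
      ((Coalgebra.comul (R := k) (A := C)).rTensor C).lTensor (C ⊗[k] C)
        ((Coalgebra.comul (R := k) (A := C)).lTensor (C ⊗[k] C) (comul3 k C c)) := by
    conv_lhs => rw [comul3, LinearMap.lTensor_comp, LinearMap.comp_apply]
    rfl
  rw [h5, h3, h2, comul3_apply]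
  rw [← LinearMap.rTensor_comp_apply, ← LinearMap.rTensor_comp_apply, LinearMap.comp_assoc, h4]

/-- Both duality conditions are instances of `S(e(x, y))z = e(y, z)x`. For the one valued in the
pen, the action supplies one `S` on each side, and `S² = id` removes the double antipode. The two
evaluation conditions on the shepherd are `e(c₁, c₂) = ε(c)` together with `S(1) = 1`, and
associativity is `comul3_coassoc`, transported along the identity map from `C` to its pen. -/
theorem isHerd_galoisHerd (hδ : Function.Bijective (delta k H C)) : (galoisHerd hδ).IsHerd where
  coev_smul x y z := by
    obtain ⟨y, rfl⟩ := (Pen.of k H C).surjective y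
    exact (isTranslation_evLin hδ).antipode_smul x y z
  ev_smul x y z := by
    obtain ⟨x, rfl⟩ := (Pen.of k H C).surjective x
    obtain ⟨z, rfl⟩ := (Pen.of k H C).surjective z
    rw [galoisHerd_ev, galoisHerd_coev, Pen.smul_of, Pen.smul_of, antipode_antipode,
      (isTranslation_evLin hδ).antipode_smul]
  coev_shepherd c := by
    have h1 : ∀ w : (C ⊗[k] C) ⊗[k] C,
        ((pairing k (galoisHerd hδ).coev).restrictScalars k).rTensor C
          (((Pen.of k H C).toLinearMap.lTensor C).rTensor C w) =
        (HopfAlgebra.antipode k ∘ₗ evLin hδ).rTensor C w := by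
      intro w
      rw [← LinearMap.comp_apply, ← LinearMap.rTensor_comp]
      congr 2
      ext a b
      exact galoisHerd_coev hδ b a
    have h2 : (HopfAlgebra.antipode k ∘ₗ evLin hδ) ∘ₗ Coalgebra.comul (R := k) =
        (Algebra.linearMap k H) ∘ₗ Coalgebra.counit (R := k) (A := C) := by
      ext c
      simp [(isTranslation_evLin hδ).comul, Algebra.algebraMap_eq_smul_one]
    rw [galoisHerd_shepherd, h1, comul3_apply, ← LinearMap.comp_apply, ← LinearMap.rTensor_comp,
      h2, LinearMap.rTensor_comp, LinearMap.comp_apply, Coalgebra.rTensor_counit_comul]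
    simp
  ev_shepherd c := by
    have h1 : ∀ w : (C ⊗[k] C) ⊗[k] C,
        ((pairing k (galoisHerd hδ).ev).restrictScalars k).lTensor C
          (TensorProduct.assoc k C (Pen k H C) C
            (((Pen.of k H C).toLinearMap.lTensor C).rTensor C w)) =
        (evLin hδ).lTensor C (TensorProduct.assoc k C C C w) := by
      refine tmul_ext fun w z => ?_
      revert w
      refine tmul_ext fun x y => ?_
      simp [galoisHerd_ev]
    have h2 : evLin hδ ∘ₗ Coalgebra.comul (R := k) =
        (Algebra.linearMap k H) ∘ₗ Coalgebra.counit (R := k) (A := C) :=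
      LinearMap.ext (isTranslation_evLin hδ).comul
    rw [galoisHerd_shepherd, h1, assoc_comul3, ← LinearMap.comp_apply, ← LinearMap.lTensor_comp,
      h2, LinearMap.lTensor_comp, LinearMap.comp_apply, Coalgebra.lTensor_counit_comul]
    simp
  shepherd_assoc := by
    set p := (Pen.of k H C).toLinearMap with hp
    have hγ : (galoisHerd hδ).shepherd = (p.lTensor C).rTensor C ∘ₗ comul3 k C := rfl
    refine LinearMap.ext fun c => ?_
    have h1 : ∀ w : (C ⊗[k] C) ⊗[k] C,
        ((galoisHerd hδ).shepherd.rTensor (Pen k H C)).rTensor C ((p.lTensor C).rTensor C w) =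
        (TensorProduct.map ((p.lTensor C).rTensor C) p).rTensor C
          (((comul3 k C).rTensor C).rTensor C w) := by
      intro w
      rw [← LinearMap.comp_apply, ← LinearMap.comp_apply, ← LinearMap.rTensor_comp,
        ← LinearMap.rTensor_comp, hγ]
      congr 2
      ext a b
      simp
    have h2 : ∀ w : (C ⊗[k] C) ⊗[k] C,
        (galoisHerd hδ).shepherd.lTensor (C ⊗[k] Pen k H C) ((p.lTensor C).rTensor C w) =
        TensorProduct.map (p.lTensor C) ((p.lTensor C).rTensor C)
          ((comul3 k C).lTensor (C ⊗[k] C) w) := by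
      refine tmul_ext fun x y => ?_
      simp [hγ]
    have h3 : ∀ w : (C ⊗[k] C) ⊗[k] ((C ⊗[k] C) ⊗[k] C),
        ((TensorProduct.assoc k (C ⊗[k] Pen k H C) C (Pen k H C)).symm.toLinearMap.rTensor C)
          ((TensorProduct.assoc k (C ⊗[k] Pen k H C) (C ⊗[k] Pen k H C) C).symm
            (TensorProduct.map (p.lTensor C) ((p.lTensor C).rTensor C) w)) =
        (TensorProduct.map ((p.lTensor C).rTensor C) p).rTensor C
          ((TensorProduct.assoc k (C ⊗[k] C) C C).symm.toLinearMap.rTensor C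
            ((TensorProduct.assoc k (C ⊗[k] C) (C ⊗[k] C) C).symm w)) := by
      refine tmul_ext fun w v => ?_
      revert v
      refine tmul_ext fun v z => ?_
      revert v
      refine tmul_ext fun x y => ?_
      simp
    simp only [LinearMap.comp_apply, LinearEquiv.coe_coe, galoisHerd_shepherd]
    rw [← hp, h1, comul3_coassoc, h2, h3]

end GaloisHerd

/-! ### The translation map of `C ⊗_H D` -/

section Composite

variable {k H : Type u} [CommRing k] [CommRing H] [HopfAlgebra k H]
  {C D : Type u} [AddCommGroup C] [Module k C] [Module H C] [IsScalarTower k H C]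
  [AddCommGroup D] [Module k D] [Module H D] [IsScalarTower k H D]

variable (k H) in
/-- `(c, d) ↦ d̂ ⊗_H ĉ`, as a `k`-bilinear map. -/
def penTmul (C D : Type u) [AddCommGroup C] [Module k C] [Module H C] [IsScalarTower k H C]
    [AddCommGroup D] [Module k D] [Module H D] [IsScalarTower k H D] :
    C →ₗ[k] D →ₗ[k] Pen k H D ⊗[H] Pen k H C :=
  ((TensorProduct.mk k (Pen k H D) (Pen k H C)).compr₂
    ((proj k H (Pen k H D) (Pen k H C)).restrictScalars k)).flip.compl₁₂
    (Pen.of k H C).toLinearMap (Pen.of k H D).toLinearMap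

theorem penTmul_apply (c : C) (d : D) :
    penTmul k H C D c d = Pen.of k H D d ⊗ₜ[H] Pen.of k H C c := rfl

/-- As `S² = id`, the element `h` acts on `C` as `S(h)` acts on the pen, so balancing over `H`
survives the passage to pens. This makes the twist well defined. -/
theorem penTmul_smul (h : H) (c : C) (d : D) :
    penTmul k H C D (h • c) d = penTmul k H C D c (h • d) := by
  rw [penTmul_apply, penTmul_apply, ← antipode_antipode k H h, ← Pen.smul_of, ← Pen.smul_of,
    TensorProduct.smul_tmul]

variable (k H) in
/-- `c ⊗_H d ↦ d̂ ⊗_H ĉ`, as a `k`-linear map. -/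
def twistFun (C D : Type u) [AddCommGroup C] [Module k C] [Module H C] [IsScalarTower k H C]
    [AddCommGroup D] [Module k D] [Module H D] [IsScalarTower k H D] :
    C ⊗[H] D →ₗ[k] Pen k H D ⊗[H] Pen k H C :=
  liftBal (penTmul k H C D) penTmul_smul

variable (k H) in
/-- `d̂ ⊗_H ĉ ↦ c ⊗_H d`, as a `k`-linear map. -/
def twistInv (C D : Type u) [AddCommGroup C] [Module k C] [Module H C] [IsScalarTower k H C]
    [AddCommGroup D] [Module k D] [Module H D] [IsScalarTower k H D] :
    Pen k H D ⊗[H] Pen k H C →ₗ[k] C ⊗[H] D :=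
  liftBal
    (((TensorProduct.mk k C D).compr₂
      ((proj k H C D).restrictScalars k)).flip.compl₁₂
      (Pen.of k H D).symm.toLinearMap (Pen.of k H C).symm.toLinearMap)
    (by
      intro h d c
      obtain ⟨c, rfl⟩ := (Pen.of k H C).surjective c
      obtain ⟨d, rfl⟩ := (Pen.of k H D).surjective d
      simp only [LinearMap.compl₁₂_apply, LinearEquiv.coe_coe, LinearMap.flip_apply,
        LinearMap.compr₂_apply, TensorProduct.mk_apply, LinearMap.restrictScalars_apply,
        TensorProduct.mapOfCompatibleSMul_tmul, Pen.smul_of, LinearEquiv.symm_apply_apply]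
      rw [TensorProduct.smul_tmul])

variable (k H C D) in
/-- The twist `c ⊗_H d ↦ d̂ ⊗_H ĉ`. -/
def twist : Pen k H (C ⊗[H] D) ≃ₗ[H] Pen k H D ⊗[H] Pen k H C where
  toFun x := twistFun k H C D ((Pen.of k H (C ⊗[H] D)).symm x)
  invFun z := Pen.of k H (C ⊗[H] D) (twistInv k H C D z)
  map_add' x y := by simp
  map_smul' h x := by
    obtain ⟨z, rfl⟩ := (Pen.of k H (C ⊗[H] D)).surjective x
    rw [Pen.smul_of, LinearEquiv.symm_apply_apply, LinearEquiv.symm_apply_apply, RingHom.id_apply]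
    revert z
    refine tmul_ext fun c d => ?_
    change Pen.of k H D d ⊗ₜ[H] Pen.of k H C (HopfAlgebra.antipode k h • c) =
      h • (Pen.of k H D d ⊗ₜ[H] Pen.of k H C c)
    rw [← Pen.smul_of, TensorProduct.tmul_smul]
  left_inv x := by
    obtain ⟨z, rfl⟩ := (Pen.of k H (C ⊗[H] D)).surjective x
    simp only [LinearEquiv.symm_apply_apply]
    congr 1
    revert z
    refine tmul_ext fun c d => ?_
    rfl
  right_inv z := by
    simp only [LinearEquiv.symm_apply_apply]
    revert z
    refine tmul_ext fun c d => ?_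
    rfl

theorem twist_tmul (c : C) (d : D) : twist k H C D (Pen.of k H (C ⊗[H] D) (c ⊗ₜ[H] d)) =
    Pen.of k H D d ⊗ₜ[H] Pen.of k H C c := rfl

variable [Coalgebra k C] [ModuleCoalgebra k H C] [Coalgebra k D] [ModuleCoalgebra k H D]

/-- The map `(c ⊗ d) ⊗ (c' ⊗ d') ↦ ev(c, c')ev(d, d')`. -/
def compEv (δC : Function.Bijective (delta k H C)) (δD : Function.Bijective (delta k H D)) :
    (C ⊗[H] D) ⊗[k] (C ⊗[H] D) →ₗ[k] H :=
  (pairing k (compPairing (galoisHerd δD).ev (galoisHerd δC).ev)).restrictScalars k ∘ₗ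
    (((twist k H C D).toLinearMap.restrictScalars k) ∘ₗ
      (Pen.of k H (C ⊗[H] D)).toLinearMap).rTensor (C ⊗[H] D)

theorem compEv_tmul (δC : Function.Bijective (delta k H C))
    (δD : Function.Bijective (delta k H D)) (x y : C ⊗[H] D) :
    compEv δC δD (x ⊗ₜ[k] y) = compPairing (galoisHerd δD).ev (galoisHerd δC).ev
      (twist k H C D (Pen.of k H (C ⊗[H] D) x)) y := rfl

theorem compEv_tmul_tmul (δC : Function.Bijective (delta k H C))
    (δD : Function.Bijective (delta k H D)) (c c' : C) (d d' : D) :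
    compEv δC δD ((c ⊗ₜ[H] d) ⊗ₜ[k] (c' ⊗ₜ[H] d')) =
      evLin δC (c ⊗ₜ[k] c') * evLin δD (d ⊗ₜ[k] d') := by
  rw [compEv_tmul, twist_tmul, compPairing_tmul, galoisHerd_ev, galoisHerd_ev, evLin_smul_right]

/-- On pure tensors the map is `e_C(c, c')e_D(d, d')` and `Δ` is componentwise, so the normalization
and the reconstruction identity each factor into the ones for `C` and `D`. Consequently `δ` is
bijective for `C ⊗_H D`, and this map is its translation map. -/
theorem isTranslation_compEv (δC : Function.Bijective (delta k H C))
    (δD : Function.Bijective (delta k H D)) : IsTranslation (compEv δC δD) where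
  smul_right h x y := by
    rw [compEv_tmul, compEv_tmul, map_smul, smul_eq_mul]
  comul z := by
    revert z
    refine tmul_ext fun c d => ?_
    have h1 : ∀ (w : C ⊗[k] C) (v : D ⊗[k] D), compEv δC δD
        (TensorProduct.map ((proj k H C D).restrictScalars k) ((proj k H C D).restrictScalars k)
          (TensorProduct.tensorTensorTensorComm k C C D D (w ⊗ₜ[k] v))) =
        evLin δC w * evLin δD v := by
      intro w v
      revert w
      refine tmul_ext fun a b => ?_
      revert v
      refine tmul_ext fun x y => ?_
      simpa using compEv_tmul_tmul δC δD a b x y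
    rw [comul_tmul_comp, h1, (isTranslation_evLin δC).comul, (isTranslation_evLin δD).comul,
      counit_tmul_comp, map_mul]
  evSmul_comul z z' := by
    induction z' with
    | zero =>
      have h1 : evSmul (compEv δC δD) (0 : C ⊗[H] D) = 0 := by
        refine TensorProduct.ext' fun x y => ?_
        simp
      simp [h1]
    | add x y hx hy =>
      have h1 : evSmul (compEv δC δD) (x + y) =
          evSmul (compEv δC δD) x + evSmul (compEv δC δD) y := by
        refine TensorProduct.ext' fun x y => ?_
        simp [tmul_add, add_smul]
      rw [h1, LinearMap.add_apply, hx, hy, smul_add]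
    | tmul c' d' =>
    revert z
    refine tmul_ext fun c d => ?_
    have h1 : ∀ (w : C ⊗[k] C) (v : D ⊗[k] D), evSmul (compEv δC δD) (c' ⊗ₜ[H] d')
        (TensorProduct.map ((proj k H C D).restrictScalars k) ((proj k H C D).restrictScalars k)
          (TensorProduct.tensorTensorTensorComm k C C D D (w ⊗ₜ[k] v))) =
        evSmul (evLin δC) c' w ⊗ₜ[H] evSmul (evLin δD) d' v := by
      intro w v
      revert w
      refine tmul_ext fun a b => ?_
      revert v
      refine tmul_ext fun x y => ?_
      change compEv δC δD ((b ⊗ₜ[H] y) ⊗ₜ[k] (c' ⊗ₜ[H] d')) • (a ⊗ₜ[H] x) =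
        (evLin δC (b ⊗ₜ[k] c') • a) ⊗ₜ[H] (evLin δD (y ⊗ₜ[k] d') • x)
      rw [compEv_tmul_tmul, TensorProduct.tmul_smul, ← TensorProduct.smul_tmul', mul_smul,
        smul_comm]
    rw [comul_tmul_comp, h1, (isTranslation_evLin δC).evSmul_comul,
      (isTranslation_evLin δD).evSmul_comul, counit_tmul_comp]
    rw [← TensorProduct.smul_tmul', TensorProduct.tmul_smul, mul_smul]

end Composite

/-! ### The smash coproduct map of two Galois co-objects -/

section Swap

section

variable {k H C D : Type u} [CommRing k] [CommRing H] [HopfAlgebra k H]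
  [AddCommGroup C] [Module k C] [Coalgebra k C]

/-- `x ⊗ y ↦ (e(x, y₁) ⊗ y₂) ⊗ y₃`. -/
def evComul3 (e : C ⊗[k] C →ₗ[k] H) : C ⊗[k] C →ₗ[k] (H ⊗[k] C) ⊗[k] C :=
  (evComul e).rTensor C ∘ₗ (TensorProduct.assoc k C C C).symm.toLinearMap ∘ₗ
    (Coalgebra.comul (R := k) (A := C)).lTensor C

theorem evComul3_tmul (e : C ⊗[k] C →ₗ[k] H) (x y : C) :
    evComul3 e (x ⊗ₜ[k] y) = (evComul e ∘ₗ TensorProduct.mk k C C x).rTensor C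
      (Coalgebra.comul (R := k) y) := by
  simp only [evComul3, LinearMap.comp_apply, LinearMap.lTensor_tmul]
  generalize Coalgebra.comul (R := k) y = w
  revert w
  refine tmul_ext fun x y => ?_
  simp

/-- `x ⊗ y ↦ (x₁ ⊗ x₂) ⊗ S(e(x₃, y))`. -/
def comul3Ev (e : C ⊗[k] C →ₗ[k] H) : C ⊗[k] C →ₗ[k] (C ⊗[k] C) ⊗[k] H :=
  (HopfAlgebra.antipode k ∘ₗ e).lTensor (C ⊗[k] C) ∘ₗ
    (TensorProduct.assoc k (C ⊗[k] C) C C).toLinearMap ∘ₗ (comul3 k C).rTensor C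

theorem comul3Ev_tmul (e : C ⊗[k] C →ₗ[k] H) (x y : C) :
    comul3Ev e (x ⊗ₜ[k] y) = (HopfAlgebra.antipode k ∘ₗ e ∘ₗ (TensorProduct.mk k C C).flip y).lTensor
      (C ⊗[k] C) (comul3 k C x) := by
  simp only [comul3Ev, LinearMap.comp_apply, LinearMap.rTensor_tmul]
  generalize comul3 k C x = w
  revert w
  refine tmul_ext fun x y => ?_
  simp

end

variable {k H : Type u} [CommRing k] [CommRing H] [HopfAlgebra k H]
  {C D : Type u} [AddCommGroup C] [Module k C] [Module H C] [IsScalarTower k H C]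
  [AddCommGroup D] [Module k D] [Module H D] [IsScalarTower k H D]

variable (k H C D) in
/-- `((h ⊗ b) ⊗ c, (p ⊗ q) ⊗ g) ↦ (hp ⊗ (q̂ ⊗_H b̂)) ⊗ gc`. -/
def swapCore : (H ⊗[k] C) ⊗[k] C →ₗ[k] (D ⊗[k] D) ⊗[k] H →ₗ[k]
    (D ⊗[k] (Pen k H D ⊗[H] Pen k H C)) ⊗[k] C :=
  TensorProduct.map₂ (TensorProduct.map₂ (act k H D) (penTmul k H C D)) (act k H C).flip

@[simp]
theorem swapCore_tmul (h g : H) (b c : C) (p q : D) :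
    swapCore k H C D ((h ⊗ₜ[k] b) ⊗ₜ[k] c) ((p ⊗ₜ[k] q) ⊗ₜ[k] g) =
      ((h • p) ⊗ₜ[k] (Pen.of k H D q ⊗ₜ[H] Pen.of k H C b)) ⊗ₜ[k] (g • c) := rfl

/-- Each of the three legs of `t` crosses to the other side on its own: the outer two by
commutativity of `H`, the middle one by `penTmul_smul`. With `t = h₁ ⊗ h₂ ⊗ h₃` this is the
`H`-balancing that makes `σ` well defined on `C ⊗_H D`. -/
theorem swapCore_balanced (t : (H ⊗[k] H) ⊗[k] H) (w : (H ⊗[k] C) ⊗[k] C)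
    (v : (D ⊗[k] D) ⊗[k] H) :
    swapCore k H C D (TensorProduct.map₂ (TensorProduct.map₂ (LinearMap.mul k H) (act k H C))
      (act k H C) t w) v =
    swapCore k H C D w (TensorProduct.map₂ (TensorProduct.map₂ (act k H D) (act k H D))
      (LinearMap.mul k H) t v) := by
  revert t
  refine tmul_ext fun t a => ?_
  revert w
  refine tmul_ext fun w c => ?_
  revert v
  refine tmul_ext fun v g => ?_
  revert t
  refine tmul_ext fun a₁ a₂ => ?_
  revert w
  refine tmul_ext fun h b => ?_
  revert v
  refine tmul_ext fun p q => ?_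
  simp only [TensorProduct.map₂_apply_tmul, TensorProduct.map_tmul, act_apply,
    LinearMap.mul_apply', swapCore_tmul]
  rw [← penTmul_apply, ← penTmul_apply, penTmul_smul, smul_smul, smul_smul, mul_comm a₁,
    mul_comm a]

theorem swapCore_smul (h : H) (w : (H ⊗[k] C) ⊗[k] C) (v : (D ⊗[k] D) ⊗[k] H) :
    swapCore k H C D (((LinearMap.mulLeft k h).rTensor C).rTensor C w) v =
      h • swapCore k H C D w v := by
  revert w
  refine tmul_ext fun w c => ?_
  revert v
  refine tmul_ext fun v g => ?_
  revert w
  refine tmul_ext fun a b => ?_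
  revert v
  refine tmul_ext fun p q => ?_
  simp [TensorProduct.smul_tmul', mul_smul]

theorem swapCore_lTensor (h : H) (w : (H ⊗[k] C) ⊗[k] C) (v : (D ⊗[k] D) ⊗[k] H) :
    swapCore k H C D w ((LinearMap.mulLeft k h).lTensor (D ⊗[k] D) v) =
      (act k H C h).lTensor _ (swapCore k H C D w v) := by
  revert w
  refine tmul_ext fun w c => ?_
  revert v
  refine tmul_ext fun v g => ?_
  revert w
  refine tmul_ext fun a b => ?_
  revert v
  refine tmul_ext fun p q => ?_
  simp [mul_smul]

theorem toCD_surjective : Function.Surjective (toCD k H C D) := by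
  intro z
  induction z with
  | zero => exact ⟨0, map_zero _⟩
  | add x y hx hy =>
    obtain ⟨a, rfl⟩ := hx
    obtain ⟨b, rfl⟩ := hy
    exact ⟨a + b, map_add _ _ _⟩
  | tmul z q =>
  induction z with
  | zero => exact ⟨0, by simp⟩
  | add x y hx hy =>
    obtain ⟨a, ha⟩ := hx
    obtain ⟨b, hb⟩ := hy
    exact ⟨a + b, by rw [map_add, ha, hb, add_tmul]⟩
  | tmul x z =>
  induction z with
  | zero => exact ⟨0, by simp⟩
  | add x y hx hy =>
    obtain ⟨a, ha⟩ := hx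
    obtain ⟨b, hb⟩ := hy
    exact ⟨a + b, by rw [map_add, ha, hb, tmul_add, add_tmul]⟩
  | tmul y d =>
    exact ⟨((Pen.of k H C).symm x ⊗ₜ[k] y) ⊗ₜ[k] (d ⊗ₜ[k] (Pen.of k H D).symm q), rfl⟩

theorem toCD_tmul (x y : C) (d q : D) :
    toCD k H C D ((x ⊗ₜ[k] y) ⊗ₜ[k] (d ⊗ₜ[k] q)) =
      (Pen.of k H C x ⊗ₜ[k] (y ⊗ₜ[H] d)) ⊗ₜ[k] Pen.of k H D q := rfl

theorem toCD_smul_right (h : H) (w : (C ⊗[k] C) ⊗[k] (D ⊗[k] D)) :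
    (act k H (Pen k H D) h).lTensor _ (toCD k H C D w) = toCD k H C D
      (((act k H D (HopfAlgebra.antipode k h)).lTensor D).lTensor (C ⊗[k] C) w) := by
  revert w
  refine tmul_ext fun w z => ?_
  revert w
  refine tmul_ext fun x y => ?_
  revert z
  refine tmul_ext fun d q => ?_
  simp [toCD_tmul, Pen.smul_of]

omit [IsScalarTower k H D] in
theorem linearMap_ext_pen {Z : Type u} [AddCommGroup Z] [Module k Z]
    {f g : C ⊗[H] D →ₗ[k] Pen k H D →ₗ[k] Z}
    (h : ∀ (y : C) (d q : D), f (y ⊗ₜ[H] d) (Pen.of k H D q) = g (y ⊗ₜ[H] d) (Pen.of k H D q)) :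
    f = g := by
  refine LinearMap.ext fun z => LinearMap.ext fun q => ?_
  obtain ⟨q, rfl⟩ := (Pen.of k H D).surjective q
  revert z
  refine tmul_ext fun y d => ?_
  exact h y d q

variable [Coalgebra k C] [Coalgebra k D]

/-- In Sweedler notation, `e(c₁, c₂) ⊗ c₃ ⊗ c₄ = 1 ⊗ c₁ ⊗ c₂`; this is how the `C`-half of the
formula for `σ` simplifies on spanning elements. -/
theorem evComul3_comul {e : C ⊗[k] C →ₗ[k] H} (he : IsTranslation e) (c : C) :
    evComul3 e (Coalgebra.comul (R := k) c) =
      (TensorProduct.mk k H C 1).rTensor C (Coalgebra.comul (R := k) c) := by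
  have h1 : evComul e ∘ₗ Coalgebra.comul (R := k) = TensorProduct.mk k H C 1 :=
    LinearMap.ext he.evComul_comul
  simp only [evComul3, LinearMap.comp_apply, LinearEquiv.coe_coe]
  rw [Coalgebra.coassoc_symm_apply, ← LinearMap.rTensor_comp_apply, h1]

theorem evComul3_smul_right [ModuleCoalgebra k H C] {e : C ⊗[k] C →ₗ[k] H}
    (he : IsTranslation e) (h : H) (x y : C) :
    evComul3 e (x ⊗ₜ[k] (h • y)) =
      TensorProduct.map₂ (TensorProduct.map₂ (LinearMap.mul k H) (act k H C)) (act k H C)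
        (comul3 k H h) (evComul3 e (x ⊗ₜ[k] y)) := by
  rw [evComul3_tmul, evComul3_tmul, ModuleCoalgebra.comul_smul, comul3_apply]
  generalize Coalgebra.comul (R := k) h = v
  generalize Coalgebra.comul (R := k) y = w
  revert v
  refine tmul_ext fun a b => ?_
  revert w
  refine tmul_ext fun x y => ?_
  simp [evComul_smul_right he]

-- Gives left linearity of `σ`: one antipode comes from the action on the pen, a second from `e` in
-- its first argument, and `S² = id`.
omit [IsScalarTower k H C] in
theorem evComul3_smul_left {e : C ⊗[k] C →ₗ[k] H}
    (he : ∀ (h : H) (c d : C), e ((h • c) ⊗ₜ[k] d) = HopfAlgebra.antipode k h * e (c ⊗ₜ[k] d))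
    (h : H) (x y : C) :
    evComul3 e ((HopfAlgebra.antipode k h • x) ⊗ₜ[k] y) =
      ((LinearMap.mulLeft k h).rTensor C).rTensor C (evComul3 e (x ⊗ₜ[k] y)) := by
  have h1 : evComul e ∘ₗ TensorProduct.mk k C C (HopfAlgebra.antipode k h • x) =
      (LinearMap.mulLeft k h).rTensor C ∘ₗ evComul e ∘ₗ TensorProduct.mk k C C x := by
    refine LinearMap.ext fun y => ?_
    simp only [LinearMap.comp_apply, TensorProduct.mk_apply, evComul_tmul]
    rw [← LinearMap.rTensor_comp_apply]
    congr 2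
    ext z
    simp [he, antipode_antipode]
  rw [evComul3_tmul, evComul3_tmul, h1, LinearMap.rTensor_comp, LinearMap.comp_apply]

/-- The `D`-half of the formula for `σ`: `d₁ ⊗ d₂ ⊗ S(e(d₃, d₄h)) = d₁ ⊗ d₂ ⊗ S(h)`. -/
theorem comul3Ev_comul {e : D ⊗[k] D →ₗ[k] H} (he : IsTranslation e) (h : H) (d : D) :
    comul3Ev e ((act k H D h).lTensor D (Coalgebra.comul (R := k) d)) =
      Coalgebra.comul (R := k) d ⊗ₜ[k] HopfAlgebra.antipode k h := by
  have h1 : ∀ w : D ⊗[k] D, comul3Ev e ((act k H D h).lTensor D w) =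
      (HopfAlgebra.antipode k ∘ₗ e ∘ₗ (act k H D h).lTensor D).lTensor (D ⊗[k] D)
        ((Coalgebra.comul (R := k)).rTensor (D ⊗[k] D)
          (TensorProduct.assoc k D D D ((Coalgebra.comul (R := k)).rTensor D w))) := by
    refine tmul_ext fun x y => ?_
    simp only [LinearMap.lTensor_tmul, comul3Ev_tmul, comul3_apply, LinearMap.rTensor_tmul]
    generalize Coalgebra.comul (R := k) x = v
    revert v
    refine tmul_ext fun v v' => ?_
    simp
  have h2 : ∀ w : D ⊗[k] D, (HopfAlgebra.antipode k ∘ₗ e ∘ₗ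
      (act k H D h).lTensor D).lTensor (D ⊗[k] D) ((Coalgebra.comul (R := k)).rTensor (D ⊗[k] D)
        ((Coalgebra.comul (R := k)).lTensor D w)) =
      TensorProduct.map (Coalgebra.comul (R := k))
        (LinearMap.toSpanSingleton k H (HopfAlgebra.antipode k h))
        ((Coalgebra.counit (R := k)).lTensor D w) := by
    refine tmul_ext fun x y => ?_
    simp [he.lTensor_act_comul]
  rw [h1, Coalgebra.coassoc_apply, h2, Coalgebra.lTensor_counit_comul]
  simp

theorem comul3_smul [ModuleCoalgebra k H D] (h : H) (d : D) : comul3 k D (h • d) =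
    TensorProduct.map₂ (TensorProduct.map₂ (act k H D) (act k H D)) (act k H D)
      (comul3 k H h) (comul3 k D d) := by
  simp only [comul3_apply]
  rw [ModuleCoalgebra.comul_smul]
  generalize Coalgebra.comul (R := k) h = v
  generalize Coalgebra.comul (R := k) d = w
  revert v
  refine tmul_ext fun a b => ?_
  revert w
  refine tmul_ext fun x y => ?_
  simp [ModuleCoalgebra.comul_smul]

/-- The third leg is `S(e(x₃h₃, y)) = S(S(h₃)e(x₃, y)) = h₃S(e(x₃, y))`, so all three legs of
`Δ²(h)` act without antipode and match those produced on the `C` side. -/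
theorem comul3Ev_smul_left [ModuleCoalgebra k H D] {e : D ⊗[k] D →ₗ[k] H}
    (he : ∀ (h : H) (c d : D), e ((h • c) ⊗ₜ[k] d) = HopfAlgebra.antipode k h * e (c ⊗ₜ[k] d))
    (h : H) (x y : D) :
    comul3Ev e ((h • x) ⊗ₜ[k] y) =
      TensorProduct.map₂ (TensorProduct.map₂ (act k H D) (act k H D)) (LinearMap.mul k H)
        (comul3 k H h) (comul3Ev e (x ⊗ₜ[k] y)) := by
  rw [comul3Ev_tmul, comul3Ev_tmul, comul3_smul]
  generalize comul3 k H h = v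
  generalize comul3 k D x = w
  revert v
  refine tmul_ext fun a b => ?_
  revert w
  refine tmul_ext fun x y => ?_
  simp [he, HopfAlgebra.antipode_mul_distrib, antipode_antipode]

theorem comul3Ev_smul_right {e : D ⊗[k] D →ₗ[k] H} (he : IsTranslation e) (h : H) (x y : D) :
    comul3Ev e (x ⊗ₜ[k] (HopfAlgebra.antipode k h • y)) =
      (LinearMap.mulLeft k h).lTensor (D ⊗[k] D) (comul3Ev e (x ⊗ₜ[k] y)) := by
  rw [comul3Ev_tmul, comul3Ev_tmul, ← LinearMap.lTensor_comp_apply]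
  congr 2
  ext z
  simp [he.smul_right, HopfAlgebra.antipode_mul_distrib, antipode_antipode]

theorem comul3Ev_lTensor_act {e : D ⊗[k] D →ₗ[k] H} (he : IsTranslation e) (h : H)
    (z : D ⊗[k] D) :
    comul3Ev e ((act k H D (HopfAlgebra.antipode k h)).lTensor D z) =
      (LinearMap.mulLeft k h).lTensor (D ⊗[k] D) (comul3Ev e z) := by
  revert z
  refine tmul_ext fun x y => ?_
  rw [LinearMap.lTensor_tmul, act_apply, comul3Ev_smul_right he]

/-- The elements `c₁ ⊗ c₂ ⊗_H d₁ ⊗ d₂h` span `(Ĉ ⊗ C) ⊗_H (D ⊗ D̂)`. -/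
theorem ext_toCD (δC : Function.Bijective (delta k H C)) (δD : Function.Bijective (delta k H D))
    {Z : Type*} [AddCommGroup Z] [Module k Z]
    {f g : (Pen k H C ⊗[k] (C ⊗[H] D)) ⊗[k] Pen k H D →ₗ[k] Z}
    (hfg : ∀ (c : C) (d : D) (h : H),
      f (toCD k H C D (Coalgebra.comul (R := k) c ⊗ₜ[k]
        (act k H D h).lTensor D (Coalgebra.comul (R := k) d))) =
      g (toCD k H C D (Coalgebra.comul (R := k) c ⊗ₜ[k]
        (act k H D h).lTensor D (Coalgebra.comul (R := k) d)))) : f = g := by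
  have h1 : ∀ (c : C) (z : D ⊗[k] D), f (toCD k H C D (Coalgebra.comul (R := k) c ⊗ₜ[k] z)) =
      g (toCD k H C D (Coalgebra.comul (R := k) c ⊗ₜ[k] z)) := by
    intro c z
    obtain ⟨w, rfl⟩ := δD.2 z
    revert w
    refine tmul_ext fun d h => ?_
    rw [delta_tmul, hfg]
  -- A scalar on the second leg of `C ⊗ C` slides across `⊗_H` onto `D`. Thus `C ⊗ C`, spanned by
  -- the `c₁ ⊗ c₂h`, contributes no scalar beyond the one already allowed on the `D` side.
  have h2 : ∀ (w : C ⊗[k] C) (h : H) (d q : D),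
      toCD k H C D ((act k H C h).lTensor C w ⊗ₜ[k] (d ⊗ₜ[k] q)) =
      toCD k H C D (w ⊗ₜ[k] ((h • d) ⊗ₜ[k] q)) := by
    intro w h d q
    revert w
    refine tmul_ext fun x y => ?_
    simp [toCD, TensorProduct.smul_tmul]
  have h3 : ∀ (w : C ⊗[k] C) (z : D ⊗[k] D), f (toCD k H C D (w ⊗ₜ[k] z)) =
      g (toCD k H C D (w ⊗ₜ[k] z)) := by
    intro w
    refine tmul_ext fun d q => ?_
    obtain ⟨v, rfl⟩ := δC.2 w
    revert v
    refine tmul_ext fun c h => ?_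
    rw [delta_tmul, h2, h1]
  have h4 : f ∘ₗ toCD k H C D = g ∘ₗ toCD k H C D := TensorProduct.ext' h3
  refine LinearMap.ext fun z => ?_
  obtain ⟨w, rfl⟩ := toCD_surjective z
  exact LinearMap.congr_fun h4 w

variable [ModuleCoalgebra k H C] [ModuleCoalgebra k H D]

/-- `y ⊗_H d ↦ (q ↦ σ(x ⊗ y ⊗_H d ⊗ q))`. -/
def swapAux (δC : Function.Bijective (delta k H C)) (δD : Function.Bijective (delta k H D)) (x : C) :
    C ⊗[H] D →ₗ[k] Pen k H D →ₗ[k] (D ⊗[k] (Pen k H D ⊗[H] Pen k H C)) ⊗[k] C :=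
  liftBal
    (LinearMap.mk₂ k
      (fun (y : C) (d : D) => swapCore k H C D (evComul3 (evLin δC) (x ⊗ₜ[k] y)) ∘ₗ
        comul3Ev (evLin δD) ∘ₗ TensorProduct.mk k D D d ∘ₗ (Pen.of k H D).symm.toLinearMap)
      (by intro y y' d; ext q; simp [tmul_add])
      (by intro a y d; ext q; simp)
      (by intro y d d'; ext q; simp)
      (by intro a y d; ext q; simp))
    (by
      intro h y d
      ext q
      simp only [LinearMap.mk₂_apply, LinearMap.comp_apply, TensorProduct.mk_apply]
      rw [evComul3_smul_right (isTranslation_evLin δC), swapCore_balanced,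
        comul3Ev_smul_left (evLin_smul_left δD)])

theorem swapAux_tmul (δC : Function.Bijective (delta k H C))
    (δD : Function.Bijective (delta k H D)) (x y : C) (d q : D) :
    swapAux δC δD x (y ⊗ₜ[H] d) (Pen.of k H D q) =
      swapCore k H C D (evComul3 (evLin δC) (x ⊗ₜ[k] y)) (comul3Ev (evLin δD) (d ⊗ₜ[k] q)) := rfl

/-- `x ↦ (y ⊗_H d ↦ (q ↦ σ(x ⊗ y ⊗_H d ⊗ q)))`. -/
def swapLin (δC : Function.Bijective (delta k H C)) (δD : Function.Bijective (delta k H D)) :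
    Pen k H C →ₗ[H] C ⊗[H] D →ₗ[k] Pen k H D →ₗ[k]
      (D ⊗[k] (Pen k H D ⊗[H] Pen k H C)) ⊗[k] C where
  toFun x := swapAux δC δD ((Pen.of k H C).symm x)
  map_add' x x' := by
    refine linearMap_ext_pen fun y d q => ?_
    simp only [map_add, LinearMap.add_apply, swapAux_tmul, add_tmul]
  map_smul' h x := by
    obtain ⟨x, rfl⟩ := (Pen.of k H C).surjective x
    refine linearMap_ext_pen fun y d q => ?_
    rw [Pen.smul_of, LinearEquiv.symm_apply_apply, LinearEquiv.symm_apply_apply,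
      RingHom.id_apply, LinearMap.smul_apply, LinearMap.smul_apply, swapAux_tmul,
      evComul3_smul_left (evLin_smul_left δC), swapCore_smul, swapAux_tmul]

/-- The map `x ⊗ y ⊗_H d ⊗ q ↦ e(x, y₁)d₁ ⊗ d₂ ⊗_H y₂ ⊗ y₃S(e(d₃, q))`. -/
def swapLinearMap (δC : Function.Bijective (delta k H C))
    (δD : Function.Bijective (delta k H D)) :
    (Pen k H C ⊗[k] (C ⊗[H] D)) ⊗[k] Pen k H D →ₗ[H]
      (D ⊗[k] (Pen k H D ⊗[H] Pen k H C)) ⊗[k] C :=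
  TensorProduct.AlgebraTensorModule.lift (TensorProduct.AlgebraTensorModule.lift (swapLin δC δD))

theorem swapLinearMap_toCD (δC : Function.Bijective (delta k H C))
    (δD : Function.Bijective (delta k H D)) (w : C ⊗[k] C) (z : D ⊗[k] D) :
    swapLinearMap δC δD (toCD k H C D (w ⊗ₜ[k] z)) =
      swapCore k H C D (evComul3 (evLin δC) w) (comul3Ev (evLin δD) z) := by
  revert w
  refine tmul_ext fun x y => ?_
  revert z
  refine tmul_ext fun d q => ?_
  rfl

/-- The `H`-bimodule map
`x ⊗ y ⊗_H d ⊗ q ↦ e(x, y₁)d₁ ⊗ d₂ ⊗_H y₂ ⊗ y₃S(e(d₃, q))`. -/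
def galoisSwap (δC : Function.Bijective (delta k H C)) (δD : Function.Bijective (delta k H D)) :
    SwapMap k H C (Pen k H C) D (Pen k H D) where
  toLinearMap := swapLinearMap δC δD
  map_right h w := by
    obtain ⟨w, rfl⟩ := toCD_surjective w
    rw [toCD_smul_right]
    revert w
    refine tmul_ext fun w z => ?_
    rw [LinearMap.lTensor_tmul, swapLinearMap_toCD, swapLinearMap_toCD,
      comul3Ev_lTensor_act (isTranslation_evLin δD), swapCore_lTensor]

/-- On a spanning element both evaluations in the closed formula contract, the first to `1` and the
second to `S(h)`. -/
theorem isGaloisSwap_galoisSwap (δC : Function.Bijective (delta k H C))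
    (δD : Function.Bijective (delta k H D)) : IsGaloisSwap (galoisSwap δC δD) := by
  intro c d h
  rw [galoisSwap, swapLinearMap_toCD, evComul3_comul (isTranslation_evLin δC),
    comul3Ev_comul (isTranslation_evLin δD)]
  generalize Coalgebra.comul (R := k) c = w
  generalize Coalgebra.comul (R := k) d = z
  revert w
  refine tmul_ext fun x y => ?_
  revert z
  refine tmul_ext fun d q => ?_
  simp [toDC]

omit [ModuleCoalgebra k H C] [ModuleCoalgebra k H D] in
theorem IsGaloisSwap.unique (δC : Function.Bijective (delta k H C))
    (δD : Function.Bijective (delta k H D)) {σ σ' : SwapMap k H C (Pen k H C) D (Pen k H D)}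
    (hσ : IsGaloisSwap σ) (hσ' : IsGaloisSwap σ') : σ' = σ := by
  have h1 : σ'.toLinearMap.restrictScalars k = σ.toLinearMap.restrictScalars k :=
    ext_toCD δC δD fun c d h => (hσ' c d h).trans (hσ c d h).symm
  have h2 : σ'.toLinearMap = σ.toLinearMap :=
    LinearMap.ext fun z => LinearMap.congr_fun h1 z
  cases σ
  cases σ'
  congr

end Swap

/-! ### Tensor products of bimodules -/

section Chain

variable {k H : Type u} [CommRing k] [CommRing H] [Algebra k H]

variable (k H) in
/-- The map `(m ⊗ n, y) ↦ m ⊗ (n ⊗_H y)`. -/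
def chain (M N Y : Type u)
    [AddCommGroup M] [Module k M]
    [AddCommGroup N] [Module k N] [Module H N] [IsScalarTower k H N]
    [AddCommGroup Y] [Module k Y] [Module H Y] [IsScalarTower k H Y] :
    M ⊗[k] N →ₗ[k] Y →ₗ[k] M ⊗[k] (N ⊗[H] Y) :=
  (LinearMap.lTensorHom M ∘ₗ
    ((TensorProduct.mk k N Y).compr₂ ((proj k H N Y).restrictScalars k)).flip).flip

variable {M N Y Z : Type u} [AddCommGroup M] [Module k M]
  [AddCommGroup N] [Module k N] [Module H N] [IsScalarTower k H N]
  [AddCommGroup Y] [Module k Y] [Module H Y] [IsScalarTower k H Y]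
  [AddCommGroup Z] [Module k Z] [Module H Z] [IsScalarTower k H Z]

@[simp]
theorem chain_tmul (m : M) (n : N) (y : Y) :
    chain k H M N Y (m ⊗ₜ[k] n) y = m ⊗ₜ[k] (n ⊗ₜ[H] y) := rfl

variable {T X P Q : Type u}
  [AddCommGroup T] [Module k T] [Module H T] [IsScalarTower k H T]
  [AddCommGroup X] [Module k X] [Module H X] [IsScalarTower k H X]
  [AddCommGroup P] [Module k P] [Module H P] [IsScalarTower k H P]
  [AddCommGroup Q] [Module k Q] [Module H Q] [IsScalarTower k H Q]

variable (k H M N P Q) in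
/-- The map `m ⊗ n ⊗_H p ⊗ q ↦ m ⊗ n ⊗_H p ⊗ q ⊗_H y`. -/
def chainTensor (y : Y) : M ⊗[k] (N ⊗[H] (P ⊗[k] Q)) →ₗ[k]
    M ⊗[k] (N ⊗[H] (P ⊗[k] (Q ⊗[H] Y))) :=
  ((TensorProduct.AlgebraTensorModule.lTensor H P
    (((TensorProduct.mk H Q Y).flip y).restrictScalars k)).lTensor N).restrictScalars k |>.lTensor M

theorem chainTensor_chain (w : M ⊗[k] N) (z : P ⊗[k] Q) (y : Y) :
    chainTensor k H M N P Q y (chain k H M N (P ⊗[k] Q) w z) =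
      chain k H M N _ w (chain k H P Q Y z y) := by
  revert w
  refine tmul_ext fun m n => ?_
  revert z
  refine tmul_ext fun p q => ?_
  simp [chainTensor]

variable [Module H M] [IsScalarTower k H M]

theorem whisker_chain (f : Y →ₗ[H] Z) (w : M ⊗[k] N) (y : Y) :
    whisker k H M N f (chain k H M N Y w y) = chain k H M N Z w (f y) := by
  revert w
  refine tmul_ext fun m n => ?_
  simp [whisker]

theorem pairingLeft_chain (b : M →ₗ[H] N →ₗ[H] H) (w : M ⊗[k] N) (y : Y) :
    pairingLeft k b Y (chain k H M N Y w y) = pairing k b w • y := by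
  revert w
  refine tmul_ext fun m n => ?_
  simp

theorem lTensor_pairingRight_chain (b : Y →ₗ[H] Z →ₗ[H] H) (w : M ⊗[k] N) (z : Y ⊗[k] Z) :
    TensorProduct.AlgebraTensorModule.lTensor H M ((pairingRight k b N).restrictScalars k)
      (chain k H M N (Y ⊗[k] Z) w z) = (act k H N (pairing k b z)).lTensor M w := by
  revert w
  refine tmul_ext fun m n => ?_
  simp [pairingRight]

/-- Extending `σ` by `Y` amounts to computing `σ` and then inserting `y` at the right end. The
equation allows the values of `σ` on spanning elements to be used inside longer tensor products. -/
theorem SwapMap.tensor_chain (σ : SwapMap k H T X P Q) (w : X ⊗[k] T) (z : P ⊗[k] Q) (y : Y) :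
    σ.tensor Y (chainAssoc k H X T P (Q ⊗[H] Y)
      (chain k H X T _ w (chain k H P Q Y z y))) =
    chainAssoc k H P Q X (T ⊗[H] Y) (chainTensor k H P Q X T y
      (σ.nested (chain k H X T _ w z))) := by
  have h1 : ∀ ζ : P ⊗[k] (Q ⊗[H] (X ⊗[k] T)),
      (((TensorProduct.mk H T Y).flip y).restrictScalars k).lTensor (P ⊗[k] (Q ⊗[H] X))
        (chainAssoc k H P Q X T ζ) =
      chainAssoc k H P Q X (T ⊗[H] Y) (chainTensor k H P Q X T y ζ) := by
    refine tmul_ext fun p ζ => ?_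
    revert ζ
    refine tmul_ext fun q ζ => ?_
    revert ζ
    refine tmul_ext fun x t => ?_
    rfl
  revert w
  refine tmul_ext fun x t => ?_
  revert z
  refine tmul_ext fun p q => ?_
  rw [← h1]
  simp only [SwapMap.nested, LinearMap.comp_apply, LinearEquiv.coe_coe,
    LinearEquiv.apply_symm_apply]
  rfl

theorem SwapMap.nestedTensor_chain (σ : SwapMap k H T X P Q) (w : X ⊗[k] T) (z : P ⊗[k] Q)
    (y : Y) : σ.nestedTensor Y (chain k H X T _ w (chain k H P Q Y z y)) =
      chainTensor k H P Q X T y (σ.nested (chain k H X T _ w z)) := by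
  simp only [SwapMap.nestedTensor, LinearMap.comp_apply, LinearEquiv.coe_coe]
  rw [SwapMap.tensor_chain, LinearEquiv.symm_apply_apply]

theorem comulPenTensor_chain {𝒯 : HerdData k H T X} (h𝒯 : 𝒯.IsHerd) (w : X ⊗[k] T) (y : Y) :
    h𝒯.comulPenTensor Y (chain k H X T Y w y) =
      chainTensor k H X T X T y (h𝒯.comulPen w) := by
  revert w
  refine tmul_ext fun x t => ?_
  rfl

end Chain

/-! ### The smash coproduct of two Galois co-objects -/

section Comul

variable {k H : Type u} [CommRing k] [CommRing H] [HopfAlgebra k H]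
  {C : Type u} [AddCommGroup C] [Module k C] [Coalgebra k C]

/-- Both sides are the four-fold coproduct, grouped on the right as `(c₁ ⊗ c₂) ⊗ (c₃ ⊗ c₄)`, the
grouping in which two factors of the coring can be recognized. -/
theorem lTensor_comul3_comul (c : C) :
    (comul3 k C).lTensor C (Coalgebra.comul (R := k) c) =
      (TensorProduct.assoc k C C C).symm.toLinearMap.lTensor C
        (TensorProduct.assoc k C C (C ⊗[k] C)
          (TensorProduct.map (Coalgebra.comul (R := k)) (Coalgebra.comul (R := k))
            (Coalgebra.comul (R := k) c))) := by
  have h1 : ∀ z : C ⊗[k] C, TensorProduct.assoc k C C (C ⊗[k] C)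
      (TensorProduct.map (Coalgebra.comul (R := k)) (Coalgebra.comul (R := k)) z) =
      ((Coalgebra.comul (R := k) (A := C)).lTensor C).lTensor C
        (TensorProduct.assoc k C C C ((Coalgebra.comul (R := k) (A := C)).rTensor C z)) := by
    refine tmul_ext fun x y => ?_
    simp only [TensorProduct.map_tmul, LinearMap.rTensor_tmul]
    generalize Coalgebra.comul (R := k) x = v
    revert v
    refine tmul_ext fun v v' => ?_
    simp
  have h2 : comul3 k C = (TensorProduct.assoc k C C C).symm.toLinearMap ∘ₗ
      (Coalgebra.comul (R := k) (A := C)).lTensor C ∘ₗ Coalgebra.comul (R := k) := by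
    refine LinearMap.ext fun c => ?_
    simp only [LinearMap.comp_apply, LinearEquiv.coe_coe, ← assoc_comul3,
      LinearEquiv.symm_apply_apply]
  rw [h1, Coalgebra.coassoc_apply, h2, LinearMap.lTensor_comp, LinearMap.lTensor_comp]
  rfl

variable [Module H C] [IsScalarTower k H C]

variable (k C) in
/-- `c ↦ ĉ₁ ⊗ c₂g`. -/
def penComul (g : H) : C →ₗ[k] Pen k H C ⊗[k] C :=
  TensorProduct.map (Pen.of k H C).toLinearMap (act k H C g) ∘ₗ Coalgebra.comul (R := k)

variable (k C) in
/-- `c ↦ c₁ ⊗ (c₂g)^`. -/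
def comulPen (g : H) : C →ₗ[k] C ⊗[k] Pen k H C :=
  ((Pen.of k H C).toLinearMap ∘ₗ act k H C g).lTensor C ∘ₗ Coalgebra.comul (R := k)

variable [ModuleCoalgebra k H C]

theorem pairing_ev_penComul (hδ : Function.Bijective (delta k H C)) (g : H) (c : C) :
    pairing k (galoisHerd hδ).ev (penComul k C g c) = Coalgebra.counit (R := k) c • g := by
  have h1 : ∀ w : C ⊗[k] C, pairing k (galoisHerd hδ).ev
      (TensorProduct.map (Pen.of k H C).toLinearMap (act k H C g) w) =
      evLin hδ ((act k H C g).lTensor C w) := by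
    refine tmul_ext fun x y => ?_
    simp [galoisHerd_ev, evLin_smul_right]
  rw [penComul, LinearMap.comp_apply, h1, (isTranslation_evLin hδ).lTensor_act_comul]

theorem pairing_coev_comulPen (hδ : Function.Bijective (delta k H C)) (g : H) (c : C) :
    pairing k (galoisHerd hδ).coev (comulPen k C g c) =
      Coalgebra.counit (R := k) c • HopfAlgebra.antipode k g := by
  have h1 : ∀ w : C ⊗[k] C, pairing k (galoisHerd hδ).coev
      (((Pen.of k H C).toLinearMap ∘ₗ act k H C g).lTensor C w) =
      HopfAlgebra.antipode k (evLin hδ ((act k H C g).lTensor C w)) := by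
    refine tmul_ext fun x y => ?_
    simp [galoisHerd_coev]
  rw [comulPen, LinearMap.comp_apply, h1, (isTranslation_evLin hδ).lTensor_act_comul, map_smul]

theorem gammaRight_galoisHerd (hδ : Function.Bijective (delta k H C)) (c : C) :
    (galoisHerd hδ).gammaRight c = TensorProduct.AlgebraTensorModule.assoc k H H C (Pen k H C) C
      ((((proj k H C (Pen k H C)).restrictScalars k) ∘ₗ
        (Pen.of k H C).toLinearMap.lTensor C).rTensor C (comul3 k C c)) := by
  rw [HerdData.gammaRight, LinearMap.comp_apply, LinearMap.comp_apply, galoisHerd_shepherd,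
    LinearMap.rTensor_comp_apply]
  rfl

/-- `γ_A(c) = c₁ ⊗_H (ĉ₂ ⊗ c₃)`. -/
theorem gammaRight_galoisHerd_eq (hδ : Function.Bijective (delta k H C)) (c : C) :
    (galoisHerd hδ).gammaRight c = (proj k H C (Pen k H C ⊗[k] C)) ((penComul k C 1).lTensor C
      (Coalgebra.comul (R := k) c)) := by
  have h1 : ∀ w : (C ⊗[k] C) ⊗[k] C,
      TensorProduct.AlgebraTensorModule.assoc k H H C (Pen k H C) C
      ((((proj k H C (Pen k H C)).restrictScalars k) ∘ₗ
        (Pen.of k H C).toLinearMap.lTensor C).rTensor C w) =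
      proj k H C (Pen k H C ⊗[k] C) (((Pen.of k H C).toLinearMap.rTensor C).lTensor C
        (TensorProduct.assoc k C C C w)) := by
    refine tmul_ext fun w z => ?_
    revert w
    refine tmul_ext fun x y => ?_
    simp
  rw [gammaRight_galoisHerd, h1, assoc_comul3, penComul, act_one, LinearMap.lTensor_comp]
  rfl

/-- `γ_B(c) = c₁ ⊗ (ĉ₂ ⊗_H c₃)`. -/
theorem gammaLeft_galoisHerd (hδ : Function.Bijective (delta k H C)) (c : C) :
    (galoisHerd hδ).gammaLeft c = TensorProduct.lift (chain k H C (Pen k H C) C ∘ₗ comulPen k C 1)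
      (Coalgebra.comul (R := k) c) := by
  have h1 : ∀ w : C ⊗[k] C,
      ((proj k H (Pen k H C) C).restrictScalars k).lTensor C
        (TensorProduct.assoc k C (Pen k H C) C (((Pen.of k H C).toLinearMap.lTensor C).rTensor C
          ((Coalgebra.comul (R := k)).rTensor C w))) =
      TensorProduct.lift (chain k H C (Pen k H C) C ∘ₗ comulPen k C 1) w := by
    refine tmul_ext fun x y => ?_
    simp only [LinearMap.rTensor_tmul, TensorProduct.lift.tmul, LinearMap.comp_apply, comulPen,
      act_one, LinearMap.comp_id]
    generalize Coalgebra.comul (R := k) x = v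
    revert v
    refine tmul_ext fun v v' => ?_
    simp
  rw [← h1]
  rfl

/-- The coring coproduct of `ĉ₁ ⊗ c₂g` is `ĉ₁ ⊗ c₂ ⊗_H ĉ₃ ⊗ c₄g`: right linearity of `γ_A` carries
`g` to the last leg. So the coproduct amounts to `Δ(c)`, with `g` kept on the second copy. -/
theorem comulPen_penComul (hδ : Function.Bijective (delta k H C)) (g : H) (c : C) :
    (isHerd_galoisHerd hδ).comulPen (penComul k C g c) =
      TensorProduct.lift ((chain k H (Pen k H C) C (Pen k H C ⊗[k] C)).compl₁₂
        (penComul k C 1) (penComul k C g)) (Coalgebra.comul (R := k) c) := by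
  have h1 : ∀ w : C ⊗[k] C, (isHerd_galoisHerd hδ).comulPen
      (TensorProduct.map (Pen.of k H C).toLinearMap (act k H C g) w) =
      TensorProduct.map (Pen.of k H C).toLinearMap
        (((TensorProduct.AlgebraTensorModule.lTensor H (Pen k H C)
          (act k H C g)).lTensor C).restrictScalars k ∘ₗ
        (TensorProduct.AlgebraTensorModule.assoc k H H C (Pen k H C) C).toLinearMap.restrictScalars
          k ∘ₗ (((proj k H C (Pen k H C)).restrictScalars k) ∘ₗ
            (Pen.of k H C).toLinearMap.lTensor C).rTensor C) ((comul3 k C).lTensor C w) := by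
    refine tmul_ext fun x y => ?_
    simp only [TensorProduct.map_tmul, HerdData.IsHerd.comulPen, LinearMap.lTensor_tmul,
      TensorProduct.AlgebraTensorModule.lTensor_tmul, act_apply,
      (isHerd_galoisHerd hδ).gammaRight_smul, gammaRight_galoisHerd]
    rfl
  have h2 : ∀ w : (C ⊗[k] C) ⊗[k] (C ⊗[k] C),
      TensorProduct.map (Pen.of k H C).toLinearMap
        (((TensorProduct.AlgebraTensorModule.lTensor H (Pen k H C)
          (act k H C g)).lTensor C).restrictScalars k ∘ₗ
        (TensorProduct.AlgebraTensorModule.assoc k H H C (Pen k H C) C).toLinearMap.restrictScalars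
          k ∘ₗ (((proj k H C (Pen k H C)).restrictScalars k) ∘ₗ
            (Pen.of k H C).toLinearMap.lTensor C).rTensor C)
        ((TensorProduct.assoc k C C C).symm.toLinearMap.lTensor C
          (TensorProduct.assoc k C C (C ⊗[k] C) w)) =
      TensorProduct.lift ((chain k H (Pen k H C) C (Pen k H C ⊗[k] C)).compl₁₂
        (TensorProduct.map (Pen.of k H C).toLinearMap (act k H C 1))
        (TensorProduct.map (Pen.of k H C).toLinearMap (act k H C g))) w := by
    refine tmul_ext fun w v => ?_
    revert w
    refine tmul_ext fun x y => ?_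
    revert v
    refine tmul_ext fun x' y' => ?_
    simp
  have h3 : ∀ w : C ⊗[k] C, TensorProduct.lift
      ((chain k H (Pen k H C) C (Pen k H C ⊗[k] C)).compl₁₂
        (TensorProduct.map (Pen.of k H C).toLinearMap (act k H C 1))
        (TensorProduct.map (Pen.of k H C).toLinearMap (act k H C g)))
      (TensorProduct.map (Coalgebra.comul (R := k)) (Coalgebra.comul (R := k)) w) =
      TensorProduct.lift ((chain k H (Pen k H C) C (Pen k H C ⊗[k] C)).compl₁₂
        (penComul k C 1) (penComul k C g)) w := by
    refine tmul_ext fun x y => ?_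
    rfl
  rw [penComul, LinearMap.comp_apply, h1, lTensor_comul3_comul, h2, h3]
  rfl

/-- The counterpart for `D ⊗ D̂`, stated with a free linear map `f` on the last leg so as to cover
both the coproduct itself and its extension by a further tensor factor over `H`. -/
theorem comulTensor_lTensor_comul (hδ : Function.Bijective (delta k H C))
    {N : Type u} [AddCommGroup N] [Module k N] (f : C →ₗ[k] N) (c : C) :
    (isHerd_galoisHerd hδ).comulTensor N (f.lTensor C (Coalgebra.comul (R := k) c)) =
      TensorProduct.lift ((chain k H C (Pen k H C) (C ⊗[k] N)).compl₁₂ (comulPen k C 1)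
        (f.lTensor C ∘ₗ Coalgebra.comul (R := k))) (Coalgebra.comul (R := k) c) := by
  have h2 : ∀ (w : C ⊗[k] Pen k H C) (y : C) (n : N),
      TensorProduct.AlgebraTensorModule.lTensor H C
        ((TensorProduct.AlgebraTensorModule.assoc k H H (Pen k H C) C N).toLinearMap.restrictScalars
          k) (TensorProduct.AlgebraTensorModule.assoc k k H C (Pen k H C ⊗[H] C) N
            (chain k H C (Pen k H C) C w y ⊗ₜ[k] n)) =
      chain k H C (Pen k H C) (C ⊗[k] N) w (y ⊗ₜ[k] n) := by
    intro w y n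
    revert w
    refine tmul_ext fun x x' => ?_
    simp
  have h3 : ∀ w : C ⊗[k] C, (isHerd_galoisHerd hδ).comulTensor N (f.lTensor C w) =
      TensorProduct.lift ((chain k H C (Pen k H C) (C ⊗[k] N)).compl₁₂ (comulPen k C 1)
        (f.lTensor C)) (TensorProduct.assoc k C C C ((Coalgebra.comul (R := k)).rTensor C w)) := by
    refine tmul_ext fun x y => ?_
    have h4 : (isHerd_galoisHerd hδ).gammaLeftLinear x = (galoisHerd hδ).gammaLeft x := rfl
    simp only [HerdData.IsHerd.comulTensor, LinearMap.comp_apply, LinearMap.lTensor_tmul,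
      TensorProduct.AlgebraTensorModule.rTensor_tmul, LinearEquiv.coe_coe, h4,
      gammaLeft_galoisHerd, LinearMap.rTensor_tmul]
    generalize Coalgebra.comul (R := k) x = v
    revert v
    refine tmul_ext fun v v' => ?_
    simp only [TensorProduct.lift.tmul, LinearMap.comp_apply, h2, TensorProduct.assoc_tmul,
      LinearMap.compl₁₂_apply, LinearMap.lTensor_tmul]
  have h5 : ∀ w : C ⊗[k] C, TensorProduct.lift ((chain k H C (Pen k H C) (C ⊗[k] N)).compl₁₂
      (comulPen k C 1) (f.lTensor C)) ((Coalgebra.comul (R := k)).lTensor C w) =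
      TensorProduct.lift ((chain k H C (Pen k H C) (C ⊗[k] N)).compl₁₂ (comulPen k C 1)
        (f.lTensor C ∘ₗ Coalgebra.comul (R := k))) w := by
    refine tmul_ext fun x y => ?_
    rfl
  rw [h3, Coalgebra.coassoc_apply, h5]

end Comul

/-! ### The smash coproduct axioms on spanning elements. -/

section Smash

variable {k H : Type u} [CommRing k] [CommRing H] [HopfAlgebra k H]
  {C D : Type u} [AddCommGroup C] [Module k C] [Module H C] [IsScalarTower k H C] [Coalgebra k C]
  [AddCommGroup D] [Module k D] [Module H D] [IsScalarTower k H D] [Coalgebra k D]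

theorem toCD_eq_chain (c : C) (d : D) (h : H) :
    toCD k H C D (Coalgebra.comul (R := k) c ⊗ₜ[k]
      (act k H D h).lTensor D (Coalgebra.comul (R := k) d)) =
    chainAssoc k H (Pen k H C) C D (Pen k H D)
      (chain k H _ _ _ (penComul k C (1 : H) c) (comulPen k D h d)) := by
  simp only [penComul, comulPen, act_one, LinearMap.comp_apply]
  generalize Coalgebra.comul (R := k) c = w
  generalize Coalgebra.comul (R := k) d = z
  revert w
  refine tmul_ext fun x y => ?_
  revert z
  refine tmul_ext fun d q => ?_
  rfl

theorem toDC_eq_chain (c : C) (d : D) (h : H) :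
    toDC k H C D (Coalgebra.comul (R := k) d ⊗ₜ[k]
      (act k H C h).lTensor C (Coalgebra.comul (R := k) c)) =
    chainAssoc k H D (Pen k H D) (Pen k H C) C
      (chain k H _ _ _ (comulPen k D (1 : H) d) (penComul k C h c)) := by
  simp only [penComul, comulPen, act_one, LinearMap.comp_apply, LinearMap.comp_id]
  generalize Coalgebra.comul (R := k) c = w
  generalize Coalgebra.comul (R := k) d = z
  revert w
  refine tmul_ext fun x y => ?_
  revert z
  refine tmul_ext fun d q => ?_
  rfl

/-- The defining formula of `σ` in the form used below: the pair from `c` and the pair from `d`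
change places, and the scalar `h` on the `D`-pair becomes `S(h)` on the `C`-pair. -/
theorem IsGaloisSwap.nested_chain {σ : SwapMap k H C (Pen k H C) D (Pen k H D)}
    (hσ : IsGaloisSwap σ) (c : C) (d : D) (h : H) :
    σ.nested (chain k H _ _ _ (penComul k C 1 c) (comulPen k D h d)) =
      chain k H _ _ _ (comulPen k D 1 d) (penComul k C (HopfAlgebra.antipode k h) c) := by
  have h1 := hσ c d h
  rw [toCD_eq_chain, toDC_eq_chain] at h1
  simp only [SwapMap.nested, LinearMap.comp_apply, LinearEquiv.coe_coe]
  rw [h1, LinearEquiv.symm_apply_apply]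

theorem IsGaloisSwap.nestedTensor_chain {σ : SwapMap k H C (Pen k H C) D (Pen k H D)}
    (hσ : IsGaloisSwap σ) {Y : Type u} [AddCommGroup Y] [Module k Y] [Module H Y]
    [IsScalarTower k H Y] (c : C) (d : D) (y : Y) :
    σ.nestedTensor Y (chain k H _ _ _ (penComul k C 1 c)
      (chain k H _ _ _ (comulPen k D 1 d) y)) =
      chain k H _ _ _ (comulPen k D 1 d) (chain k H _ _ _ (penComul k C 1 c) y) := by
  rw [SwapMap.nestedTensor_chain, hσ.nested_chain, chainTensor_chain, HopfAlgebra.antipode_one]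

theorem ext_chain (δC : Function.Bijective (delta k H C)) (δD : Function.Bijective (delta k H D))
    {Z : Type*} [AddCommGroup Z] [Module k Z] [Module H Z] [IsScalarTower k H Z]
    {f g : Pen k H C ⊗[k] (C ⊗[H] (D ⊗[k] Pen k H D)) →ₗ[H] Z}
    (hfg : ∀ (c : C) (d : D) (h : H),
      f (chain k H _ _ _ (penComul k C 1 c) (comulPen k D h d)) =
      g (chain k H _ _ _ (penComul k C 1 c) (comulPen k D h d))) : f = g := by
  have h1 : (f ∘ₗ (chainAssoc k H (Pen k H C) C D (Pen k H D)).symm.toLinearMap).restrictScalars k =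
      (g ∘ₗ (chainAssoc k H (Pen k H C) C D (Pen k H D)).symm.toLinearMap).restrictScalars k := by
    refine ext_toCD δC δD fun c d h => ?_
    rw [toCD_eq_chain]
    simpa using hfg c d h
  refine LinearMap.ext fun z => ?_
  simpa using LinearMap.congr_fun h1 (chainAssoc k H (Pen k H C) C D (Pen k H D) z)

variable [ModuleCoalgebra k H C] [ModuleCoalgebra k H D]

theorem comulPenTensor_chain_penComul (hδ : Function.Bijective (delta k H C))
    {Y : Type u} [AddCommGroup Y] [Module k Y] [Module H Y] [IsScalarTower k H Y] (c : C) (y : Y) :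
    (isHerd_galoisHerd hδ).comulPenTensor Y (chain k H _ _ _ (penComul k C 1 c) y) =
      TensorProduct.lift ((chain k H (Pen k H C) C (Pen k H C ⊗[k] (C ⊗[H] Y))).compl₁₂
        (penComul k C 1) ((chain k H (Pen k H C) C Y).flip y ∘ₗ penComul k C 1))
        (Coalgebra.comul (R := k) c) := by
  rw [comulPenTensor_chain, comulPen_penComul]
  generalize Coalgebra.comul (R := k) c = w
  revert w
  refine tmul_ext fun a b => ?_
  simp [chainTensor_chain]

-- Both sides equal `d₁ ⊗ d̂₂ ⊗_H ĉ₁ ⊗ c₂ ⊗_H ĉ₃ ⊗ c₄S(h)`. The first swap already moves the scalar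
-- to the last leg, so the second is a plain interchange.
omit [ModuleCoalgebra k H D] in
theorem IsGaloisSwap.left_pentagon (δC : Function.Bijective (delta k H C))
    (δD : Function.Bijective (delta k H D)) {σ : SwapMap k H C (Pen k H C) D (Pen k H D)}
    (hσ : IsGaloisSwap σ) :
    σ.nestedTensor (Pen k H C ⊗[k] C) ∘ₗ whisker k H (Pen k H C) C σ.nested ∘ₗ
        (isHerd_galoisHerd δC).comulPenTensor (D ⊗[k] Pen k H D) =
      whisker k H D (Pen k H D) (isHerd_galoisHerd δC).comulPen ∘ₗ σ.nested := by
  refine ext_chain δC δD fun c d h => ?_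
  simp only [LinearMap.comp_apply]
  rw [comulPenTensor_chain_penComul, hσ.nested_chain, whisker_chain, comulPen_penComul]
  generalize Coalgebra.comul (R := k) c = w
  revert w
  refine tmul_ext fun a b => ?_
  simp only [TensorProduct.lift.tmul, LinearMap.compl₁₂_apply, LinearMap.comp_apply,
    LinearMap.flip_apply]
  rw [whisker_chain, hσ.nested_chain, hσ.nestedTensor_chain]

-- Here the coproduct splits `d` and leaves `h` on the second copy. The `C`-pair passes the first
-- copy as a plain interchange, and picks up `S(h)` on passing the second.
omit [ModuleCoalgebra k H C] in
theorem IsGaloisSwap.right_pentagon (δC : Function.Bijective (delta k H C))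
    (δD : Function.Bijective (delta k H D)) {σ : SwapMap k H C (Pen k H C) D (Pen k H D)}
    (hσ : IsGaloisSwap σ) :
    whisker k H D (Pen k H D) σ.nested ∘ₗ σ.nestedTensor (D ⊗[k] Pen k H D) ∘ₗ
        whisker k H (Pen k H C) C ((isHerd_galoisHerd δD).comulTensor (Pen k H D)) =
      (isHerd_galoisHerd δD).comulTensor (Pen k H D ⊗[H] (Pen k H C ⊗[k] C)) ∘ₗ σ.nested := by
  -- Rewrites the value of `σ` as a linear map applied to the second leg of `Δ(d)`, the shape
  -- required by `comulTensor_lTensor_comul`.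
  have h1 : ∀ (d : D) (v : Pen k H C ⊗[k] C), chain k H _ _ _ (comulPen k D 1 d) v =
      (((TensorProduct.mk H (Pen k H D) (Pen k H C ⊗[k] C)).flip v).restrictScalars k ∘ₗ
        (Pen.of k H D).toLinearMap).lTensor D (Coalgebra.comul (R := k) d) := by
    intro d v
    rw [comulPen, act_one, LinearMap.comp_id, LinearMap.comp_apply]
    generalize Coalgebra.comul (R := k) d = w
    revert w
    refine tmul_ext fun a b => ?_
    simp
  refine ext_chain δC δD fun c d h => ?_
  simp only [LinearMap.comp_apply]
  rw [whisker_chain, hσ.nested_chain, h1, comulTensor_lTensor_comul]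
  rw [comulPen, LinearMap.comp_apply, comulTensor_lTensor_comul]
  generalize Coalgebra.comul (R := k) d = w
  revert w
  refine tmul_ext fun a b => ?_
  simp only [TensorProduct.lift.tmul, LinearMap.compl₁₂_apply, LinearMap.comp_apply]
  rw [← h1, hσ.nestedTensor_chain, whisker_chain]
  congr 1
  exact hσ.nested_chain c b h

theorem IsGaloisSwap.isSmash (δC : Function.Bijective (delta k H C))
    (δD : Function.Bijective (delta k H D)) {σ : SwapMap k H C (Pen k H C) D (Pen k H D)}
    (hσ : IsGaloisSwap σ) : σ.IsSmash (isHerd_galoisHerd δC) (isHerd_galoisHerd δD) where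
  left_pentagon := hσ.left_pentagon δC δD
  right_pentagon := hσ.right_pentagon δC δD
  -- Both sides are `ε(d) ĉ₁ ⊗ c₂S(h)`: the scalar comes from `σ` on the left and from the
  -- coevaluation on the right.
  left_counit := by
    refine ext_chain δC δD fun c d h => ?_
    rw [LinearMap.comp_apply, hσ.nested_chain, pairingLeft_chain, lTensor_pairingRight_chain,
      pairing_coev_comulPen, pairing_coev_comulPen, penComul, penComul, LinearMap.comp_apply,
      LinearMap.comp_apply]
    generalize Coalgebra.comul (R := k) c = w
    revert w
    refine tmul_ext fun a b => ?_
    simp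
  -- Both sides are `ε(c) d₁ ⊗ (d₂h)^`. On the left the scalar `S(h)` acts on the pen, hence on `D`
  -- as `S(S(h)) = h`.
  right_counit := by
    refine ext_chain δC δD fun c d h => ?_
    rw [LinearMap.comp_apply, hσ.nested_chain, pairingLeft_chain, lTensor_pairingRight_chain,
      pairing_ev_penComul, pairing_ev_penComul, comulPen, comulPen, LinearMap.comp_apply,
      LinearMap.comp_apply]
    generalize Coalgebra.comul (R := k) d = w
    revert w
    refine tmul_ext fun a b => ?_
    simp [Pen.smul_of, antipode_antipode]

end Smash

/-! ### The composite herd -/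

section Composite

/-- An isomorphism of pens transports the herd axioms. -/
theorem HerdData.IsIdentifiedBy.isHerd {k H T X X' : Type u} [CommRing k] [CommRing H]
    [Algebra k H] [AddCommGroup T] [Module k T] [Module H T] [IsScalarTower k H T]
    [AddCommGroup X] [Module k X] [Module H X] [IsScalarTower k H X]
    [AddCommGroup X'] [Module k X'] [Module H X'] [IsScalarTower k H X']
    {𝒯 : HerdData k H T X} {𝒯' : HerdData k H T X'} {τ : X ≃ₗ[H] X'}
    (hτ : 𝒯.IsIdentifiedBy 𝒯' τ) (h𝒯 : 𝒯.IsHerd) : 𝒯'.IsHerd where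
  coev_smul x y z := by
    obtain ⟨y, rfl⟩ := τ.surjective y
    rw [hτ.coev_eq, hτ.ev_eq, h𝒯.coev_smul]
  ev_smul x y z := by
    obtain ⟨x, rfl⟩ := τ.surjective x
    obtain ⟨z, rfl⟩ := τ.surjective z
    rw [hτ.coev_eq, hτ.ev_eq, ← map_smul, ← map_smul, h𝒯.ev_smul]
  coev_shepherd x := by
    have h1 : ((pairing k 𝒯'.coev).restrictScalars k) ∘ₗ
        (τ.toLinearMap.restrictScalars k).lTensor T = (pairing k 𝒯.coev).restrictScalars k :=
      TensorProduct.ext' fun t x => hτ.coev_eq t x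
    rw [hτ.shepherd_eq, ← LinearMap.rTensor_comp_apply, h1, h𝒯.coev_shepherd]
  ev_shepherd x := by
    have h1 : ∀ w : (T ⊗[k] X) ⊗[k] T, ((pairing k 𝒯'.ev).restrictScalars k).lTensor T
        (TensorProduct.assoc k T X' T
          (((τ.toLinearMap.restrictScalars k).lTensor T).rTensor T w)) =
        ((pairing k 𝒯.ev).restrictScalars k).lTensor T (TensorProduct.assoc k T X T w) := by
      refine tmul_ext fun w z => ?_
      revert w
      refine tmul_ext fun x y => ?_
      simp [hτ.ev_eq]
    rw [hτ.shepherd_eq, h1, h𝒯.ev_shepherd]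
  shepherd_assoc := by
    set p := τ.toLinearMap.restrictScalars k with hp
    have hγ : 𝒯'.shepherd = (p.lTensor T).rTensor T ∘ₗ 𝒯.shepherd :=
      LinearMap.ext hτ.shepherd_eq
    have h1 : (𝒯'.shepherd.rTensor X').rTensor T ∘ₗ (p.lTensor T).rTensor T =
        (TensorProduct.map ((p.lTensor T).rTensor T) p).rTensor T ∘ₗ
          (𝒯.shepherd.rTensor X).rTensor T := by
      rw [← LinearMap.rTensor_comp, ← LinearMap.rTensor_comp, hγ]
      congr 1
      ext a b
      simp
    have h2 : 𝒯'.shepherd.lTensor (T ⊗[k] X') ∘ₗ (p.lTensor T).rTensor T =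
        TensorProduct.map (p.lTensor T) ((p.lTensor T).rTensor T) ∘ₗ
          𝒯.shepherd.lTensor (T ⊗[k] X) := by
      refine TensorProduct.ext' fun x y => ?_
      simp [hγ]
    have h3 : (TensorProduct.assoc k (T ⊗[k] X') T X').symm.toLinearMap.rTensor T ∘ₗ
        (TensorProduct.assoc k (T ⊗[k] X') (T ⊗[k] X') T).symm.toLinearMap ∘ₗ
          TensorProduct.map (p.lTensor T) ((p.lTensor T).rTensor T) =
        (TensorProduct.map ((p.lTensor T).rTensor T) p).rTensor T ∘ₗ
          (TensorProduct.assoc k (T ⊗[k] X) T X).symm.toLinearMap.rTensor T ∘ₗ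
            (TensorProduct.assoc k (T ⊗[k] X) (T ⊗[k] X) T).symm.toLinearMap := by
      refine LinearMap.ext fun w => ?_
      simp only [LinearMap.comp_apply, LinearEquiv.coe_coe]
      revert w
      refine tmul_ext fun w v => ?_
      revert v
      refine tmul_ext fun v z => ?_
      revert v
      refine tmul_ext fun x y => ?_
      simp
    refine LinearMap.ext fun t => ?_
    have e1 := fun z => LinearMap.congr_fun h1 z
    have e2 := fun z => LinearMap.congr_fun h2 z
    have e3 := fun z => LinearMap.congr_fun h3 z
    have e4 := LinearMap.congr_fun h𝒯.shepherd_assoc t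
    simp only [LinearMap.comp_apply, LinearEquiv.coe_coe] at e1 e2 e3 e4
    simp only [LinearMap.comp_apply, LinearEquiv.coe_coe, hτ.shepherd_eq]
    -- The map `p` is pushed to the outside on the left side, associativity of the old shepherd is
    -- applied, and `p` is drawn back in on the right side.
    rw [← hp, e1, e4, e2, e3]

variable {k H : Type u} [CommRing k] [CommRing H] [HopfAlgebra k H]
  {C D : Type u} [AddCommGroup C] [Module k C] [Module H C] [IsScalarTower k H C] [Coalgebra k C]
  [AddCommGroup D] [Module k D] [Module H D] [IsScalarTower k H D] [Coalgebra k D]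
  [ModuleCoalgebra k H C] [ModuleCoalgebra k H D]

theorem comul3_tmul_comp (c : C) (d : D) : comul3 k (C ⊗[H] D) (c ⊗ₜ[H] d) =
    TensorProduct.map₂ (TensorProduct.map₂
      ((TensorProduct.mk k C D).compr₂ ((proj k H C D).restrictScalars k))
      ((TensorProduct.mk k C D).compr₂ ((proj k H C D).restrictScalars k)))
      ((TensorProduct.mk k C D).compr₂ ((proj k H C D).restrictScalars k))
      (comul3 k C c) (comul3 k D d) := by
  have h0 : ∀ (c : C) (d : D), Coalgebra.comul (R := k) (c ⊗ₜ[H] d) = TensorProduct.map₂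
      ((TensorProduct.mk k C D).compr₂ ((proj k H C D).restrictScalars k))
      ((TensorProduct.mk k C D).compr₂ ((proj k H C D).restrictScalars k))
      (Coalgebra.comul (R := k) c) (Coalgebra.comul (R := k) d) := by
    intro c d
    rw [comul_tmul_comp]
    generalize Coalgebra.comul (R := k) c = w
    generalize Coalgebra.comul (R := k) d = z
    revert w
    refine tmul_ext fun x y => ?_
    revert z
    refine tmul_ext fun d q => ?_
    simp
  rw [comul3_apply, comul3_apply, comul3_apply, h0]
  generalize Coalgebra.comul (R := k) c = w
  generalize Coalgebra.comul (R := k) d = z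
  revert w
  refine tmul_ext fun x y => ?_
  revert z
  refine tmul_ext fun d q => ?_
  simp [h0]

theorem gammaRightTensor_tmul (hδ : Function.Bijective (delta k H C)) {Y : Type u} [AddCommGroup Y]
    [Module k Y] [Module H Y] [IsScalarTower k H Y] (c : C) (y : Y) :
    (isHerd_galoisHerd hδ).gammaRightTensor Y (c ⊗ₜ[H] y) =
      proj k H C (Pen k H C ⊗[k] (C ⊗[H] Y))
        (((chain k H (Pen k H C) C Y).flip y ∘ₗ penComul k C 1).lTensor C
          (Coalgebra.comul (R := k) c)) := by
  have h1 : ∀ w : Pen k H C ⊗[k] C, TensorProduct.AlgebraTensorModule.lTensor H (Pen k H C)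
      (((TensorProduct.mk H C Y).flip y).restrictScalars k) w = chain k H (Pen k H C) C Y w y := by
    refine tmul_ext fun x y => ?_
    simp
  have h2 : (isHerd_galoisHerd hδ).gammaRightTensor Y (c ⊗ₜ[H] y) =
      (TensorProduct.AlgebraTensorModule.lTensor H (Pen k H C)
        (((TensorProduct.mk H C Y).flip y).restrictScalars k)).lTensor C
          ((galoisHerd hδ).gammaRight c) := rfl
  rw [h2, gammaRight_galoisHerd_eq]
  generalize Coalgebra.comul (R := k) c = w
  revert w
  refine tmul_ext fun x y => ?_
  simp [h1]

omit [ModuleCoalgebra k H C] [ModuleCoalgebra k H D] in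
theorem IsGaloisSwap.tensor_chain {σ : SwapMap k H C (Pen k H C) D (Pen k H D)}
    (hσ : IsGaloisSwap σ) {Y : Type u} [AddCommGroup Y] [Module k Y] [Module H Y]
    [IsScalarTower k H Y] (c : C) (d : D) (y : Y) :
    σ.tensor Y (chainAssoc k H _ _ _ _ (chain k H _ _ _ (penComul k C 1 c)
      (chain k H _ _ _ (comulPen k D 1 d) y))) =
      chainAssoc k H _ _ _ _
        (chain k H _ _ _ (comulPen k D 1 d) (chain k H _ _ _ (penComul k C 1 c) y)) := by
  rw [SwapMap.tensor_chain, hσ.nested_chain, chainTensor_chain, HopfAlgebra.antipode_one]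

variable (k H C D) in
/-- `((a ⊗ b) ⊗ c, (p ⊗ q) ⊗ r) ↦ ((a ⊗_H p) ⊗ (q̂ ⊗_H b̂)) ⊗ (c ⊗_H r)`. -/
def interleave : (C ⊗[k] C) ⊗[k] C →ₗ[k] (D ⊗[k] D) ⊗[k] D →ₗ[k]
    ((C ⊗[H] D) ⊗[k] (Pen k H D ⊗[H] Pen k H C)) ⊗[k] (C ⊗[H] D) :=
  TensorProduct.map₂ (TensorProduct.map₂
    ((TensorProduct.mk k C D).compr₂ ((proj k H C D).restrictScalars k)) (penTmul k H C D))
    ((TensorProduct.mk k C D).compr₂ ((proj k H C D).restrictScalars k))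

/-- `Δ²` on `C ⊗_H D` is componentwise, and the twist reverses only the middle factor; the result is
the common value `c₁ ⊗_H d₁ ⊗ d̂₂ ⊗_H ĉ₂ ⊗ c₃ ⊗_H d₃` of the two shepherds. -/
theorem galoisHerd_shepherd_comp (δCD : Function.Bijective (delta k H (C ⊗[H] D)))
    (c : C) (d : D) :
    (((twist k H C D).toLinearMap.restrictScalars k).lTensor (C ⊗[H] D)).rTensor (C ⊗[H] D)
      ((galoisHerd δCD).shepherd (c ⊗ₜ[H] d)) =
      interleave k H C D (comul3 k C c) (comul3 k D d) := by
  rw [galoisHerd_shepherd, comul3_tmul_comp]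
  generalize comul3 k C c = w
  generalize comul3 k D d = z
  revert w
  refine tmul_ext fun w c => ?_
  revert z
  refine tmul_ext fun z r => ?_
  revert w
  refine tmul_ext fun a b => ?_
  revert z
  refine tmul_ext fun p q => ?_
  simp [interleave, twist_tmul, penTmul_apply]

variable (k H C D) in
/-- The reassociation `a ⊗_H ((p ⊗ (q ⊗_H b)) ⊗ t) ↦ ((a ⊗_H p) ⊗ (q ⊗_H b)) ⊗ t`. -/
def regroup : C ⊗[H] ((D ⊗[k] (Pen k H D ⊗[H] Pen k H C)) ⊗[k] (C ⊗[H] D)) →ₗ[k]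
    ((C ⊗[H] D) ⊗[k] (Pen k H D ⊗[H] Pen k H C)) ⊗[k] (C ⊗[H] D) :=
  (((TensorProduct.AlgebraTensorModule.assoc k H H C D
    (Pen k H D ⊗[H] Pen k H C)).symm.toLinearMap.restrictScalars k).rTensor (C ⊗[H] D)) ∘ₗ
  (TensorProduct.AlgebraTensorModule.assoc k H H C (D ⊗[k] (Pen k H D ⊗[H] Pen k H C))
    (C ⊗[H] D)).symm.toLinearMap.restrictScalars k

omit [ModuleCoalgebra k H C] [ModuleCoalgebra k H D] in
theorem regroup_chain (a b : C) (p q : D) :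
    regroup k H C D (a ⊗ₜ[H] chainAssoc k H _ _ _ _ (chain k H _ _ _ (comulPen k D 1 p)
      (chain k H _ _ _ (penComul k C 1 b) q))) =
      interleave k H C D ((TensorProduct.assoc k C C C).symm
        (a ⊗ₜ[k] Coalgebra.comul (R := k) b)) (Coalgebra.comul (R := k) p ⊗ₜ[k] q) := by
  simp only [penComul, comulPen, act_one, LinearMap.comp_apply, LinearMap.comp_id]
  generalize Coalgebra.comul (R := k) b = w
  generalize Coalgebra.comul (R := k) p = z
  revert w
  refine tmul_ext fun x y => ?_
  revert z
  refine tmul_ext fun p p' => ?_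
  rfl

/-- The composite shepherd is `c₁ ⊗_H σ(ĉ₂ ⊗ c₃ ⊗_H d₁ ⊗ d̂₂) ⊗_H d₃`. By coassociativity the
argument of `σ` is a spanning element with `h = 1`, on which `σ` merely interchanges the two pairs.
-/
theorem comp_shepherd (δC : Function.Bijective (delta k H C))
    (δD : Function.Bijective (delta k H D)) {σ : SwapMap k H C (Pen k H C) D (Pen k H D)}
    (hσ : IsGaloisSwap σ) (c : C) (d : D) :
    (HerdData.comp (isHerd_galoisHerd δC) (isHerd_galoisHerd δD) σ).shepherd (c ⊗ₜ[H] d) =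
      interleave k H C D (comul3 k C c) (comul3 k D d) := by
  have h1 : ∀ s t, regroup k H C D ((σ.tensor D ∘ₗ
      (chainAssoc k H (Pen k H C) C D (Pen k H D ⊗[H] D)).toLinearMap).lTensor C
        (proj k H C _ (((chain k H (Pen k H C) C _).flip
          (TensorProduct.lift (chain k H D (Pen k H D) D ∘ₗ comulPen k D 1) t) ∘ₗ
            penComul k C 1).lTensor C s))) =
      interleave k H C D ((TensorProduct.assoc k C C C).symm
        ((Coalgebra.comul (R := k)).lTensor C s)) ((Coalgebra.comul (R := k)).rTensor D t) := by
    intro s t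
    revert s
    refine tmul_ext fun a b => ?_
    simp only [LinearMap.lTensor_tmul, TensorProduct.mapOfCompatibleSMul_tmul,
      LinearMap.comp_apply, LinearMap.flip_apply, LinearEquiv.coe_coe]
    revert t
    refine tmul_ext fun p q => ?_
    rw [TensorProduct.lift.tmul, LinearMap.comp_apply, hσ.tensor_chain, regroup_chain,
      LinearMap.rTensor_tmul]
  have h2 : (HerdData.comp (isHerd_galoisHerd δC) (isHerd_galoisHerd δD) σ).shepherd
      (c ⊗ₜ[H] d) = regroup k H C D ((σ.tensor D ∘ₗ
      (chainAssoc k H (Pen k H C) C D (Pen k H D ⊗[H] D)).toLinearMap).lTensor C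
        ((isHerd_galoisHerd δC).gammaRightTensor _
          (c ⊗ₜ[H] (galoisHerd δD).gammaLeft d))) := rfl
  rw [h2, gammaLeft_galoisHerd, gammaRightTensor_tmul, h1, ← assoc_comul3,
    LinearEquiv.symm_apply_apply, ← comul3_apply]

/-- The evaluations agree by uniqueness of the translation map, the coevaluations because in
addition `S` is multiplicative, and the shepherds because both are the same interleaving. -/
theorem isIdentifiedBy_comp (δC : Function.Bijective (delta k H C))
    (δD : Function.Bijective (delta k H D)) (δCD : Function.Bijective (delta k H (C ⊗[H] D)))
    {σ : SwapMap k H C (Pen k H C) D (Pen k H D)} (hσ : IsGaloisSwap σ) :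
    (galoisHerd δCD).IsIdentifiedBy
      (HerdData.comp (isHerd_galoisHerd δC) (isHerd_galoisHerd δD) σ) (twist k H C D) where
  ev_eq x t := by
    obtain ⟨x, rfl⟩ := (Pen.of k H (C ⊗[H] D)).surjective x
    rw [galoisHerd_ev, (isTranslation_compEv δC δD).evLin_eq, compEv_tmul]
    rfl
  coev_eq t x := by
    obtain ⟨x, rfl⟩ := (Pen.of k H (C ⊗[H] D)).surjective x
    rw [galoisHerd_coev, (isTranslation_compEv δC δD).evLin_eq]
    revert t
    refine tmul_ext fun c d => ?_
    revert x
    refine tmul_ext fun c' d' => ?_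
    rw [compEv_tmul_tmul, twist_tmul, HerdData.comp, compPairing_tmul, map_smul, galoisHerd_coev,
      galoisHerd_coev, HopfAlgebra.antipode_mul_distrib, smul_eq_mul, mul_comm]
  shepherd_eq t := by
    revert t
    refine tmul_ext fun c d => ?_
    rw [comp_shepherd δC δD hσ, galoisHerd_shepherd_comp]

end Composite

end

end HerdTheory

/-! ### The main theorem. -/

theorem mainTheorem10 (k H C D : Type u) [CommRing k] [CommRing H] [HopfAlgebra k H]
    [AddCommGroup C] [Module k C] [Module H C] [IsScalarTower k H C] [Coalgebra k C]
    [HerdTheory.ModuleCoalgebra k H C]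
    [AddCommGroup D] [Module k D] [Module H D] [IsScalarTower k H D] [Coalgebra k D]
    [HerdTheory.ModuleCoalgebra k H D]
    (hC : HerdTheory.IsGaloisCoobject k H C) (hD : HerdTheory.IsGaloisCoobject k H D) :
    HerdTheory.IsGaloisCoobject k H (C ⊗[H] D) ∧
    ∃ (δC : Function.Bijective (HerdTheory.delta k H C))
      (δD : Function.Bijective (HerdTheory.delta k H D))
      (δCD : Function.Bijective (HerdTheory.delta k H (C ⊗[H] D)))
      (herdC : (HerdTheory.galoisHerd δC).IsHerd)
      (herdD : (HerdTheory.galoisHerd δD).IsHerd)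
      (σ : HerdTheory.SwapMap k H C (HerdTheory.Pen k H C) D (HerdTheory.Pen k H D))
      (τ : HerdTheory.Pen k H (C ⊗[H] D) ≃ₗ[H]
        HerdTheory.Pen k H D ⊗[H] HerdTheory.Pen k H C),
      (HerdTheory.galoisHerd δCD).IsHerd ∧
      HerdTheory.IsGaloisSwap σ ∧
      (∀ σ', HerdTheory.IsGaloisSwap σ' → σ' = σ) ∧
      σ.IsSmash herdC herdD ∧
      (∀ (c : C) (d : D), τ (HerdTheory.Pen.of k H (C ⊗[H] D) (c ⊗ₜ[H] d)) =
        HerdTheory.Pen.of k H D d ⊗ₜ[H] HerdTheory.Pen.of k H C c) ∧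
      (HerdTheory.HerdData.comp herdC herdD σ).IsHerd ∧
      (HerdTheory.galoisHerd δCD).IsIdentifiedBy (HerdTheory.HerdData.comp herdC herdD σ) τ := by
  have δC := hC.delta_bijective
  have δD := hD.delta_bijective
  have δCD := (HerdTheory.isTranslation_compEv δC δD).delta_bijective
  have hσ := HerdTheory.isGaloisSwap_galoisSwap δC δD
  have hτ := HerdTheory.isIdentifiedBy_comp δC δD δCD hσ
  obtain ⟨c₀, hc₀⟩ := hC.exists_counit_eq_one
  obtain ⟨d₀, hd₀⟩ := hD.exists_counit_eq_one
  -- The counit of `C ⊗_H D` is multiplicative on pure tensors, so `c₀ ⊗_H d₀` has counit `1`.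
  refine ⟨HerdTheory.isGaloisCoobject_of_delta_bijective δCD (c₀ := c₀ ⊗ₜ[H] d₀)
      (by rw [HerdTheory.counit_tmul_comp, hc₀, hd₀, mul_one]),
    δC, δD, δCD, HerdTheory.isHerd_galoisHerd δC, HerdTheory.isHerd_galoisHerd δD,
    HerdTheory.galoisSwap δC δD, HerdTheory.twist k H C D, HerdTheory.isHerd_galoisHerd δCD, hσ,
    fun σ' hσ' => hσ.unique δC δD hσ', hσ.isSmash δC δD, HerdTheory.twist_tmul,
    hτ.isHerd (HerdTheory.isHerd_galoisHerd δCD), hτ⟩
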